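/- Let $d\ge 2$. Use the Fourier transform $\widehat f(\xi)=\int_{\mathbb R^d} f(x)e^{-ix\cdot\xi}\,dx$ on $L^2(\mathbb R^d)$, and write $\|f\|_{\dot H^1}=\|(-\Delta)^{1/2}f\|_{L^2}$ and $H^1=L^2\cap\dot H^1$. For $u_0\in L^2(\mathbb R^d)$ let $u\in C(\mathbb R;L^2(\mathbb R^d))$ denote the solution of $i\partial_t u+\Delta u=0$, $u(0)=u_0$. Let $\mathfrak D=i\partial_t+\frac12\Delta$, and for $\beta\in\mathbb R$ let $|\mathfrak D|^\beta$ be the space-time Fourier multiplier operator on $\mathbb R^{1+d}$ with symbol $\left|\tau+\tfrac12|\xi|^2\right|^\beta$. Put $$K_d=\frac{2^{\frac{2-3d}{2}}\pi^{\frac{2-d}{2}}}{\Gamma(\frac d2)},$$ $$\mathfrak G=\{\exp(a|\eta|^2+b\cdot\eta+c): a,c\in\mathbb C,\ b\in\mathbb C^d,\ \mathrm{Re}\,a<0\},$$ $$\mathfrak G_r=\{\exp(a|\eta|^2+ib\cdot\eta+c): a,c\in\mathbb C,\ b\in\mathbb R^d,\ \mathrm{Re}\,a<0\}.$$ Then $$\big\|\,|\mathfrak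 D|^{\frac{2-d}{4}}(u^2)\big\|_{L^2(\mathbb R^{1+d})}^2\le K_d\,\|u_0\|_{L^2}^4\qquad\text{for all }u_0\in L^2(\mathbb R^d),\tag{1}$$ $$\big\|\,|\mathfrak D|^{\frac{4-d}{4}}(u^2)\big\|_{L^2(\mathbb R^{1+d})}^2\le K_d\,\|u_0\|_{\dot H^1}^2\|u_0\|_{L^2}^2\qquad\text{for all }u_0\in H^1(\mathbb R^d),\tag{2}$$ and in each of (1) and (2) the constant $K_d$ is optimal, i.e. it cannot be replaced by a smaller one. Call non-zero initial data $u_0$ (in $L^2$ for (1), in $H^1$ for (2)) an extremiser if equality holds. Then $u_0$ is an extremiser for (1) if and only if $\widehat u_0\in\mathfrak G$, and an extremiser for (2) if and only if $\widehat u_0\in\mathfrak G_r$ (up to equality almost everywhere). -/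

import Mathlib

open MeasureTheory
open scoped ENNReal FourierTransform SchwartzMap Laplacian ContDiff

/-- Euclidean space `ℝ^d`. -/
abbrev RSpace (d : ℕ) : Type := EuclideanSpace ℝ (Fin d)

/-- The space `L²(ℝ^d)` of complex-valued functions. -/
abbrev L2Space (d : ℕ) : Type := Lp ℂ 2 (volume : Measure (RSpace d))

/-- `u ∈ C(ℝ; L²(ℝ^d))` solves `i ∂ₜu + Δu = 0`, `u(0) = u₀`; the equation is tested in the space
variable against Schwartz functions: `d/dt ∫ u(t) ψ = i ∫ u(t) Δψ` for all `t` and `ψ`. -/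
structure IsSchrodingerSolution {d : ℕ} (u₀ : L2Space d) (u : ℝ → L2Space d) : Prop where
  continuous : Continuous u
  initial : u 0 = u₀
  equation : ∀ (ψ : 𝓢(RSpace d, ℂ)) (t : ℝ),
    HasDerivAt (fun s : ℝ => ∫ x, u s x * ψ x) (Complex.I * ∫ x, u t x * (Δ ψ) x) t

/-- The (Plancherel) Fourier transform on `L²(ℝ^d)`, normalised as
`f̂(ξ) = ∫ f(x) exp(-i x·ξ) dx`. Mathlib's `𝓕` has the phase `exp(-2πi x·ξ)`, whence the dilation. -/
noncomputable def hatL2 {d : ℕ} (f : L2Space d) : RSpace d → ℂ :=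
  fun ξ => (𝓕 f : L2Space d) ((2 * Real.pi)⁻¹ • ξ)

/-- The squared homogeneous Sobolev norm
`‖f‖²_{Ḣ^s} = ‖(-Δ)^{s/2} f‖²_{L²} = (2π)^{-d} ∫ |ξ|^{2s} |f̂(ξ)|² dξ`, possibly infinite. -/
noncomputable def homSobolevNormSq {d : ℕ} (s : ℝ) (f : L2Space d) : ℝ≥0∞ :=
  ENNReal.ofReal (((2 * Real.pi) ^ d)⁻¹) *
    ∫⁻ ξ : RSpace d, ‖((‖ξ‖ ^ s : ℝ) : ℂ) * hatL2 f ξ‖ₑ ^ 2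

/-- Membership in `H¹(ℝ^d) = L² ∩ Ḣ¹` for an element of `L²(ℝ^d)`. -/
def InH1 {d : ℕ} (f : L2Space d) : Prop := homSobolevNormSq 1 f < ⊤

/-- The space-time Fourier transform `φ̃(t,x) = ∫ φ(τ,ξ) exp(-i(tτ + x·ξ)) dτ dξ` of an integrable
function; it is applied to test functions. -/
noncomputable def spaceTimeFourier {d : ℕ} (φ : ℝ × RSpace d → ℂ) (t : ℝ) (x : RSpace d) : ℂ :=
  ∫ p : ℝ × RSpace d,
    φ p * Complex.exp (-(Complex.I * ((t * p.1 + inner ℝ x p.2 : ℝ) : ℂ)))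

/-- The locally integrable function `W` on `ℝ × ℝ^d` is the distributional space-time Fourier
transform of `F`: `∫ F φ̃ dx dt = ∫ W φ` for all test functions `φ`. Each time slice of `F` is
integrable and the left-hand side is an (absolutely convergent) iterated integral, so that only
the classes of the slices `F t` up to null sets matter. -/
structure IsSpaceTimeFourier {d : ℕ} (F : ℝ → RSpace d → ℂ) (W : ℝ × RSpace d → ℂ) : Prop where
  slice_integrable : ∀ t, Integrable (F t)
  locallyIntegrable : LocallyIntegrable W
  pairing : ∀ φ : ℝ × RSpace d → ℂ, ContDiff ℝ ∞ φ → HasCompactSupport φ →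
    Integrable (fun t => ∫ x, F t x * spaceTimeFourier φ t x) ∧
      ∫ t, ∫ x, F t x * spaceTimeFourier φ t x = ∫ p, W p * φ p

/-- `‖ |𝔇|^β F ‖²` in `L²(ℝ × ℝ^d)`, where `𝔇 = i ∂ₜ + Δ/2` and `|𝔇|^β` is the Fourier multiplier
with symbol `|τ + |ξ|²/2|^β`, the norm being computed on the Fourier side by Plancherel:
`(2π)^{-(d+1)} ∫ |τ + |ξ|²/2|^{2β} |F̃(τ,ξ)|² dτ dξ`. The function `F̃`, if it exists, is unique up
to null sets, so the infimum only picks this value; it is `∞` when `F̃` is not a function. -/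
noncomputable def dispersiveNormSq {d : ℕ} (β : ℝ) (F : ℝ → RSpace d → ℂ) : ℝ≥0∞ :=
  ⨅ (W : ℝ × RSpace d → ℂ) (_ : IsSpaceTimeFourier F W),
    ENNReal.ofReal (((2 * Real.pi) ^ (d + 1))⁻¹) *
      ∫⁻ p : ℝ × RSpace d, ‖((|p.1 + ‖p.2‖ ^ 2 / 2| ^ β : ℝ) : ℂ) * W p‖ₑ ^ 2

/-- The gaussians `exp(a|η|² + b·η + c)` with `a, c ∈ ℂ`, `b ∈ ℂ^d`, `Re a < 0`. -/
def gaussians (d : ℕ) : Set (RSpace d → ℂ) :=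
  {g | ∃ (a c : ℂ) (b : Fin d → ℂ), a.re < 0 ∧
    g = fun η => Complex.exp (a * ((‖η‖ ^ 2 : ℝ) : ℂ) + ∑ j, b j * (η j : ℂ) + c)}

/-- The gaussians with radial modulus, `exp(a|η|² + i b·η + c)` with `a, c ∈ ℂ`, `b ∈ ℝ^d`,
`Re a < 0`. -/
def radialGaussians (d : ℕ) : Set (RSpace d → ℂ) :=
  {g | ∃ (a c : ℂ) (b : Fin d → ℝ), a.re < 0 ∧
    g = fun η => Complex.exp
      (a * ((‖η‖ ^ 2 : ℝ) : ℂ) + Complex.I * ((∑ j, b j * η j : ℝ) : ℂ) + c)}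

/-- The Fourier transform of `f` belongs to the class `S` of functions, up to null sets. -/
def HatMem {d : ℕ} (f : L2Space d) (S : Set (RSpace d → ℂ)) : Prop :=
  ∃ g ∈ S, hatL2 f =ᵐ[volume] g

/-- The constant `2^{(2-3d)/2} π^{(2-d)/2} / Γ(d/2)`. -/
noncomputable def sharpConst (d : ℕ) : ℝ≥0∞ :=
  ENNReal.ofReal ((2 : ℝ) ^ ((2 - 3 * (d : ℝ)) / 2) * Real.pi ^ ((2 - (d : ℝ)) / 2) /
    Real.Gamma ((d : ℝ) / 2))

/-! Write `f` for the Fourier transform of `u₀`. The evolution multiplies `f` by `exp(-it|ξ|²)`, so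
`u²` is a superposition of waves indexed by pairs of frequencies `ξ/2 ± ζ`, with total frequency `ξ`
and, by the parallelogram law, temporal frequency `τ = -(|ξ|²/2 + 2|ζ|²)`. Pairs with the same `(ξ,
|ζ|)` land on the same point `(τ, ξ)`. In polar coordinates `ζ = rθ` the space-time transform of
`u²` is therefore a constant times `r^(d-2)` times the spherical integral of `f(ξ/2 + rθ) f(ξ/2 -
rθ)`, supported where `τ + |ξ|²/2 = -2r² < 0` (`IsSchrodingerSolution.isSpaceTimeFourier`).

The multiplier is a power of `2r²`. The exponent `(2-d)/4` is the one for which the powers of `r`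
combine to exactly `r^(d-1) dr`, the polar density; the exponent `(4-d)/4` leaves one additional
weight `2r²`. Cauchy–Schwarz on the sphere against the constant function then bounds both norms by
integrals of `|f(x)|²|f(y)|²`, with weight `1` or `2r² = |x-y|²/2` (`lintegral_sphMean_le`). The
first integral is a product of two `L²` norms. The second is energy times mass minus the squared
momentum `|∫ |f|² x|²` (`lintegral_pair_energy`), and the momentum term is discarded.

Equality in Cauchy–Schwarz means that `f(x) f(y)` depends only on `x + y` and `|x - y|` almost
everywhere; in the second estimate the momentum must vanish as well. For nonzero `f ∈ L²` this
functional equation has only gaussian solutions (`RadialPairProd.exists_ae_eq_quadExp`). Damping `f`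
by a gaussian preserves the equation and makes the transform `G` continuously differentiable. The
equation passes to `G`, where it says that the products of `G` over opposite vertices of a rectangle
agree. Such a `G` has no zeros, its logarithmic derivative is affine, and so it is the exponential
of a quadratic with radial leading part; inverting the transform and removing the damping gives the
form of `f`. Zero momentum removes the real part of the linear coefficient. Gaussians attain
equality, which also makes the constants optimal. -/

/-! ### The Fourier transform on `L²` and the transform of a square -/

/-- The bilinear pairing `∫ h n` on `L²` as a continuous bilinear map. -/
noncomputable def l2Pairing (d : ℕ) : L2Space d →L[ℂ] L2Space d →L[ℂ] ℂ :=
  (ContinuousLinearMap.mul ℂ ℂ).lpPairing volume 2 2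

theorem l2Pairing_apply {d : ℕ} (h n : L2Space d) : l2Pairing d h n = ∫ x, h x * n x := by
  simp [l2Pairing, ContinuousLinearMap.lpPairing_eq_integral]

/-- A Schwartz function as an element of `L²`. -/
noncomputable def schwartzL2 {d : ℕ} (χ : 𝓢(RSpace d, ℂ)) : L2Space d := χ.toLp 2

theorem coeFn_schwartzL2 {d : ℕ} (χ : 𝓢(RSpace d, ℂ)) : schwartzL2 χ =ᵐ[volume] χ :=
  χ.coeFn_toLp 2 volume

theorem fourier_schwartzL2 {d : ℕ} (χ : 𝓢(RSpace d, ℂ)) : 𝓕 (schwartzL2 χ) = schwartzL2 (𝓕 χ) :=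
  SchwartzMap.toLp_fourier_eq χ

theorem fourierInv_schwartzL2 {d : ℕ} (χ : 𝓢(RSpace d, ℂ)) :
    𝓕⁻ (schwartzL2 χ) = schwartzL2 (𝓕⁻ χ) :=
  SchwartzMap.toLp_fourierInv_eq χ

theorem denseRange_schwartzL2 (d : ℕ) : DenseRange (schwartzL2 : 𝓢(RSpace d, ℂ) → L2Space d) :=
  SchwartzMap.denseRange_toLpCLM (p := 2) ENNReal.ofNat_ne_top

theorem l2Pairing_schwartzL2 {d : ℕ} (h : L2Space d) (ψ : 𝓢(RSpace d, ℂ)) :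
    l2Pairing d h (schwartzL2 ψ) = ∫ x, h x * ψ x := by
  rw [l2Pairing_apply]
  refine integral_congr_ae ?_
  filter_upwards [coeFn_schwartzL2 ψ] with x hx
  rw [hx]

theorem l2Pairing_fourier_schwartz {d : ℕ} (h : L2Space d) (ψ : 𝓢(RSpace d, ℂ)) :
    l2Pairing d (𝓕 h) (schwartzL2 ψ) = l2Pairing d h (𝓕 (schwartzL2 ψ)) := by
  have := congrArg (fun T : 𝓢'(RSpace d, ℂ) => T ψ) (Lp.fourier_toTemperedDistribution_eq h)
  simp only [TemperedDistribution.fourier_apply, Lp.toTemperedDistribution_apply, smul_eq_mul] at this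
  rw [fourier_schwartzL2, l2Pairing_schwartzL2, l2Pairing_schwartzL2]
  simp only [mul_comm] at this ⊢
  exact this.symm

theorem l2Pairing_fourier {d : ℕ} (h n : L2Space d) :
    l2Pairing d (𝓕 h) n = l2Pairing d h (𝓕 n) := by
  refine DenseRange.induction_on (p := fun n => l2Pairing d (𝓕 h) n = l2Pairing d h (𝓕 n))
    (denseRange_schwartzL2 d) n ?_ ?_
  · exact isClosed_eq (by fun_prop)
      ((l2Pairing d h).continuous.comp (Lp.fourierTransformₗᵢ (RSpace d) ℂ).continuous)
  · intro ψ
    exact l2Pairing_fourier_schwartz h ψ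

theorem integral_fourier_mul_eq_of_integrable {d : ℕ} {f g : RSpace d → ℂ} (hf : Integrable f)
    (hg : Integrable g) : ∫ ξ, 𝓕 f ξ * g ξ = ∫ x, f x * 𝓕 g x := by
  have := VectorFourier.integral_fourierIntegral_smul_eq_flip (L := innerₗ (RSpace d))
    (μ := volume) (ν := volume) (f := f) (g := g) Real.continuous_fourierChar
    continuous_inner hf hg
  rw [flip_innerₗ] at this
  exact this

/-- The Plancherel transform is defined by extension, so its agreement with the integral formula on
`L¹ ∩ L²` is checked by pairing both with smooth compactly supported functions. -/
theorem l2_fourier_ae_eq {d : ℕ} (m : RSpace d → ℂ) (h1 : Integrable m) (h2 : MemLp m 2) :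
    (𝓕 (h2.toLp m) : L2Space d) =ᵐ[volume] 𝓕 m := by
  refine ae_eq_of_integral_contDiff_smul_eq
    ((Lp.memLp _).locallyIntegrable (by norm_num)) ?_ ?_
  · exact (VectorFourier.fourierIntegral_continuous Real.continuous_fourierChar
      continuous_inner h1).locallyIntegrable
  · intro g hg hc
    let ψ : 𝓢(RSpace d, ℂ) := (hc.comp_left (g := ((↑) : ℝ → ℂ)) (by simp)).toSchwartzMap
      (Complex.ofRealCLM.contDiff.comp hg)
    have hψ : ∀ x, ψ x = (g x : ℂ) := fun x => rfl
    have e1 := l2Pairing_fourier_schwartz (h2.toLp m) ψ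
    rw [fourier_schwartzL2, l2Pairing_schwartzL2, l2Pairing_schwartzL2] at e1
    have e2 := integral_fourier_mul_eq_of_integrable h1 (ψ.integrable (μ := volume))
    have e3 : ∫ x, (h2.toLp m) x * (𝓕 ψ) x = ∫ x, m x * (𝓕 ψ) x := by
      refine integral_congr_ae ?_
      filter_upwards [h2.coeFn_toLp] with x hx
      rw [hx]
    simp only [Complex.real_smul, ← hψ]
    simp only [mul_comm (ψ _)]
    rw [e1, e3, ← SchwartzMap.fourier_coe] at *
    exact e2.symm

theorem l2Pairing_fourierInv {d : ℕ} (h n : L2Space d) :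
    l2Pairing d (𝓕⁻ h) n = l2Pairing d h (𝓕⁻ n) := by
  have := l2Pairing_fourier (𝓕⁻ h) (𝓕⁻ n)
  rw [FourierTransform.fourier_fourierInv_eq, FourierTransform.fourier_fourierInv_eq] at this
  exact this.symm

theorem integral_fourierInv_mul_eq_of_integrable {d : ℕ} {f g : RSpace d → ℂ} (hf : Integrable f)
    (hg : Integrable g) : ∫ ξ, 𝓕⁻ f ξ * g ξ = ∫ x, f x * 𝓕⁻ g x := by
  have := integral_fourier_mul_eq_of_integrable hf hg.comp_neg
  rw [← Real.fourierInv_eq_fourier_comp_neg] at this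
  rw [← this, ← integral_neg_eq_self]
  simp [Real.fourierInv_eq_fourier_neg]

theorem l2_fourierInv_ae_eq {d : ℕ} (m : RSpace d → ℂ) (h1 : Integrable m) (h2 : MemLp m 2) :
    (𝓕⁻ (h2.toLp m) : L2Space d) =ᵐ[volume] 𝓕⁻ m := by
  refine ae_eq_of_integral_contDiff_smul_eq
    ((Lp.memLp _).locallyIntegrable (by norm_num)) ?_ ?_
  · rw [Real.fourierInv_eq_fourier_comp_neg]
    exact (VectorFourier.fourierIntegral_continuous Real.continuous_fourierChar
      continuous_inner h1.comp_neg).locallyIntegrable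
  · intro g hg hc
    let ψ : 𝓢(RSpace d, ℂ) := (hc.comp_left (g := ((↑) : ℝ → ℂ)) (by simp)).toSchwartzMap
      (Complex.ofRealCLM.contDiff.comp hg)
    have hψ : ∀ x, ψ x = (g x : ℂ) := fun x => rfl
    have e1 := l2Pairing_fourierInv (h2.toLp m) (schwartzL2 ψ)
    rw [fourierInv_schwartzL2, l2Pairing_schwartzL2, l2Pairing_schwartzL2] at e1
    have e2 := integral_fourierInv_mul_eq_of_integrable h1 (ψ.integrable (μ := volume))
    have e3 : ∫ x, (h2.toLp m) x * (𝓕⁻ ψ) x = ∫ x, m x * (𝓕⁻ ψ) x := by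
      refine integral_congr_ae ?_
      filter_upwards [h2.coeFn_toLp] with x hx
      rw [hx]
    simp only [Complex.real_smul, ← hψ]
    simp only [mul_comm (ψ _)]
    rw [e1, e3, ← SchwartzMap.fourierInv_coe] at *
    exact e2.symm

theorem continuous_fourier_of_integrable {d : ℕ} {k : RSpace d → ℂ} (hk : Integrable k) :
    Continuous (𝓕 k) :=
  VectorFourier.fourierIntegral_continuous Real.continuous_fourierChar continuous_inner hk

theorem norm_fourier_le {d : ℕ} (k : RSpace d → ℂ) (x : RSpace d) : ‖𝓕 k x‖ ≤ ∫ y, ‖k y‖ :=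
  VectorFourier.norm_fourierIntegral_le_integral_norm _ _ _ _ _

theorem memLp_two_fourier {d : ℕ} {k : RSpace d → ℂ} (h1 : Integrable k) (h2 : MemLp k 2) :
    MemLp (𝓕 k) 2 :=
  (memLp_congr_ae (l2_fourier_ae_eq k h1 h2)).1 (Lp.memLp _)

theorem l2Pairing_toLp_right {d : ℕ} (h : L2Space d) {m : RSpace d → ℂ} (hm : MemLp m 2) :
    l2Pairing d h (hm.toLp m) = ∫ x, h x * m x := by
  rw [l2Pairing_apply]
  refine integral_congr_ae ?_
  filter_upwards [hm.coeFn_toLp] with x hx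
  rw [hx]

theorem integral_mul_fourier {d : ℕ} (h : L2Space d) {k : RSpace d → ℂ} (h1 : Integrable k)
    (h2 : MemLp k 2) : ∫ x, h x * 𝓕 k x = ∫ ξ, (𝓕 h : L2Space d) ξ * k ξ := by
  rw [← l2Pairing_toLp_right _ h2, l2Pairing_fourier, l2Pairing_apply]
  refine integral_congr_ae ?_
  filter_upwards [l2_fourier_ae_eq k h1 h2] with x hx
  rw [hx]

theorem fourier_comp_add_right {d : ℕ} (k : RSpace d → ℂ) (ξ x : RSpace d) :
    𝓕 (fun η => k (η + ξ)) x = (Real.fourierChar (inner ℝ ξ x) : ℂ) * 𝓕 k x := by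
  have := congrFun (VectorFourier.fourierIntegral_comp_add_right Real.fourierChar
    (volume : Measure (RSpace d)) (innerₗ (RSpace d)) k ξ) x
  exact this

/-- The Fourier transform of `h²`, tested against `k`. -/
theorem integral_sq_mul_fourier {d : ℕ} (h : L2Space d) {k : RSpace d → ℂ} (h1 : Integrable k)
    (h2 : MemLp k 2) :
    ∫ x, h x ^ 2 * 𝓕 k x =
      ∫ ξ, ∫ η, (𝓕 h : L2Space d) ξ * (𝓕 h : L2Space d) η * k (ξ + η) := by
  have hΨ2 := memLp_two_fourier h1 h2
  have hm1 : Integrable (fun x => h x * 𝓕 k x) := (Lp.memLp h).integrable_mul hΨ2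
  have hm2 : MemLp (fun x => h x * 𝓕 k x) 2 := by
    have : MemLp (𝓕 k) ∞ := memLp_top_of_bound
      (continuous_fourier_of_integrable h1).aestronglyMeasurable _
      (Filter.Eventually.of_forall (norm_fourier_le k))
    exact this.mul (Lp.memLp h)
  -- The inverse transform of a product is a correlation: the character supplied by `𝓕⁻` is absorbed
  -- as a translation of `k`.
  have key : ∀ ξ, 𝓕⁻ (fun x => h x * 𝓕 k x) ξ = ∫ η, (𝓕 h : L2Space d) η * k (η + ξ) := by
    intro ξ
    have hi := h1.comp_add_right ξ
    have hi2 : MemLp (fun η => k (η + ξ)) 2 :=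
      h2.comp_measurePreserving (measurePreserving_add_right volume ξ)
    rw [← integral_mul_fourier h hi hi2, Real.fourierInv_eq]
    refine integral_congr_ae (Filter.Eventually.of_forall fun x => ?_)
    simp only [fourier_comp_add_right, Circle.smul_def, smul_eq_mul, real_inner_comm]
    ring
  -- The square is split as `h` times the `L²` function `h · 𝓕 k`, and the transform is moved from
  -- the second factor onto `h`.
  have e := l2Pairing_fourier h (𝓕⁻ (hm2.toLp _) : L2Space d)
  rw [FourierTransform.fourier_fourierInv_eq, l2Pairing_toLp_right, l2Pairing_apply] at e
  calc ∫ x, h x ^ 2 * 𝓕 k x = ∫ x, h x * (h x * 𝓕 k x) := by simp only [sq, mul_assoc]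
    _ = _ := e.symm
    _ = _ := by
      refine integral_congr_ae ?_
      filter_upwards [l2_fourierInv_ae_eq _ hm1 hm2] with ξ hξ
      rw [hξ, key, ← integral_const_mul]
      simp only [mul_assoc, add_comm]

/-! ### The Schrödinger evolution on the Fourier side -/

theorem laplacian_fourier_eq {d : ℕ} (χ : 𝓢(RSpace d, ℂ)) :
    Δ (𝓕 χ) = 𝓕 (-(((2 * Real.pi) ^ 2 : ℝ) : ℂ) •
      SchwartzMap.smulLeftCLM ℂ (fun ξ : RSpace d => ‖ξ‖ ^ 2) χ) := by
  let b := EuclideanSpace.basisFun (Fin d) ℝ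
  have hb : ∀ i, (inner ℝ · (b i) : RSpace d → ℝ).HasTemperateGrowth := by
    intro i; fun_prop
  have hn : (fun ξ : RSpace d => ‖ξ‖ ^ 2).HasTemperateGrowth := by fun_prop
  rw [SchwartzMap.laplacian_eq_sum b]
  simp_rw [SchwartzMap.lineDerivOp_fourier_eq]
  refine (map_sum (FourierTransform.fourierCLM ℂ 𝓢(RSpace d, ℂ)) _ _).symm.trans ?_
  refine congrArg (FourierTransform.fourierCLM ℂ 𝓢(RSpace d, ℂ)) ?_
  ext ξ
  simp only [_root_.sum_apply, _root_.smul_apply,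
    SchwartzMap.smulLeftCLM_apply_apply (hb _), SchwartzMap.smulLeftCLM_apply_apply hn,
    ← b.sum_sq_inner_left ξ]
  simp only [smul_eq_mul, Complex.real_smul, Complex.ofReal_sum, Finset.sum_mul, Finset.mul_sum]
  refine Finset.sum_congr rfl fun i _ => ?_
  push_cast
  linear_combination (4 * (Real.pi : ℂ) ^ 2 * (inner ℝ ξ (b i) : ℂ) ^ 2 * χ ξ) * Complex.I_sq

/-- The unimodular factor `exp(i s |2πξ|²)`. -/
noncomputable def phase {d : ℕ} (s : ℝ) (ξ : RSpace d) : ℂ :=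
  Complex.exp (((s * ((2 * Real.pi) ^ 2 * ‖ξ‖ ^ 2) : ℝ) : ℂ) * Complex.I)

theorem norm_phase {d : ℕ} (s : ℝ) (ξ : RSpace d) : ‖phase s ξ‖ = 1 :=
  Complex.norm_exp_ofReal_mul_I _

theorem continuous_phase {d : ℕ} (s : ℝ) : Continuous (phase s : RSpace d → ℂ) := by
  unfold phase; fun_prop

theorem phase_add {d : ℕ} (s t : ℝ) (ξ : RSpace d) : phase (s + t) ξ = phase s ξ * phase t ξ := by
  simp only [phase, ← Complex.exp_add]; congr 1; push_cast; ring

theorem phase_zero {d : ℕ} (ξ : RSpace d) : phase 0 ξ = 1 := by simp [phase]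

theorem memLp_phase_mul {d : ℕ} (s : ℝ) {v : RSpace d → ℂ} (hv : MemLp v 2) :
    MemLp (fun ξ => phase s ξ * v ξ) 2 :=
  hv.of_le ((continuous_phase s).aestronglyMeasurable.mul hv.1)
    (Filter.Eventually.of_forall fun ξ => by simp [norm_phase])

/-- Multiplication by `exp(i s |2πξ|²)` on `L²`. -/
noncomputable def phaseMul {d : ℕ} (s : ℝ) (v : L2Space d) : L2Space d :=
  (memLp_phase_mul s (Lp.memLp v)).toLp _

theorem phaseMul_ae {d : ℕ} (s : ℝ) (v : L2Space d) :
    phaseMul s v =ᵐ[volume] fun ξ => phase s ξ * v ξ :=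
  MemLp.coeFn_toLp _

theorem phaseMul_sub {d : ℕ} (s : ℝ) (v w : L2Space d) :
    phaseMul s (v - w) = phaseMul s v - phaseMul s w := by
  apply Lp.ext
  filter_upwards [phaseMul_ae s v, phaseMul_ae s w, phaseMul_ae s (v - w), Lp.coeFn_sub v w,
    Lp.coeFn_sub (phaseMul s v) (phaseMul s w)] with ξ h1 h2 h3 h4 h5
  rw [h3, h5, Pi.sub_apply, h1, h2, h4, Pi.sub_apply]; ring

theorem norm_phaseMul {d : ℕ} (s : ℝ) (v : L2Space d) : ‖phaseMul s v‖ = ‖v‖ := by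
  refine le_antisymm (Lp.norm_le_norm_of_ae_le ?_) (Lp.norm_le_norm_of_ae_le ?_) <;>
  · filter_upwards [phaseMul_ae s v] with ξ h
    rw [h]; simp [norm_phase]

theorem phaseMul_add {d : ℕ} (s t : ℝ) (v : L2Space d) :
    phaseMul (s + t) v = phaseMul s (phaseMul t v) := by
  apply Lp.ext
  filter_upwards [phaseMul_ae (s + t) v, phaseMul_ae s (phaseMul t v), phaseMul_ae t v]
    with ξ h1 h2 h3
  rw [h1, h2, h3, phase_add, mul_assoc]

theorem phaseMul_zero {d : ℕ} (v : L2Space d) : phaseMul 0 v = v := by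
  apply Lp.ext
  filter_upwards [phaseMul_ae 0 v] with ξ h1
  rw [h1, phase_zero, one_mul]

theorem l2Pairing_phaseMul {d : ℕ} (s : ℝ) (v w : L2Space d) :
    l2Pairing d (phaseMul s v) w = l2Pairing d v (phaseMul s w) := by
  rw [l2Pairing_apply, l2Pairing_apply]
  refine integral_congr_ae ?_
  filter_upwards [phaseMul_ae s v, phaseMul_ae s w] with ξ h1 h2
  rw [h1, h2]; ring

/-- Multiplication of a Schwartz function by `|2πξ|²`. -/
noncomputable def sqMul {d : ℕ} (χ : 𝓢(RSpace d, ℂ)) : 𝓢(RSpace d, ℂ) :=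
  (((2 * Real.pi) ^ 2 : ℝ) : ℂ) • SchwartzMap.smulLeftCLM ℂ (fun ξ : RSpace d => ‖ξ‖ ^ 2) χ

theorem sqMul_apply {d : ℕ} (χ : 𝓢(RSpace d, ℂ)) (ξ : RSpace d) :
    sqMul χ ξ = (((2 * Real.pi) ^ 2 * ‖ξ‖ ^ 2 : ℝ) : ℂ) * χ ξ := by
  have hn : (fun ξ : RSpace d => ‖ξ‖ ^ 2).HasTemperateGrowth := by fun_prop
  simp only [sqMul, _root_.smul_apply, SchwartzMap.smulLeftCLM_apply_apply hn, smul_eq_mul,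
    Complex.real_smul]
  push_cast; ring

theorem laplacian_fourier_eq' {d : ℕ} (χ : 𝓢(RSpace d, ℂ)) : Δ (𝓕 χ) = -𝓕 (sqMul χ) := by
  rw [laplacian_fourier_eq, sqMul, neg_smul]
  exact map_neg (FourierTransform.fourierCLM ℂ 𝓢(RSpace d, ℂ)) _

/-- The Taylor bound is used for `|x| ≤ 1`; beyond that the crude bound `2|x|` is already below
`2x²`. No smallness of `x` may be assumed, because it will be `h|2πξ|²` with `ξ` unbounded. -/
theorem norm_exp_mul_I_sub_one_sub_le (x : ℝ) :
    ‖Complex.exp (x * Complex.I) - 1 - x * Complex.I‖ ≤ 2 * x ^ 2 := by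
  rcases le_or_gt |x| 1 with h | h
  · have := Complex.norm_exp_sub_one_sub_id_le (x := x * Complex.I) (by simpa using h)
    simp only [norm_mul, Complex.norm_real, Complex.norm_I, mul_one, Real.norm_eq_abs,
      sq_abs] at this
    linarith [sq_nonneg x]
  · have h1 : ‖Complex.exp (x * Complex.I) - 1‖ ≤ |x| := by
      simpa [mul_comm] using Real.norm_exp_I_mul_ofReal_sub_one_le (x := x)
    have h2 : ‖(x : ℂ) * Complex.I‖ = |x| := by simp
    have := norm_sub_le (Complex.exp (x * Complex.I) - 1) (x * Complex.I)
    nlinarith [sq_abs x]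

theorem norm_phase_remainder_le {d : ℕ} (s h : ℝ) (ξ : RSpace d) (z : ℂ) :
    ‖phase (s + h) ξ * z - phase s ξ * z - ((h : ℂ) * Complex.I) *
        (phase s ξ * ((((2 * Real.pi) ^ 2 * ‖ξ‖ ^ 2 : ℝ) : ℂ) * z))‖ ≤
      2 * h ^ 2 * ‖(((2 * Real.pi) ^ 2 * ‖ξ‖ ^ 2 : ℝ) : ℂ) *
        ((((2 * Real.pi) ^ 2 * ‖ξ‖ ^ 2 : ℝ) : ℂ) * z)‖ := by
  rw [phase_add, show phase h ξ = Complex.exp (((h * ((2 * Real.pi) ^ 2 * ‖ξ‖ ^ 2) : ℝ) : ℂ) *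
    Complex.I) from rfl]
  set q : ℝ := (2 * Real.pi) ^ 2 * ‖ξ‖ ^ 2
  have e : phase s ξ * Complex.exp (((h * q : ℝ) : ℂ) * Complex.I) * z - phase s ξ * z -
      ((h : ℂ) * Complex.I) * (phase s ξ * ((q : ℂ) * z)) =
      phase s ξ * ((Complex.exp (((h * q : ℝ) : ℂ) * Complex.I) - 1 -
        ((h * q : ℝ) : ℂ) * Complex.I) * z) := by
    push_cast; ring
  rw [e, norm_mul, norm_phase, one_mul, norm_mul, norm_mul, norm_mul]
  refine (mul_le_mul_of_nonneg_right (norm_exp_mul_I_sub_one_sub_le (h * q))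
    (norm_nonneg _)).trans (le_of_eq ?_)
  rw [← mul_assoc ‖(q : ℂ)‖, Complex.norm_real, Real.norm_eq_abs, abs_mul_abs_self]
  ring

theorem norm_sub_sub_smul_le_of_ae {d : ℕ} {A B C R : L2Space d} {c : ℂ} {K : ℝ}
    (h : ∀ᵐ ξ, ‖A ξ - B ξ - c * C ξ‖ ≤ K * ‖R ξ‖) : ‖A - B - c • C‖ ≤ K * ‖R‖ := by
  refine Lp.norm_le_mul_norm_of_ae_le_mul ?_
  filter_upwards [h, Lp.coeFn_sub (A - B) (c • C), Lp.coeFn_sub A B, Lp.coeFn_smul c C]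
    with ξ h h1 h2 h3
  rwa [h1, Pi.sub_apply, h2, Pi.sub_apply, h3, Pi.smul_apply, smul_eq_mul]

theorem phaseMul_schwartzL2_ae {d : ℕ} (s : ℝ) (χ : 𝓢(RSpace d, ℂ)) :
    phaseMul s (schwartzL2 χ) =ᵐ[volume] fun ξ => phase s ξ * χ ξ := by
  filter_upwards [phaseMul_ae s (schwartzL2 χ), coeFn_schwartzL2 χ] with ξ h1 h2
  rw [h1, h2]

theorem norm_phaseMul_remainder_le {d : ℕ} (χ : 𝓢(RSpace d, ℂ)) (s h : ℝ) :
    ‖phaseMul (s + h) (schwartzL2 χ) - phaseMul s (schwartzL2 χ) -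
      ((h : ℂ) * Complex.I) • phaseMul s (schwartzL2 (sqMul χ))‖ ≤
      2 * h ^ 2 * ‖(schwartzL2 (sqMul (sqMul χ)))‖ := by
  have h0 := coeFn_schwartzL2 (sqMul (sqMul χ))
  have h1 := phaseMul_schwartzL2_ae (s + h) χ
  have h2 := phaseMul_schwartzL2_ae s χ
  have h3 := phaseMul_schwartzL2_ae s (sqMul χ)
  refine norm_sub_sub_smul_le_of_ae (K := 2 * h ^ 2) ?_
  filter_upwards [h1, h2, h3, h0] with ξ h1 h2 h3 h6
  have := norm_phase_remainder_le s h ξ (χ ξ)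
  rw [← sqMul_apply, ← sqMul_apply] at this
  rw [h1, h2, h3, h6]
  exact this

/-- The second-order remainder costs a factor `|2πξ|⁴`, which a Schwartz function absorbs, so the
error is `O(h²)` in `L²` norm. -/
theorem hasDerivAt_phaseMul {d : ℕ} (χ : 𝓢(RSpace d, ℂ)) (s : ℝ) :
    HasDerivAt (fun s : ℝ => phaseMul s (schwartzL2 χ))
      (Complex.I • phaseMul s (schwartzL2 (sqMul χ))) s := by
  rw [hasDerivAt_iff_isLittleO_nhds_zero]
  refine Asymptotics.IsBigO.trans_isLittleO (g := fun h : ℝ => h ^ 2) ?_ ?_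
  · refine Asymptotics.IsBigO.of_bound (2 * ‖(schwartzL2 (sqMul (sqMul χ)))‖)
      (Filter.Eventually.of_forall fun h => ?_)
    have e := RCLike.real_smul_eq_coe_smul (K := ℂ) h
      (Complex.I • phaseMul s (schwartzL2 (sqMul χ)))
    rw [e, smul_smul]
    refine (norm_phaseMul_remainder_le χ s h).trans (le_of_eq ?_)
    rw [Real.norm_of_nonneg (sq_nonneg h)]; ring
  · simpa using Asymptotics.isLittleO_pow_id (𝕜 := ℝ) (n := 2) (by norm_num)

/-- Schwartz functions are dense and multiplication by the phase is isometric, so continuity passes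
to all of `L²` by an `ε/3` argument. -/
theorem continuous_phaseMul {d : ℕ} (v : L2Space d) : Continuous fun s : ℝ => phaseMul s v := by
  rw [Metric.continuous_iff']
  intro s ε hε
  obtain ⟨χ, hw⟩ := (denseRange_schwartzL2 d).exists_dist_lt v (ε := ε / 3) (by positivity)
  have hd : ∀ t, dist (phaseMul t v) (phaseMul t (schwartzL2 χ)) < ε / 3 := by
    intro t
    rw [dist_eq_norm, ← phaseMul_sub, norm_phaseMul, ← dist_eq_norm]
    exact hw
  filter_upwards [Metric.continuousAt_iff'.1 (hasDerivAt_phaseMul χ s).continuousAt (ε / 3)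
    (by positivity)] with t ht
  have h1 := hd t
  have h2 := hd s
  rw [dist_comm] at h2
  have := dist_triangle4 (phaseMul t v) (phaseMul t (schwartzL2 χ)) (phaseMul s (schwartzL2 χ))
    (phaseMul s v)
  linarith

/-- A product rule for a bilinear pairing in which the first factor is only differentiable
against the value of the second one. -/
theorem hasDerivAt_bilin_of_weak {E : Type*} [NormedAddCommGroup E] [NormedSpace ℂ E]
    (B : E →L[ℂ] E →L[ℂ] ℂ) {v a : ℝ → E} {a' : E} {c : ℂ} {s : ℝ}
    (hv : Continuous v) (ha : HasDerivAt a a' s)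
    (hw : HasDerivAt (fun t => B (v t) (a s)) c s) :
    HasDerivAt (fun t => B (v t) (a t)) (c + B (v s) a') s := by
  rw [hasDerivAt_iff_tendsto_slope] at *
  -- The slope of `B (v t) (a t)` is that of `B (v t) (a s)` plus `B (v t)` applied to the slope of
  -- `a`; continuity of `v` suffices for the second term.
  have h2 : Filter.Tendsto (fun t => B (v t) (slope a s t)) (nhdsWithin s {s}ᶜ)
      (nhds (B (v s) a')) :=
    (isBoundedBilinearMap_apply.continuous.tendsto (B (v s), a')).comp
      (((B.continuous.tendsto (v s)).comp
        ((hv.tendsto s).mono_left nhdsWithin_le_nhds)).prodMk_nhds ha)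
  refine (hw.add h2).congr fun t => ?_
  simp only [slope, vsub_eq_sub, map_sub, Complex.real_smul,
    ContinuousLinearMap.map_smul_of_tower, smul_sub]
  ring

theorem IsSchrodingerSolution.hasDerivAt_fourier {d : ℕ} {u₀ : L2Space d} {u : ℝ → L2Space d}
    (hu : IsSchrodingerSolution u₀ u) (χ : 𝓢(RSpace d, ℂ)) (t : ℝ) :
    HasDerivAt (fun s => l2Pairing d (𝓕 (u s)) (schwartzL2 χ))
      (-(Complex.I * l2Pairing d (𝓕 (u t)) (schwartzL2 (sqMul χ)))) t := by
  have h := hu.equation (𝓕 χ) t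
  rw [laplacian_fourier_eq'] at h
  simp only [_root_.neg_apply, mul_neg, integral_neg, ← l2Pairing_schwartzL2,
    ← fourier_schwartzL2, ← l2Pairing_fourier_schwartz] at h
  exact h

theorem contDiff_phase {d : ℕ} (s : ℝ) : ContDiff ℝ ∞ (phase s : RSpace d → ℂ) := by
  unfold phase
  have : ContDiff ℝ ∞ fun ξ : RSpace d => s * ((2 * Real.pi) ^ 2 * ‖ξ‖ ^ 2) := by
    have := contDiff_norm_sq ℝ (E := RSpace d) (n := ∞)
    fun_prop
  exact ((Complex.ofRealCLM.contDiff.comp this).mul contDiff_const).cexp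

/-- A product of a smooth compactly supported function with a phase, as a Schwartz function. -/
theorem exists_schwartz_phase_mul {d : ℕ} (s : ℝ) {g : RSpace d → ℂ} (hg : ContDiff ℝ ∞ g)
    (hc : HasCompactSupport g) : ∃ χ : 𝓢(RSpace d, ℂ), ∀ ξ, χ ξ = phase s ξ * g ξ :=
  ⟨(HasCompactSupport.mul_left hc).toSchwartzMap ((contDiff_phase s).mul hg), fun _ => rfl⟩

/-- Undoing the expected phase gives a conserved quantity: the derivative from the equation and the
derivative of the phase cancel. -/
theorem IsSchrodingerSolution.hasDerivAt_phaseMul_fourier {d : ℕ} {u₀ : L2Space d}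
    {u : ℝ → L2Space d} (hu : IsSchrodingerSolution u₀ u) {χ : 𝓢(RSpace d, ℂ)}
    (hc : HasCompactSupport χ) (t : ℝ) :
    HasDerivAt (fun s => l2Pairing d (𝓕 (u s)) (phaseMul s (schwartzL2 χ))) 0 t := by
  have hv : Continuous fun t => (𝓕 (u t) : L2Space d) :=
    (Lp.fourierTransformₗᵢ (RSpace d) ℂ).continuous.comp hu.continuous
  -- The weak equation needs a fixed Schwartz test function, so the phase is frozen at time `t`.
  -- Compact support of `χ` keeps the product Schwartz.
  obtain ⟨χt, hχt⟩ := exists_schwartz_phase_mul t χ.smooth' hc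
  have e1 : phaseMul t (schwartzL2 χ) = schwartzL2 χt := by
    apply Lp.ext
    filter_upwards [phaseMul_schwartzL2_ae t χ, coeFn_schwartzL2 χt] with ξ h1 h2
    rw [h1, h2, hχt]; rfl
  have e2 : phaseMul t (schwartzL2 (sqMul χ)) = schwartzL2 (sqMul χt) := by
    apply Lp.ext
    filter_upwards [phaseMul_schwartzL2_ae t (sqMul χ), coeFn_schwartzL2 (sqMul χt)] with ξ h1 h2
    rw [h1, h2, sqMul_apply, sqMul_apply, hχt]
    exact mul_left_comm _ _ _
  have h := hasDerivAt_bilin_of_weak _ hv (hasDerivAt_phaseMul χ t)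
    (by rw [e1]; exact hu.hasDerivAt_fourier χt t)
  rw [e2, map_smul, smul_eq_mul, neg_add_cancel] at h
  exact h

/-- This gives uniqueness for the weak formulation: `exp(it|2πξ|²) 𝓕 (u t)` has constant pairings
with all smooth compactly supported functions, hence equals its value at time zero. -/
theorem IsSchrodingerSolution.fourier_eq {d : ℕ} {u₀ : L2Space d} {u : ℝ → L2Space d}
    (hu : IsSchrodingerSolution u₀ u) (t : ℝ) :
    (𝓕 (u t) : L2Space d) = phaseMul (-t) (𝓕 u₀) := by
  have key : phaseMul t (𝓕 (u t)) = (𝓕 u₀ : L2Space d) := by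
    apply Lp.ext
    refine ae_eq_of_integral_contDiff_smul_eq ((Lp.memLp _).locallyIntegrable (by norm_num))
      ((Lp.memLp _).locallyIntegrable (by norm_num)) fun g hg hc => ?_
    let χ : 𝓢(RSpace d, ℂ) := (hc.comp_left (g := ((↑) : ℝ → ℂ)) (by simp)).toSchwartzMap
      (Complex.ofRealCLM.contDiff.comp hg)
    have hχ : ∀ x, χ x = (g x : ℂ) := fun x => rfl
    have hχc : HasCompactSupport χ := hc.comp_left (g := ((↑) : ℝ → ℂ)) (by simp)
    have hd := fun s => hu.hasDerivAt_phaseMul_fourier hχc s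
    have h := is_const_of_deriv_eq_zero (fun s => (hd s).differentiableAt) (fun s => (hd s).deriv)
      t 0
    rw [phaseMul_zero, ← l2Pairing_phaseMul, l2Pairing_schwartzL2, l2Pairing_schwartzL2,
      hu.initial] at h
    simpa only [Complex.real_smul, ← hχ, mul_comm (χ _)] using h
  rw [← key, ← phaseMul_add, neg_add_cancel, phaseMul_zero]

/-- The Schrödinger evolution of every datum in `L²`. -/
theorem exists_isSchrodingerSolution {d : ℕ} (u₀ : L2Space d) :
    ∃ u : ℝ → L2Space d, IsSchrodingerSolution u₀ u := by
  refine ⟨fun t => 𝓕⁻ (phaseMul (-t) (𝓕 u₀)), ?_, ?_, ?_⟩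
  · exact (Lp.fourierTransformₗᵢ (RSpace d) ℂ).symm.continuous.comp
      ((continuous_phaseMul _).comp continuous_neg)
  · simp [phaseMul_zero]
  · intro ψ t
    set χ : 𝓢(RSpace d, ℂ) := 𝓕⁻ ψ with hχ
    have hψ : ψ = 𝓕 χ := by simp [hχ]
    rw [hψ, laplacian_fourier_eq']
    simp only [_root_.neg_apply, mul_neg, integral_neg, ← l2Pairing_schwartzL2,
      ← fourier_schwartzL2, ← l2Pairing_fourier_schwartz, FourierTransform.fourier_fourierInv_eq,
      l2Pairing_phaseMul]
    have h := hasDerivAt_bilin_of_weak (l2Pairing d) (s := -t) (v := fun _ => 𝓕 u₀)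
      (c := 0) continuous_const (hasDerivAt_phaseMul χ (-t)) (hasDerivAt_const _ _)
    rw [map_smul, zero_add, smul_eq_mul] at h
    have h' := h.scomp t (hasDerivAt_neg t)
    rw [neg_one_smul] at h'
    exact h'

/-! ### Centre-of-mass coordinates for a pair of frequencies -/

section CenterOfMass

variable {d : ℕ}

/-- Centre-of-mass coordinates `(ξ, ζ) ↦ (ξ/2 + ζ, ξ/2 - ζ)`. -/
noncomputable def comMap (p : RSpace d × RSpace d) : RSpace d × RSpace d :=
  ((2⁻¹ : ℝ) • p.1 + p.2, (2⁻¹ : ℝ) • p.1 - p.2)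

theorem measurePreserving_shear_add (c : ℝ) :
    MeasurePreserving (fun p : RSpace d × RSpace d => (p.1, c • p.1 + p.2)) :=
  (MeasurePreserving.id (volume : Measure (RSpace d))).skew_product
    (g := fun x y => c • x + y) (by fun_prop)
    (Filter.Eventually.of_forall fun x => (measurePreserving_add_left volume (c • x)).map_eq)

theorem measurePreserving_shear_sub (c : ℝ) :
    MeasurePreserving (fun p : RSpace d × RSpace d => (p.1, c • p.1 - p.2)) :=
  (MeasurePreserving.id (volume : Measure (RSpace d))).skew_product
    (g := fun x y => c • x - y) (by fun_prop)
    (Filter.Eventually.of_forall fun x => (Measure.measurePreserving_sub_left volume (c • x)).map_eq)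

theorem measurable_comMap : Measurable (comMap : RSpace d × RSpace d → _) := by
  unfold comMap; fun_prop

theorem measurePreserving_comMap : MeasurePreserving (comMap : RSpace d × RSpace d → _) := by
  have h1 := measurePreserving_shear_add (d := d) 2⁻¹
  have h2 : MeasurePreserving (Prod.swap : RSpace d × RSpace d → _) := Measure.measurePreserving_swap
  have h3 : MeasurePreserving (fun p : RSpace d × RSpace d => (p.1, (-1 : ℝ) • p.1 + p.2)) :=
    measurePreserving_shear_add (-1)
  -- The map factors as `(ξ, ζ) ↦ (ξ, ξ/2 + ζ)`, a swap, and subtraction of the first entry from the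
  -- second; each factor preserves volume.
  convert h3.comp (h2.comp h1) using 1
  ext p : 1
  simp only [comMap, Function.comp_apply, Prod.swap, Prod.mk.injEq, true_and]
  module

/-- The product `f(ξ/2 + ζ) f(ξ/2 - ζ)`. -/
noncomputable def pairProd (f : RSpace d → ℂ) (p : RSpace d × RSpace d) : ℂ :=
  f ((2⁻¹ : ℝ) • p.1 + p.2) * f ((2⁻¹ : ℝ) • p.1 - p.2)

theorem measurable_pairProd {f : RSpace d → ℂ} (hf : Measurable f) : Measurable (pairProd f) := by
  unfold pairProd; fun_prop

/-- The product is at most `|f(ξ/2+ζ)|² + |f(ξ/2-ζ)|²`; after a shear each term times `|k(ξ)|` is a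
tensor product of integrable functions. -/
theorem integrable_pairProd_mul {f : RSpace d → ℂ} (hf : Measurable f) (h2 : MemLp f 2)
    {k : RSpace d → ℂ} (hk : Integrable k) :
    Integrable (fun p : RSpace d × RSpace d => pairProd f p * k p.1) := by
  have hsq : Integrable (fun x => ‖f x‖ ^ 2) := h2.integrable_norm_pow (by norm_num)
  have hp : Integrable (fun p : RSpace d × RSpace d => ‖k p.1‖ * ‖f p.2‖ ^ 2) := hk.norm.mul_prod hsq
  have h1 := (measurePreserving_shear_add (d := d) 2⁻¹).integrable_comp_of_integrable hp
  have h3 := (measurePreserving_shear_sub (d := d) 2⁻¹).integrable_comp_of_integrable hp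
  refine (h1.add h3).mono' ?_ (Filter.Eventually.of_forall fun p => ?_)
  · exact (measurable_pairProd hf).aestronglyMeasurable.mul hk.1.comp_fst
  · simp only [pairProd, norm_mul, Pi.add_apply, Function.comp_apply, ← mul_add]
    rw [mul_comm]
    refine mul_le_mul_of_nonneg_left ?_ (norm_nonneg _)
    nlinarith [sq_nonneg (‖f ((2⁻¹ : ℝ) • p.1 + p.2)‖ - ‖f ((2⁻¹ : ℝ) • p.1 - p.2)‖),
      sq_nonneg (‖f ((2⁻¹ : ℝ) • p.1 + p.2)‖), sq_nonneg ‖f ((2⁻¹ : ℝ) • p.1 - p.2)‖]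

/-- The kinetic energy `|ξ|²/2 + 2|ζ|² = |ξ/2 + ζ|² + |ξ/2 - ζ|²`. -/
noncomputable def energy (p : RSpace d × RSpace d) : ℝ := ‖p.1‖ ^ 2 / 2 + 2 * ‖p.2‖ ^ 2

theorem energy_eq (p : RSpace d × RSpace d) :
    energy p = ‖(2⁻¹ : ℝ) • p.1 + p.2‖ ^ 2 + ‖(2⁻¹ : ℝ) • p.1 - p.2‖ ^ 2 := by
  have := parallelogram_law_with_norm ℝ ((2⁻¹ : ℝ) • p.1) p.2
  rw [norm_smul] at this
  norm_num at this
  unfold energy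
  nlinarith

end CenterOfMass

/-! ### The Fourier transform in time of a test function -/

section TimeFourier

variable {d : ℕ} {φ : ℝ × RSpace d → ℂ}

/-- The Fourier transform in the time variable. -/
noncomputable def timeFourier (φ : ℝ × RSpace d → ℂ) (t : ℝ) (ξ : RSpace d) : ℂ :=
  ∫ τ : ℝ, φ (τ, ξ) * Complex.exp (-(Complex.I * ((t * τ : ℝ) : ℂ)))

theorem timeFourier_eq (φ : ℝ × RSpace d → ℂ) (t : ℝ) (ξ : RSpace d) :
    timeFourier φ t ξ = 𝓕 (fun τ => φ (τ, ξ)) ((2 * Real.pi)⁻¹ * t) := by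
  rw [Real.fourier_real_eq_integral_exp_smul, timeFourier]
  refine integral_congr_ae (Filter.Eventually.of_forall fun τ => ?_)
  simp only [smul_eq_mul]
  rw [mul_comm]
  congr 2
  have : (Real.pi : ℂ) ≠ 0 := by exact_mod_cast Real.pi_ne_zero
  push_cast
  field_simp

theorem HasCompactSupport.slice (hc : HasCompactSupport φ) (ξ : RSpace d) :
    HasCompactSupport (fun τ => φ (τ, ξ)) := by
  refine HasCompactSupport.intro (hc.image continuous_fst) fun τ hτ => ?_
  by_contra h
  exact hτ ⟨(τ, ξ), subset_tsupport _ h, rfl⟩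

theorem integrable_slice (hφ : Continuous φ) (hc : HasCompactSupport φ) (ξ : RSpace d) :
    Integrable (fun τ => φ (τ, ξ)) :=
  (by fun_prop : Continuous fun τ => φ (τ, ξ)).integrable_of_hasCompactSupport (hc.slice ξ)

/-- The time derivative of a function on space-time. -/
noncomputable def timeDeriv (φ : ℝ × RSpace d → ℂ) (p : ℝ × RSpace d) : ℂ :=
  fderiv ℝ φ p (1, 0)

theorem contDiff_timeDeriv (hφ : ContDiff ℝ ∞ φ) : ContDiff ℝ ∞ (timeDeriv φ) :=
  (hφ.fderiv_right (m := ∞) (by simp)).clm_apply contDiff_const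

theorem hasCompactSupport_timeDeriv (hc : HasCompactSupport φ) :
    HasCompactSupport (timeDeriv φ) :=
  (hc.fderiv (𝕜 := ℝ)).comp_left (g := fun L : ℝ × RSpace d →L[ℝ] ℂ => L (1, 0)) (by simp)

theorem hasDerivAt_slice (hφ : ContDiff ℝ ∞ φ) (τ : ℝ) (ξ : RSpace d) :
    HasDerivAt (fun τ => φ (τ, ξ)) (timeDeriv φ (τ, ξ)) τ := by
  have h := (hφ.differentiable (by simp) (τ, ξ)).hasFDerivAt
  exact h.comp_hasDerivAt τ ((hasDerivAt_id τ).prodMk (hasDerivAt_const τ ξ))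

theorem timeFourier_timeDeriv (hφ : ContDiff ℝ ∞ φ) (hc : HasCompactSupport φ) (t : ℝ)
    (ξ : RSpace d) : timeFourier (timeDeriv φ) t ξ = Complex.I * t * timeFourier φ t ξ := by
  rw [timeFourier_eq, timeFourier_eq]
  have hd : deriv (fun τ => φ (τ, ξ)) = fun τ => timeDeriv φ (τ, ξ) :=
    funext fun τ => (hasDerivAt_slice hφ τ ξ).deriv
  have := Real.fourier_deriv (integrable_slice hφ.continuous hc ξ)
    (fun τ => (hasDerivAt_slice hφ τ ξ).differentiableAt)
    (by rw [hd]; exact integrable_slice (contDiff_timeDeriv hφ).continuous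
          (hasCompactSupport_timeDeriv hc) ξ)
  rw [hd] at this
  rw [this]
  have hp : (Real.pi : ℂ) ≠ 0 := by exact_mod_cast Real.pi_ne_zero
  simp only [smul_eq_mul]
  push_cast
  field_simp

theorem exists_norm_timeFourier_le (hφ : Continuous φ) (hc : HasCompactSupport φ) :
    ∃ C, 0 ≤ C ∧ ∀ t ξ, ‖timeFourier φ t ξ‖ ≤ C := by
  obtain ⟨M, hM⟩ := hc.exists_bound_of_continuous hφ
  obtain ⟨R, hR⟩ := hc.isBounded.subset_closedBall (0 : ℝ × RSpace d)
  have hM0 : 0 ≤ M := (norm_nonneg _).trans (hM 0)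
  refine ⟨M * (volume (Metric.closedBall (0 : ℝ) R)).toReal, by positivity, fun t ξ => ?_⟩
  have hs : Function.support (fun τ => φ (τ, ξ) * Complex.exp (-(Complex.I * ((t * τ : ℝ) : ℂ))))
      ⊆ Metric.closedBall (0 : ℝ) R := by
    intro τ hτ
    have h1 : φ (τ, ξ) ≠ 0 := left_ne_zero_of_mul hτ
    have := hR (subset_tsupport _ h1)
    rw [mem_closedBall_zero_iff] at this ⊢
    exact (norm_fst_le (τ, ξ)).trans this
  rw [timeFourier, ← setIntegral_eq_integral_of_forall_compl_eq_zero
    (fun τ hτ => by_contra fun h => hτ (hs h))]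
  refine norm_setIntegral_le_of_norm_le_const (measure_closedBall_lt_top) fun τ _ => ?_
  rw [norm_mul, show -(Complex.I * ((t * τ : ℝ) : ℂ)) = ((-(t * τ) : ℝ) : ℂ) * Complex.I by
    push_cast; ring, Complex.norm_exp_ofReal_mul_I, mul_one]
  exact hM _

theorem timeFourier_eq_zero {R : ℝ} (hR : tsupport φ ⊆ Metric.closedBall 0 R) (t : ℝ)
    {ξ : RSpace d} (hξ : ξ ∉ Metric.closedBall (0 : RSpace d) R) : timeFourier φ t ξ = 0 := by
  rw [timeFourier]
  refine integral_eq_zero_of_ae (Filter.Eventually.of_forall fun τ => ?_)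
  have : φ (τ, ξ) = 0 := by
    by_contra h
    refine hξ ?_
    have := hR (subset_tsupport _ h)
    rw [mem_closedBall_zero_iff] at this ⊢
    exact (norm_snd_le (τ, ξ)).trans this
  simp [this]

/-- Two time derivatives multiply the transform by `-t²`, so bounding it together with that of the
second derivative gives decay integrable in `t`. The indicator records the compact support in `ξ`.
-/
theorem exists_timeFourier_decay (hφ : ContDiff ℝ ∞ φ) (hc : HasCompactSupport φ) :
    ∃ C R : ℝ, 0 ≤ C ∧ ∀ t ξ, ‖timeFourier φ t ξ‖ ≤
      (1 + t ^ 2)⁻¹ * (Metric.closedBall (0 : RSpace d) R).indicator (fun _ => C) ξ := by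
  obtain ⟨R, hR⟩ := hc.isBounded.subset_closedBall (0 : ℝ × RSpace d)
  obtain ⟨C, hC0, hC⟩ := exists_norm_timeFourier_le hφ.continuous hc
  have hφ1 := contDiff_timeDeriv hφ
  have hc1 := hasCompactSupport_timeDeriv hc
  obtain ⟨C', hC0', hC'⟩ := exists_norm_timeFourier_le (contDiff_timeDeriv hφ1).continuous
    (hasCompactSupport_timeDeriv hc1)
  refine ⟨C + C', R, by positivity, fun t ξ => ?_⟩
  by_cases hξ : ξ ∈ Metric.closedBall (0 : RSpace d) R
  · rw [Set.indicator_of_mem hξ]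
    have h1 := hC t ξ
    have h2 := hC' t ξ
    rw [timeFourier_timeDeriv hφ1 hc1, timeFourier_timeDeriv hφ hc] at h2
    simp only [norm_mul, Complex.norm_I, one_mul, Complex.norm_real, Real.norm_eq_abs] at h2
    rw [← mul_assoc, abs_mul_abs_self] at h2
    rw [inv_mul_eq_div, le_div_iff₀ (by positivity)]
    nlinarith
  · rw [timeFourier_eq_zero hR t hξ, Set.indicator_of_notMem hξ]
    simp

theorem measurable_timeFourier (hφ : Continuous φ) :
    Measurable (fun p : ℝ × RSpace d => timeFourier φ p.1 p.2) := by
  have : StronglyMeasurable (Function.uncurry fun (p : ℝ × RSpace d) (τ : ℝ) =>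
      φ (τ, p.2) * Complex.exp (-(Complex.I * ((p.1 * τ : ℝ) : ℂ)))) := by
    apply Continuous.stronglyMeasurable
    unfold Function.uncurry
    fun_prop
  exact this.integral_prod_right.measurable

theorem integrable_timeFourier_time (hφ : ContDiff ℝ ∞ φ) (hc : HasCompactSupport φ)
    (ξ : RSpace d) : Integrable (fun t => timeFourier φ t ξ) := by
  obtain ⟨C, R, hC, h⟩ := exists_timeFourier_decay hφ hc
  refine (integrable_inv_one_add_sq.mul_const _).mono'
    ((measurable_timeFourier hφ.continuous).comp (measurable_id.prodMk measurable_const)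
      ).aestronglyMeasurable (Filter.Eventually.of_forall fun t => h t ξ)

/-- Fourier inversion in the time variable. -/
theorem integral_exp_mul_timeFourier (hφ : ContDiff ℝ ∞ φ) (hc : HasCompactSupport φ)
    (σ : ℝ) (ξ : RSpace d) :
    ∫ t : ℝ, Complex.exp (-(Complex.I * ((t * σ : ℝ) : ℂ))) * timeFourier φ t ξ =
      2 * Real.pi * φ (-σ, ξ) := by
  have hpi : (0 : ℝ) < 2 * Real.pi := by positivity
  have hg : Continuous (fun τ => φ (τ, ξ)) := hφ.continuous.comp (by fun_prop)
  have hF : Integrable (𝓕 (fun τ => φ (τ, ξ))) := by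
    have := (integrable_timeFourier_time hφ hc ξ).comp_mul_left' hpi.ne'
    refine this.congr (Filter.Eventually.of_forall fun t => ?_)
    simp only [timeFourier_eq]
    rw [inv_mul_cancel_left₀ hpi.ne']
  have h := congrFun (hg.fourierInv_fourier_eq (integrable_slice hφ.continuous hc ξ) hF) (-σ)
  rw [← h, Real.fourierInv_eq_fourier_neg, neg_neg, Real.fourier_real_eq_integral_exp_smul]
  -- The substitution `s = t/(2π)` passes from frequencies normalised with `2π` to those without;
  -- its Jacobian is the factor `2π` in the result.
  have hs := Measure.integral_comp_mul_left (fun s : ℝ => Complex.exp (↑(-2 * Real.pi * s * σ) * Complex.I) •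
    𝓕 (fun τ => φ (τ, ξ)) s) (2 * Real.pi)⁻¹
  rw [inv_inv, abs_of_pos hpi] at hs
  have : (2 * Real.pi : ℂ) = ((2 * Real.pi : ℝ) : ℂ) := by push_cast; rfl
  rw [this, ← Complex.real_smul, ← hs]
  refine integral_congr_ae (Filter.Eventually.of_forall fun t => ?_)
  simp only [timeFourier_eq, smul_eq_mul]
  congr 2
  have : (Real.pi : ℂ) ≠ 0 := by exact_mod_cast Real.pi_ne_zero
  push_cast
  field_simp

end TimeFourier

/-! ### Pairing the square of a solution with test functions -/

section Pairing

variable {d : ℕ} {φ : ℝ × RSpace d → ℂ}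

theorem integrable_timeFourier_space (hφ : ContDiff ℝ ∞ φ) (hc : HasCompactSupport φ) (t : ℝ) :
    Integrable (timeFourier φ t) ∧ MemLp (timeFourier φ t) 2 := by
  obtain ⟨C, R, hC, h⟩ := exists_timeFourier_decay hφ hc
  have hm : AEStronglyMeasurable (timeFourier φ t) (volume : Measure (RSpace d)) :=
    ((measurable_timeFourier hφ.continuous).comp
      (measurable_const.prodMk measurable_id)).aestronglyMeasurable
  have hl : ∀ p : ℝ≥0∞, MemLp (fun ξ => (1 + t ^ 2)⁻¹ *
      (Metric.closedBall (0 : RSpace d) R).indicator (fun _ => C) ξ) p volume := fun p =>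
    (memLp_indicator_const p Metric.isClosed_closedBall.measurableSet C
      (Or.inr measure_closedBall_lt_top.ne)).const_mul _
  have hb : ∀ᵐ ξ : RSpace d, ‖timeFourier φ t ξ‖ ≤ ‖(1 + t ^ 2)⁻¹ *
      (Metric.closedBall (0 : RSpace d) R).indicator (fun _ => C) ξ‖ :=
    Filter.Eventually.of_forall fun ξ => (h t ξ).trans (le_abs_self _)
  exact ⟨memLp_one_iff_integrable.1 ((hl 1).of_le hm hb), (hl 2).of_le hm hb⟩

/-- The dilated partial Fourier transform whose spatial Fourier transform is the space-time one. -/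
noncomputable def sliceKernel (φ : ℝ × RSpace d → ℂ) (t : ℝ) (η : RSpace d) : ℂ :=
  (((2 * Real.pi) ^ d : ℝ) : ℂ) * timeFourier φ t ((2 * Real.pi) • η)

theorem two_pi_pos : (0 : ℝ) < 2 * Real.pi := by positivity

theorem integrable_sliceKernel (hφ : ContDiff ℝ ∞ φ) (hc : HasCompactSupport φ) (t : ℝ) :
    Integrable (sliceKernel φ t) :=
  ((integrable_timeFourier_space hφ hc t).1.comp_smul two_pi_pos.ne').const_mul _

theorem memLp_comp_smul {g : RSpace d → ℂ} (hg : MemLp g 2) {c : ℝ} (hc : c ≠ 0) :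
    MemLp (fun ξ => g (c • ξ)) 2 := by
  have hm : AEStronglyMeasurable (fun ξ => g (c • ξ)) (volume : Measure (RSpace d)) :=
    hg.1.comp_quasiMeasurePreserving (Measure.quasiMeasurePreserving_smul volume hc)
  rw [memLp_two_iff_integrable_sq_norm hm]
  exact ((memLp_two_iff_integrable_sq_norm hg.1).1 hg).comp_smul hc

theorem memLp_sliceKernel (hφ : ContDiff ℝ ∞ φ) (hc : HasCompactSupport φ) (t : ℝ) :
    MemLp (sliceKernel φ t) 2 :=
  (memLp_comp_smul (integrable_timeFourier_space hφ hc t).2 two_pi_pos.ne').const_mul _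

/-- Fubini separates the time integral, and `ξ = 2πη` matches the two normalisations of the spatial
transform. The Jacobian `(2π)^d` is the factor built into `sliceKernel`. -/
theorem spaceTimeFourier_eq (hφ : ContDiff ℝ ∞ φ) (hc : HasCompactSupport φ) (t : ℝ)
    (x : RSpace d) : spaceTimeFourier φ t x = 𝓕 (sliceKernel φ t) x := by
  have hi : Integrable (fun p : ℝ × RSpace d =>
      φ p * Complex.exp (-(Complex.I * ((t * p.1 + inner ℝ x p.2 : ℝ) : ℂ)))) := by
    refine Continuous.integrable_of_hasCompactSupport ?_ hc.mul_right
    have := hφ.continuous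
    fun_prop
  have h1 : spaceTimeFourier φ t x =
      ∫ ξ, Complex.exp (-(Complex.I * ((inner ℝ x ξ : ℝ) : ℂ))) * timeFourier φ t ξ := by
    rw [spaceTimeFourier, Measure.volume_eq_prod, integral_prod_symm _ hi]
    refine integral_congr_ae (Filter.Eventually.of_forall fun ξ => ?_)
    simp only [timeFourier, ← integral_const_mul]
    refine integral_congr_ae (Filter.Eventually.of_forall fun τ => ?_)
    simp only
    rw [mul_left_comm, ← Complex.exp_add]
    congr 2
    push_cast; ring
  have hs := Measure.integral_comp_smul volume (fun ξ : RSpace d =>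
    Complex.exp (-(Complex.I * ((inner ℝ x ξ : ℝ) : ℂ))) * timeFourier φ t ξ) (2 * Real.pi)
  rw [finrank_euclideanSpace_fin, abs_of_pos (by positivity), ← h1] at hs
  rw [Real.fourier_eq']
  have hp : (2 * Real.pi) ^ d ≠ 0 := by positivity
  rw [eq_inv_smul_iff₀ hp, ← integral_smul] at hs
  rw [← hs]
  refine integral_congr_ae (Filter.Eventually.of_forall fun η => ?_)
  simp only [sliceKernel, smul_eq_mul, Complex.real_smul, inner_smul_right]
  rw [mul_left_comm]
  congr 3
  rw [real_inner_comm]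
  push_cast; ring

theorem measurable_hatL2 (u : L2Space d) : Measurable (hatL2 u) :=
  (Lp.stronglyMeasurable _).measurable.comp (measurable_const_smul _)

theorem memLp_hatL2 (u : L2Space d) : MemLp (hatL2 u) 2 :=
  memLp_comp_smul (Lp.memLp _) (inv_ne_zero two_pi_pos.ne')

theorem hatL2_two_pi_smul (u : L2Space d) (ξ : RSpace d) :
    hatL2 u ((2 * Real.pi) • ξ) = (𝓕 u : L2Space d) ξ := by
  rw [hatL2, inv_smul_smul₀ two_pi_pos.ne']

theorem quasiMeasurePreserving_shear_add :
    Measure.QuasiMeasurePreserving (fun p : RSpace d × RSpace d => (2⁻¹ : ℝ) • p.1 + p.2) :=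
  Measure.quasiMeasurePreserving_snd.comp (measurePreserving_shear_add (d := d) 2⁻¹).quasiMeasurePreserving

theorem quasiMeasurePreserving_shear_sub :
    Measure.QuasiMeasurePreserving (fun p : RSpace d × RSpace d => (2⁻¹ : ℝ) • p.1 - p.2) :=
  Measure.quasiMeasurePreserving_snd.comp (measurePreserving_shear_sub (d := d) 2⁻¹).quasiMeasurePreserving

theorem pairProd_congr_ae {f g : RSpace d → ℂ} (h : f =ᵐ[volume] g) :
    pairProd f =ᵐ[volume] pairProd g := by
  filter_upwards [quasiMeasurePreserving_shear_add.ae h, quasiMeasurePreserving_shear_sub.ae h]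
    with p h1 h2
  rw [pairProd, pairProd, h1, h2]

theorem IsSchrodingerSolution.hatL2_ae {u₀ : L2Space d} {u : ℝ → L2Space d}
    (hu : IsSchrodingerSolution u₀ u) (t : ℝ) :
    hatL2 (u t) =ᵐ[volume] fun ξ =>
      Complex.exp (-(Complex.I * ((t * ‖ξ‖ ^ 2 : ℝ) : ℂ))) * hatL2 u₀ ξ := by
  have h := phaseMul_ae (-t) (𝓕 u₀ : L2Space d)
  rw [← hu.fourier_eq] at h
  have h2 := (Measure.quasiMeasurePreserving_smul (volume : Measure (RSpace d))
    (inv_ne_zero two_pi_pos.ne')).ae h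
  filter_upwards [h2] with ξ hξ
  refine hξ.trans ?_
  rw [hatL2, phase]
  congr 2
  rw [norm_smul, Real.norm_of_nonneg (by positivity)]
  have : (Real.pi : ℂ) ≠ 0 := by exact_mod_cast Real.pi_ne_zero
  push_cast
  field_simp

/-- The phases of the two particles add up to the total kinetic energy, which depends on `ζ` only
through `|ζ|`. -/
theorem pairProd_phase (f : RSpace d → ℂ) (t : ℝ) (p : RSpace d × RSpace d) :
    pairProd (fun ξ => Complex.exp (-(Complex.I * ((t * ‖ξ‖ ^ 2 : ℝ) : ℂ))) * f ξ) p =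
      Complex.exp (-(Complex.I * ((t * energy p : ℝ) : ℂ))) * pairProd f p := by
  rw [energy_eq]
  simp only [pairProd]
  rw [mul_mul_mul_comm, ← Complex.exp_add]
  congr 2
  push_cast; ring

/-- The time slices of the space-time Fourier pairing in centre-of-mass coordinates. -/
theorem IsSchrodingerSolution.integral_slice {u₀ : L2Space d} {u : ℝ → L2Space d}
    (hu : IsSchrodingerSolution u₀ u) (hφ : ContDiff ℝ ∞ φ) (hc : HasCompactSupport φ) (t : ℝ) :
    ∫ x, u t x ^ 2 * spaceTimeFourier φ t x = ((((2 * Real.pi) ^ d)⁻¹ : ℝ) : ℂ) *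
      ∫ p, Complex.exp (-(Complex.I * ((t * energy p : ℝ) : ℂ))) *
        (pairProd (hatL2 u₀) p * timeFourier φ t p.1) := by
  set v : RSpace d → ℂ := ⇑(𝓕 (u t) : L2Space d) with hv
  have hvm : Measurable v := (Lp.stronglyMeasurable _).measurable
  have hi := integrable_pairProd_mul hvm (Lp.memLp _) (integrable_sliceKernel hφ hc t)
  have hcom : ∀ p : RSpace d × RSpace d, pairProd v p * sliceKernel φ t p.1 =
      (fun q : RSpace d × RSpace d => v q.1 * v q.2 * sliceKernel φ t (q.1 + q.2)) (comMap p) := by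
    intro p
    simp only [comMap, pairProd]
    congr 2
    module
  have hmeas : AEStronglyMeasurable (fun q : RSpace d × RSpace d =>
      v q.1 * v q.2 * sliceKernel φ t (q.1 + q.2)) (Measure.map comMap volume) := by
    have hk : Measurable (sliceKernel φ t) := by
      have := measurable_timeFourier hφ.continuous
      unfold sliceKernel
      fun_prop
    exact (by fun_prop : Measurable _).aestronglyMeasurable
  have hi' : Integrable (fun q : RSpace d × RSpace d =>
      v q.1 * v q.2 * sliceKernel φ t (q.1 + q.2)) := by
    rw [← measurePreserving_comMap.map_eq, integrable_map_measure hmeas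
      measurable_comMap.aemeasurable]
    exact hi.congr (Filter.Eventually.of_forall hcom)
  have e1 : ∫ x, u t x ^ 2 * spaceTimeFourier φ t x =
      ∫ p, pairProd v p * sliceKernel φ t p.1 := by
    simp only [spaceTimeFourier_eq hφ hc]
    rw [integral_sq_mul_fourier _ (integrable_sliceKernel hφ hc t) (memLp_sliceKernel hφ hc t)]
    have := integral_prod _ hi'
    rw [← hv, ← this, ← Measure.volume_eq_prod]
    conv_lhs => rw [← measurePreserving_comMap.map_eq]
    rw [integral_map measurable_comMap.aemeasurable hmeas]
    exact integral_congr_ae (Filter.Eventually.of_forall fun p => (hcom p).symm)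
  have e2 : ∀ p : RSpace d × RSpace d, pairProd v p * sliceKernel φ t p.1 =
      (((2 * Real.pi) ^ d : ℝ) : ℂ) * (fun q : RSpace d × RSpace d => pairProd (hatL2 (u t)) q *
        timeFourier φ t q.1) ((2 * Real.pi) • p) := by
    intro p
    simp only [pairProd, sliceKernel, hv, Prod.smul_fst, Prod.smul_snd, ← hatL2_two_pi_smul,
      smul_add, smul_sub, smul_comm (2 * Real.pi) (2⁻¹ : ℝ)]
    ring
  have hs := Measure.integral_comp_smul
    ((volume : Measure (RSpace d)).prod (volume : Measure (RSpace d)))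
    (fun q : RSpace d × RSpace d => pairProd (hatL2 (u t)) q * timeFourier φ t q.1) (2 * Real.pi)
  rw [← Measure.volume_eq_prod] at hs
  rw [e1, integral_congr_ae (Filter.Eventually.of_forall e2), integral_const_mul,
    hs, Module.finrank_prod, finrank_euclideanSpace_fin,
    abs_of_pos (by positivity), Complex.real_smul, ← mul_assoc]
  -- The factor `(2π)^d` of `sliceKernel` meets `(2π)^(-2d)` from dilating `ℝ^d × ℝ^d`.
  congr 1
  · rw [pow_add, mul_inv]
    have : (((2 * Real.pi) ^ d : ℝ) : ℂ) ≠ 0 := by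
      rw [Complex.ofReal_ne_zero]; positivity
    push_cast at this ⊢
    field_simp
  · refine integral_congr_ae ?_
    filter_upwards [pairProd_congr_ae (hu.hatL2_ae t)] with p hp
    rw [hp, pairProd_phase, mul_assoc]

/-- The space-time Fourier pairing in centre-of-mass coordinates. -/
theorem IsSchrodingerSolution.integral_pairing {u₀ : L2Space d} {u : ℝ → L2Space d}
    (hu : IsSchrodingerSolution u₀ u) (hφ : ContDiff ℝ ∞ φ) (hc : HasCompactSupport φ) :
    Integrable (fun t => ∫ x, u t x ^ 2 * spaceTimeFourier φ t x) ∧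
      ∫ t, ∫ x, u t x ^ 2 * spaceTimeFourier φ t x =
        ((((2 * Real.pi) ^ d)⁻¹ * (2 * Real.pi) : ℝ) : ℂ) *
          ∫ p, pairProd (hatL2 u₀) p * φ (-energy p, p.1) := by
  obtain ⟨C, R, hC, hdec⟩ := exists_timeFourier_decay hφ hc
  have hfm := measurable_hatL2 u₀
  have hind : Integrable ((Metric.closedBall (0 : RSpace d) R).indicator (fun _ => (C : ℂ))) :=
    (integrable_indicator_iff Metric.isClosed_closedBall.measurableSet).2
      (integrableOn_const measure_closedBall_lt_top.ne)
  -- The decay in `t` and the cutoff in `ξ` give a dominating function integrable over `(t, ξ, ζ)`,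
  -- so the time integral may be performed first.
  have hmaj := integrable_inv_one_add_sq.mul_prod (integrable_pairProd_mul hfm (memLp_hatL2 u₀) hind).norm
  have hI : Integrable (Function.uncurry fun (t : ℝ) (p : RSpace d × RSpace d) =>
      Complex.exp (-(Complex.I * ((t * energy p : ℝ) : ℂ))) *
        (pairProd (hatL2 u₀) p * timeFourier φ t p.1)) (volume.prod volume) := by
    refine hmaj.mono' ?_ (Filter.Eventually.of_forall fun q => ?_)
    · have h1 := measurable_timeFourier hφ.continuous
      have h2 := measurable_pairProd hfm
      refine Measurable.aestronglyMeasurable ?_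
      have h3 : Measurable (fun q : ℝ × RSpace d × RSpace d => timeFourier φ q.1 q.2.1) :=
        h1.comp (by fun_prop : Measurable fun q : ℝ × RSpace d × RSpace d => (q.1, q.2.1))
      unfold Function.uncurry energy
      fun_prop
    · simp only [Function.uncurry]
      rw [norm_mul, norm_mul, norm_mul, show -(Complex.I * ((q.1 * energy q.2 : ℝ) : ℂ)) =
        ((-(q.1 * energy q.2) : ℝ) : ℂ) * Complex.I by push_cast; ring,
        Complex.norm_exp_ofReal_mul_I, one_mul, mul_left_comm]
      refine mul_le_mul_of_nonneg_left ((hdec q.1 q.2.1).trans (le_of_eq ?_)) (norm_nonneg _)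
      congr 1
      by_cases h : q.2.1 ∈ Metric.closedBall (0 : RSpace d) R
      · rw [Set.indicator_of_mem h, Set.indicator_of_mem h]
        simp [abs_of_nonneg hC]
      · rw [Set.indicator_of_notMem h, Set.indicator_of_notMem h]
        simp
  simp only [hu.integral_slice hφ hc]
  refine ⟨hI.integral_prod_left.const_mul _, ?_⟩
  rw [integral_const_mul, integral_integral_swap hI, Complex.ofReal_mul, mul_assoc]
  congr 1
  rw [← integral_const_mul]
  refine integral_congr_ae (Filter.Eventually.of_forall fun p => ?_)
  have := integral_exp_mul_timeFourier hφ hc (energy p) p.1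
  simp only [mul_left_comm _ (pairProd (hatL2 u₀) p)]
  rw [integral_const_mul, this]
  push_cast; ring

end Pairing

/-! ### Polar coordinates and the passage to space-time frequencies -/

section Polar

variable {d : ℕ}

/-- The unit sphere. -/
abbrev USphere (d : ℕ) : Type := Metric.sphere (0 : RSpace d) 1

/-- Surface measure on the unit sphere. -/
noncomputable def surf (d : ℕ) : Measure (USphere d) := (volume : Measure (RSpace d)).toSphere

instance (d : ℕ) : IsFiniteMeasure (surf d) := by unfold surf; infer_instance

/-- The measure `4 r dr` on the half line. -/
noncomputable def radialMeasure : Measure ℝ :=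
  (volume.restrict (Set.Ioi 0)).withDensity fun r => ENNReal.ofReal (4 * r)

/-- The measure `r^(d-1) dr` on the half line. -/
noncomputable def polarMeasure (d : ℕ) : Measure ℝ :=
  radialMeasure.withDensity fun r => ENNReal.ofReal (r ^ (d - 2) / 4)

instance : SFinite radialMeasure := by unfold radialMeasure; infer_instance

instance (d : ℕ) : SFinite (polarMeasure d) := by unfold polarMeasure; infer_instance

theorem ae_radialMeasure_pos : ∀ᵐ r ∂radialMeasure, 0 < r :=
  (withDensity_absolutelyContinuous _ _).ae_le (ae_restrict_mem measurableSet_Ioi)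

theorem ae_polarMeasure_pos (d : ℕ) : ∀ᵐ r ∂polarMeasure d, 0 < r :=
  (withDensity_absolutelyContinuous _ _).ae_le ae_radialMeasure_pos

theorem lintegral_polarMeasure (hd : 2 ≤ d) {g : ℝ → ℝ≥0∞} (hg : Measurable g) :
    ∫⁻ r, g r ∂polarMeasure d = ∫⁻ r in Set.Ioi 0, ENNReal.ofReal (r ^ (d - 1)) * g r := by
  rw [polarMeasure, lintegral_withDensity_eq_lintegral_mul _ (by fun_prop) hg, radialMeasure,
    lintegral_withDensity_eq_lintegral_mul _ (by fun_prop) (by fun_prop)]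
  refine setLIntegral_congr_fun measurableSet_Ioi fun r hr => ?_
  simp only [Pi.mul_apply]
  have hr' : (0 : ℝ) ≤ 4 * r := by have := hr.out; positivity
  rw [← mul_assoc, ← ENNReal.ofReal_mul hr']
  congr 2
  obtain ⟨k, rfl⟩ := Nat.exists_eq_add_of_le hd
  simp only [show 2 + k - 2 = k by omega, show 2 + k - 1 = k + 1 by omega, pow_succ]
  ring

theorem nontrivial_RSpace (hd : 2 ≤ d) : Nontrivial (RSpace d) :=
  Module.nontrivial_of_finrank_pos (R := ℝ) (by rw [finrank_euclideanSpace_fin]; omega)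

/-- Polar coordinates. -/
theorem measurePreserving_polar (hd : 2 ≤ d) :
    MeasurePreserving (fun q : USphere d × ℝ => q.2 • (q.1 : RSpace d))
      ((surf d).prod (polarMeasure d)) volume := by
  have hmeas : Measurable (fun q : USphere d × ℝ => q.2 • (q.1 : RSpace d)) := by fun_prop
  have := nontrivial_RSpace hd
  refine ⟨hmeas, Measure.ext_of_lintegral _ fun g hg => ?_⟩
  rw [lintegral_map hg hmeas, lintegral_prod_symm _ (by fun_prop),
    lintegral_polarMeasure hd (by fun_prop)]
  have h1 : ∫⁻ x, g x = ∫⁻ x : ({0}ᶜ : Set (RSpace d)), g x.1 ∂(volume.comap Subtype.val) := by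
    rw [lintegral_subtype_comap (measurableSet_singleton _).compl, restrict_compl_singleton]
  have h2 := (volume : Measure (RSpace d)).measurePreserving_homeomorphUnitSphereProd.symm
    (homeomorphUnitSphereProd (RSpace d)).toMeasurableEquiv
  have h3 := h2.lintegral_comp_emb (MeasurableEquiv.measurableEmbedding _) (fun x => g x.1)
  rw [h1, ← h3]
  rw [lintegral_prod_symm _ (by
    refine Measurable.aemeasurable ?_
    exact (hg.comp measurable_subtype_coe).comp (MeasurableEquiv.measurable _))]
  rw [finrank_euclideanSpace_fin, Measure.volumeIoiPow,
    lintegral_withDensity_eq_lintegral_mul _ (by fun_prop) (by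
      refine Measurable.lintegral_prod_left' (f := fun q : USphere d × Set.Ioi (0 : ℝ) =>
        g ((homeomorphUnitSphereProd (RSpace d)).toMeasurableEquiv.symm q).1) ?_
      exact (hg.comp measurable_subtype_coe).comp (MeasurableEquiv.measurable _))]
  exact (lintegral_subtype_comap measurableSet_Ioi (fun r : ℝ => ENNReal.ofReal (r ^ (d - 1)) *
    ∫⁻ θ : USphere d, g (r • (θ : RSpace d)) ∂surf d)).symm

/-- Polar coordinates in the second variable of `ℝ^d × ℝ^d`. -/
def polarMap (q : (RSpace d × ℝ) × USphere d) : RSpace d × RSpace d :=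
  (q.1.1, q.1.2 • (q.2 : RSpace d))

theorem measurable_polarMap : Measurable (polarMap : (RSpace d × ℝ) × USphere d → _) := by
  unfold polarMap; fun_prop

theorem measurePreserving_polarMap (hd : 2 ≤ d) :
    MeasurePreserving (polarMap : (RSpace d × ℝ) × USphere d → _)
      ((volume.prod (polarMeasure d)).prod (surf d)) volume := by
  have h1 := (MeasurePreserving.id (volume : Measure (RSpace d))).prod (measurePreserving_polar hd)
  have h2 := (MeasurePreserving.id (volume : Measure (RSpace d))).prod
    (Measure.measurePreserving_swap (μ := polarMeasure d) (ν := surf d))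
  have h3 := measurePreserving_prodAssoc (volume : Measure (RSpace d)) (polarMeasure d) (surf d)
  exact h1.comp (h2.comp h3)

/-- The passage from `(ξ, r)` to the space-time frequency `(-(|ξ|²/2 + 2 r²), ξ)`. -/
noncomputable def freqMap (q : RSpace d × ℝ) : ℝ × RSpace d :=
  (-(‖q.1‖ ^ 2 / 2 + 2 * q.2 ^ 2), q.1)

theorem measurable_freqMap : Measurable (freqMap : RSpace d × ℝ → _) := by
  unfold freqMap; fun_prop

/-- The substitution `s = -2r²` has Jacobian `4r`, the density of `radialMeasure`. The remaining
density `r^(d-2)/4` of `polarMeasure` is what is left of `r^(d-1)`. -/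
theorem measurePreserving_neg_two_mul_sq :
    MeasurePreserving (fun r : ℝ => -(2 * r ^ 2)) radialMeasure (volume.restrict (Set.Iio 0)) := by
  have hmeas : Measurable (fun r : ℝ => -(2 * r ^ 2)) := by fun_prop
  refine ⟨hmeas, Measure.ext_of_lintegral _ fun g hg => ?_⟩
  rw [lintegral_map hg hmeas, radialMeasure,
    lintegral_withDensity_eq_lintegral_mul _ (by fun_prop) (by fun_prop)]
  have himg : (fun r : ℝ => -(2 * r ^ 2)) '' Set.Ioi 0 = Set.Iio 0 := by
    ext s
    constructor
    · rintro ⟨r, hr, rfl⟩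
      have : 0 < r := hr
      simp only [Set.mem_Iio]
      have : 0 < r ^ 2 := by positivity
      linarith
    · intro hs
      have hs' : s < 0 := hs
      refine ⟨Real.sqrt (-s / 2), Real.sqrt_pos.2 (by linarith), ?_⟩
      simp only
      rw [Real.sq_sqrt (by linarith)]
      ring
  have hinj : Set.InjOn (fun r : ℝ => -(2 * r ^ 2)) (Set.Ioi 0) := by
    intro a ha b hb hab
    simp only [neg_inj] at hab
    have ha' : 0 < a := ha
    have hb' : 0 < b := hb
    nlinarith [mul_pos ha' hb', sq_nonneg (a - b), sq_nonneg (a + b)]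
  rw [← himg, lintegral_image_eq_lintegral_abs_deriv_mul measurableSet_Ioi (f' := fun r => -(4 * r))
    (fun r _ => HasDerivAt.hasDerivWithinAt (by
      have := ((hasDerivAt_pow 2 r).const_mul 2).neg
      rw [show -(2 * (((2 : ℕ) : ℝ) * r ^ (2 - 1))) = -(4 * r) by norm_num; ring] at this
      exact this)) hinj]
  refine setLIntegral_congr_fun measurableSet_Ioi fun r hr => ?_
  have : 0 < r := hr
  simp only [Pi.mul_apply]
  rw [abs_neg, abs_of_pos (by positivity)]

/-- After the radial substitution only a shear by `-|ξ|²/2` and a swap remain. The image is the open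
region below the paraboloid, which carries the transform of `u²`. -/
theorem measurePreserving_freqMap :
    MeasurePreserving (freqMap : RSpace d × ℝ → _) (volume.prod radialMeasure)
      (volume.restrict {p | p.1 + ‖p.2‖ ^ 2 / 2 < 0}) := by
  have h1 := (MeasurePreserving.id (volume : Measure (RSpace d))).prod
    measurePreserving_neg_two_mul_sq
  have h2 : MeasurePreserving (fun p : RSpace d × ℝ => (p.1, -(‖p.1‖ ^ 2 / 2) + p.2)) :=
    (MeasurePreserving.id (volume : Measure (RSpace d))).skew_product
      (g := fun x y => -(‖x‖ ^ 2 / 2) + y) (by fun_prop)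
      (Filter.Eventually.of_forall fun x => (measurePreserving_add_left volume _).map_eq)
  have h3 : MeasurePreserving (Prod.swap : RSpace d × ℝ → _) := Measure.measurePreserving_swap
  have hs : MeasurableSet {p : ℝ × RSpace d | p.1 + ‖p.2‖ ^ 2 / 2 < 0} :=
    measurableSet_lt (by fun_prop) measurable_const
  have h4 := (h3.comp h2).restrict_preimage hs
  have hpre : (Prod.swap ∘ fun p : RSpace d × ℝ => (p.1, -(‖p.1‖ ^ 2 / 2) + p.2)) ⁻¹'
      {p : ℝ × RSpace d | p.1 + ‖p.2‖ ^ 2 / 2 < 0} = Set.univ ×ˢ Set.Iio 0 := by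
    ext p
    simp
  rw [hpre, Measure.volume_eq_prod, ← Measure.prod_restrict, Measure.restrict_univ] at h4
  have e : (Prod.swap ∘ fun p : RSpace d × ℝ => (p.1, -(‖p.1‖ ^ 2 / 2) + p.2)) ∘
      Prod.map id (fun r : ℝ => -(2 * r ^ 2)) = freqMap := by
    funext p
    simp only [freqMap, Function.comp_apply, Prod.swap, Prod.map, id, Prod.mk.injEq, and_true]
    ring
  rw [← e]
  exact h4.comp h1

end Polar

/-! ### The space-time transform of `u²` and its weighted norm -/

section Multiplier

variable {d : ℕ}

/-- The integral of `f(ξ/2 + rθ) f(ξ/2 - rθ)` over `θ` in the unit sphere. -/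
noncomputable def sphMean (f : RSpace d → ℂ) (q : RSpace d × ℝ) : ℂ :=
  ∫ θ : USphere d, pairProd f (polarMap (q, θ)) ∂surf d

/-- The space-time Fourier transform of the square of a Schrödinger evolution. -/
noncomputable def spectralDensity (f : RSpace d → ℂ) (p : ℝ × RSpace d) : ℂ :=
  if p.1 + ‖p.2‖ ^ 2 / 2 < 0 then
    ((((2 * Real.pi) ^ d)⁻¹ * (2 * Real.pi) *
      (Real.sqrt (-(p.1 + ‖p.2‖ ^ 2 / 2) / 2) ^ (d - 2) / 4) : ℝ) : ℂ) *
      sphMean f (p.2, Real.sqrt (-(p.1 + ‖p.2‖ ^ 2 / 2) / 2))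
  else 0

theorem stronglyMeasurable_sphMean {f : RSpace d → ℂ} (hf : Measurable f) :
    StronglyMeasurable (sphMean f) := by
  have h := (measurable_pairProd hf).comp measurable_polarMap
  exact (h.stronglyMeasurable (f := fun q : (RSpace d × ℝ) × USphere d =>
    pairProd f (polarMap q))).integral_prod_right'

theorem measurable_spectralDensity {f : RSpace d → ℂ} (hf : Measurable f) :
    Measurable (spectralDensity f) := by
  have h := (stronglyMeasurable_sphMean hf).measurable
  refine Measurable.ite (measurableSet_lt (by fun_prop) measurable_const) ?_ measurable_const
  fun_prop

theorem spectralDensity_freqMap (f : RSpace d → ℂ) {q : RSpace d × ℝ} (hq : 0 < q.2) :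
    spectralDensity f (freqMap q) =
      ((((2 * Real.pi) ^ d)⁻¹ * (2 * Real.pi) * (q.2 ^ (d - 2) / 4) : ℝ) : ℂ) * sphMean f q := by
  have e : (freqMap q).1 + ‖(freqMap q).2‖ ^ 2 / 2 = -(2 * q.2 ^ 2) := by
    simp only [freqMap]; ring
  have hs : Real.sqrt (-(-(2 * q.2 ^ 2)) / 2) = q.2 := by
    rw [show -(-(2 * q.2 ^ 2)) / 2 = q.2 ^ 2 by ring, Real.sqrt_sq hq.le]
  rw [spectralDensity, e, hs, if_pos (by have : 0 < q.2 ^ 2 := by positivity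
                                         linarith)]
  rfl

theorem ae_pos_snd : ∀ᵐ q ∂((volume : Measure (RSpace d)).prod radialMeasure), 0 < q.2 :=
  Measure.quasiMeasurePreserving_snd.ae ae_radialMeasure_pos

theorem lintegral_spectral {f : RSpace d → ℂ} (hf : Measurable f)
    {w : ℝ × RSpace d → ℝ≥0∞} (hw : Measurable w) (n : ℕ) (hn : n ≠ 0) :
    ∫⁻ p, w p * ‖spectralDensity f p‖ₑ ^ n =
      ∫⁻ q, w (freqMap q) * ‖spectralDensity f (freqMap q)‖ₑ ^ n
        ∂((volume : Measure (RSpace d)).prod radialMeasure) := by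
  have hm : Measurable fun p => w p * ‖spectralDensity f p‖ₑ ^ n :=
    hw.mul ((measurable_spectralDensity hf).enorm.pow_const n)
  rw [measurePreserving_freqMap.lintegral_comp (f := fun p => w p * ‖spectralDensity f p‖ₑ ^ n) hm,
    ← lintegral_indicator (measurableSet_lt (by fun_prop) measurable_const)]
  refine lintegral_congr fun p => ?_
  by_cases hp : p ∈ {p : ℝ × RSpace d | p.1 + ‖p.2‖ ^ 2 / 2 < 0}
  · rw [Set.indicator_of_mem hp]
  · rw [Set.indicator_of_notMem hp, spectralDensity, if_neg (by exact hp)]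
    simp [hn]

theorem lintegral_polarMap (hd : 2 ≤ d) {g : RSpace d × RSpace d → ℝ≥0∞} (hg : Measurable g) :
    ∫⁻ p, g p = ∫⁻ q, ENNReal.ofReal (q.2 ^ (d - 2) / 4) * ∫⁻ θ, g (polarMap (q, θ)) ∂surf d
      ∂((volume : Measure (RSpace d)).prod radialMeasure) := by
  have hm : Measurable fun q => g (polarMap q) := hg.comp measurable_polarMap
  rw [← (measurePreserving_polarMap hd).lintegral_comp hg, lintegral_prod _ hm.aemeasurable,
    polarMeasure, prod_withDensity_right (by fun_prop),
    lintegral_withDensity_eq_lintegral_mul _ (by fun_prop) hm.lintegral_prod_right']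
  rfl

theorem norm_polarMap_snd {q : RSpace d × ℝ} (hq : 0 < q.2) (θ : USphere d) :
    ‖(polarMap (q, θ)).2‖ = q.2 := by
  simp [polarMap, norm_smul, abs_of_pos hq]

theorem energy_polarMap {q : RSpace d × ℝ} (hq : 0 < q.2) (θ : USphere d) :
    (-energy (polarMap (q, θ)), (polarMap (q, θ)).1) = freqMap q := by
  rw [energy, norm_polarMap_snd hq]
  rfl

theorem enorm_spectralDensity_freqMap_le (f : RSpace d → ℂ) {q : RSpace d × ℝ} (hq : 0 < q.2) :
    ‖spectralDensity f (freqMap q)‖ₑ ≤ ENNReal.ofReal (((2 * Real.pi) ^ d)⁻¹ * (2 * Real.pi)) *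
      (ENNReal.ofReal (q.2 ^ (d - 2) / 4) * ∫⁻ θ, ‖pairProd f (polarMap (q, θ))‖ₑ ∂surf d) := by
  have h0 : 0 ≤ ((2 * Real.pi) ^ d)⁻¹ * (2 * Real.pi) := by positivity
  rw [spectralDensity_freqMap f hq, enorm_mul, ← mul_assoc (ENNReal.ofReal _),
    ← ENNReal.ofReal_mul h0]
  refine mul_le_mul' (le_of_eq ?_) (enorm_integral_le_lintegral_enorm _)
  rw [← ofReal_norm, Complex.norm_real, Real.norm_of_nonneg (by positivity)]

/-- The density is dominated by the fibre integrals of `|pairProd f|`. A compact set bounds `ξ`, and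
over a ball of `ξ` the pair product is integrable in both variables. -/
theorem locallyIntegrable_spectralDensity (hd : 2 ≤ d) {f : RSpace d → ℂ} (hf : Measurable f)
    (h2 : MemLp f 2) : LocallyIntegrable (spectralDensity f) := by
  rw [locallyIntegrable_iff]
  intro K hK
  obtain ⟨R, hR⟩ := hK.isBounded.subset_closedBall (0 : ℝ × RSpace d)
  refine ⟨(measurable_spectralDensity hf).aestronglyMeasurable, ?_⟩
  have hind : Integrable ((Metric.closedBall (0 : RSpace d) R).indicator (fun _ => (1 : ℂ))) :=
    (integrable_indicator_iff Metric.isClosed_closedBall.measurableSet).2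
      (integrableOn_const measure_closedBall_lt_top.ne)
  have hfin := (integrable_pairProd_mul hf h2 hind).2
  set k := (Metric.closedBall (0 : RSpace d) R).indicator (fun _ => (1 : ℂ)) with hk
  have hkm : Measurable k := measurable_const.indicator Metric.isClosed_closedBall.measurableSet
  have hg : Measurable fun p : RSpace d × RSpace d => ‖pairProd f p * k p.1‖ₑ :=
    ((measurable_pairProd hf).mul (hkm.comp measurable_fst)).enorm
  have hKm := hK.measurableSet
  rw [hasFiniteIntegral_iff_enorm] at hfin ⊢
  rw [lintegral_polarMap hd hg] at hfin
  have h1 : ∫⁻ p in K, ‖spectralDensity f p‖ₑ =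
      ∫⁻ p, K.indicator (fun _ => (1 : ℝ≥0∞)) p * ‖spectralDensity f p‖ₑ ^ 1 := by
    rw [← lintegral_indicator hKm]
    refine lintegral_congr fun p => ?_
    by_cases hp : p ∈ K <;> simp [hp]
  rw [h1, lintegral_spectral hf (measurable_const.indicator hKm) 1 one_ne_zero]
  refine lt_of_le_of_lt ?_ (ENNReal.mul_lt_top (ENNReal.ofReal_lt_top
    (r := ((2 * Real.pi) ^ d)⁻¹ * (2 * Real.pi))) hfin)
  rw [← lintegral_const_mul' _ _ ENNReal.ofReal_ne_top]
  refine lintegral_mono_ae ?_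
  filter_upwards [ae_pos_snd] with q hq
  by_cases hqK : freqMap q ∈ K
  · rw [Set.indicator_of_mem hqK, one_mul, pow_one]
    refine (enorm_spectralDensity_freqMap_le f hq).trans (le_of_eq ?_)
    have : k q.1 = 1 := by
      refine Set.indicator_of_mem ?_ _
      have := hR hqK
      rw [mem_closedBall_zero_iff] at this ⊢
      exact (norm_snd_le (freqMap q)).trans this
    simp only [polarMap, this, mul_one]
  · rw [Set.indicator_of_notMem hqK, zero_mul]
    exact zero_le

theorem integrable_pairProd_mul_energy {f : RSpace d → ℂ} (hf : Measurable f)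
    (h2 : MemLp f 2) {φ : ℝ × RSpace d → ℂ} (hφ : Continuous φ) (hc : HasCompactSupport φ) :
    Integrable (fun p : RSpace d × RSpace d => pairProd f p * φ (-energy p, p.1)) := by
  obtain ⟨M, hM⟩ := hc.exists_bound_of_continuous hφ
  obtain ⟨R, hR⟩ := hc.isBounded.subset_closedBall (0 : ℝ × RSpace d)
  have hM0 : 0 ≤ M := (norm_nonneg _).trans (hM 0)
  have hind : Integrable ((Metric.closedBall (0 : RSpace d) R).indicator (fun _ => (M : ℂ))) :=
    (integrable_indicator_iff Metric.isClosed_closedBall.measurableSet).2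
      (integrableOn_const measure_closedBall_lt_top.ne)
  refine (integrable_pairProd_mul hf h2 hind).mono ?_ (Filter.Eventually.of_forall fun p => ?_)
  · refine Measurable.aestronglyMeasurable ?_
    have h1 := measurable_pairProd hf
    have h3 := hφ.measurable
    unfold energy
    fun_prop
  · rw [norm_mul, norm_mul]
    refine mul_le_mul_of_nonneg_left ?_ (norm_nonneg _)
    by_cases h : p.1 ∈ Metric.closedBall (0 : RSpace d) R
    · rw [Set.indicator_of_mem h]
      refine (hM _).trans (le_of_eq ?_)
      simp [abs_of_nonneg hM0]
    · rw [Set.indicator_of_notMem h, norm_zero, norm_le_zero_iff]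
      by_contra hne
      refine h ?_
      have := hR (subset_tsupport _ hne)
      rw [mem_closedBall_zero_iff] at this ⊢
      exact (norm_snd_le (-energy p, p.1)).trans this

/-- The test function is evaluated at a point depending only on `(ξ, r)`, so in polar coordinates it
leaves the integral over `θ`, and the spherical integral appears. -/
theorem integral_spectralDensity_mul (hd : 2 ≤ d) {f : RSpace d → ℂ} (hf : Measurable f)
    (h2 : MemLp f 2) {φ : ℝ × RSpace d → ℂ} (hφ : Continuous φ) (hc : HasCompactSupport φ) :
    ((((2 * Real.pi) ^ d)⁻¹ * (2 * Real.pi) : ℝ) : ℂ) *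
          ∫ p, pairProd f p * φ (-energy p, p.1) = ∫ p, spectralDensity f p * φ p := by
  have hH := integrable_pairProd_mul_energy hf h2 hφ hc
  have hP := measurePreserving_polarMap hd
  have hHc := hP.integrable_comp_of_integrable hH
  have e1 : ∫ p, pairProd f p * φ (-energy p, p.1) =
      ∫ q, ∫ θ, pairProd f (polarMap (q, θ)) *
        φ (-energy (polarMap (q, θ)), (polarMap (q, θ)).1) ∂surf d
        ∂((volume : Measure (RSpace d)).prod (polarMeasure d)) := by
    refine Eq.trans ?_ (integral_prod _ hHc)
    conv_lhs => rw [← hP.map_eq]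
    rw [integral_map measurable_polarMap.aemeasurable (by rw [hP.map_eq]; exact hH.1)]
    rfl
  have e2 : ∫ p, spectralDensity f p * φ p =
      ∫ q, spectralDensity f (freqMap q) * φ (freqMap q)
        ∂((volume : Measure (RSpace d)).prod radialMeasure) := by
    have hm := ((measurable_spectralDensity hf).mul hφ.measurable).aestronglyMeasurable
      (μ := volume.restrict {p : ℝ × RSpace d | p.1 + ‖p.2‖ ^ 2 / 2 < 0})
    have h0 : ∫ p, spectralDensity f p * φ p =
        ∫ p in {p : ℝ × RSpace d | p.1 + ‖p.2‖ ^ 2 / 2 < 0}, spectralDensity f p * φ p := by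
      refine (setIntegral_eq_integral_of_forall_compl_eq_zero fun p hp => ?_).symm
      rw [spectralDensity, if_neg (by exact hp), zero_mul]
    rw [h0, ← measurePreserving_freqMap.map_eq, integral_map measurable_freqMap.aemeasurable]
    rw [measurePreserving_freqMap.map_eq]
    exact hm
  rw [e1, e2, polarMeasure, prod_withDensity_right (by fun_prop),
    integral_withDensity_eq_integral_toReal_smul (by fun_prop)
      (Filter.Eventually.of_forall fun _ => ENNReal.ofReal_lt_top), ← integral_const_mul]
  refine integral_congr_ae ?_
  filter_upwards [ae_pos_snd] with q hq
  simp only [energy_polarMap hq, integral_mul_const]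
  rw [ENNReal.toReal_ofReal (by positivity), spectralDensity_freqMap f hq, Complex.real_smul]
  rw [sphMean]
  push_cast
  ring

/-- The space-time Fourier transform of `u²` is a locally integrable function. -/
theorem IsSchrodingerSolution.isSpaceTimeFourier (hd : 2 ≤ d) {u₀ : L2Space d}
    {u : ℝ → L2Space d} (hu : IsSchrodingerSolution u₀ u) :
    IsSpaceTimeFourier (fun t x => u t x ^ 2) (spectralDensity (hatL2 u₀)) where
  slice_integrable t := by
    have := (Lp.memLp (u t)).integrable_mul (Lp.memLp (u t))
    exact this.congr (Filter.Eventually.of_forall fun x => (sq _).symm)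
  locallyIntegrable := locallyIntegrable_spectralDensity hd (measurable_hatL2 u₀) (memLp_hatL2 u₀)
  pairing φ hφ hc := by
    have h := hu.integral_pairing hφ hc
    refine ⟨h.1, h.2.trans ?_⟩
    exact integral_spectralDensity_mul hd (measurable_hatL2 u₀) (memLp_hatL2 u₀) hφ.continuous hc

theorem IsSpaceTimeFourier.ae_eq {F : ℝ → RSpace d → ℂ} {W W' : ℝ × RSpace d → ℂ}
    (h : IsSpaceTimeFourier F W) (h' : IsSpaceTimeFourier F W') : W =ᵐ[volume] W' := by
  refine ae_eq_of_integral_contDiff_smul_eq h.locallyIntegrable h'.locallyIntegrable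
    fun g hg hc => ?_
  have hg' : ContDiff ℝ ∞ (fun p => (g p : ℂ)) := Complex.ofRealCLM.contDiff.comp hg
  have hc' : HasCompactSupport (fun p => (g p : ℂ)) :=
    hc.comp_left (g := ((↑) : ℝ → ℂ)) (by simp)
  have := (h.pairing _ hg' hc').2.symm.trans (h'.pairing _ hg' hc').2
  simpa only [Complex.real_smul, mul_comm] using this

theorem IsSpaceTimeFourier.dispersiveNormSq_eq {F : ℝ → RSpace d → ℂ} {W : ℝ × RSpace d → ℂ}
    (h : IsSpaceTimeFourier F W) (β : ℝ) :
    dispersiveNormSq β F = ENNReal.ofReal (((2 * Real.pi) ^ (d + 1))⁻¹) *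
      ∫⁻ p : ℝ × RSpace d, ‖((|p.1 + ‖p.2‖ ^ 2 / 2| ^ β : ℝ) : ℂ) * W p‖ₑ ^ 2 := by
  refine le_antisymm (iInf₂_le W h) (le_iInf₂ fun W' h' => le_of_eq ?_)
  congr 1
  refine lintegral_congr_ae ?_
  filter_upwards [h.ae_eq h'] with p hp
  rw [hp]

/-- The squared density carries `r^(2(d-2))/16` and the measure is `4r dr`. Comparing the weight
with its value at `β = (2-d)/4` turns these into `r^(d-1) dr` times a constant, which isolates the
surplus exponent `β - (2-d)/4`. -/
theorem lintegral_weight_spectralDensity (hd : 2 ≤ d) {f : RSpace d → ℂ} (hf : Measurable f)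
    (β : ℝ) :
    ∫⁻ p : ℝ × RSpace d, ‖((|p.1 + ‖p.2‖ ^ 2 / 2| ^ β : ℝ) : ℂ) * spectralDensity f p‖ₑ ^ 2 =
      ENNReal.ofReal (((((2 * Real.pi) ^ d)⁻¹ * (2 * Real.pi)) ^ 2) / 4 * 2 ^ ((2 - d : ℝ) / 2)) *
        ∫⁻ q, ENNReal.ofReal ((2 * q.2 ^ 2) ^ (2 * (β - (2 - d : ℝ) / 4))) * ‖sphMean f q‖ₑ ^ 2
          ∂((volume : Measure (RSpace d)).prod (polarMeasure d)) := by
  have hm : Measurable fun q : RSpace d × ℝ =>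
      ENNReal.ofReal ((2 * q.2 ^ 2) ^ (2 * (β - (2 - d : ℝ) / 4))) * ‖sphMean f q‖ₑ ^ 2 := by
    have := (stronglyMeasurable_sphMean hf).measurable
    fun_prop
  have h1 : ∀ p : ℝ × RSpace d,
      ‖((|p.1 + ‖p.2‖ ^ 2 / 2| ^ β : ℝ) : ℂ) * spectralDensity f p‖ₑ ^ 2 =
      ENNReal.ofReal (|p.1 + ‖p.2‖ ^ 2 / 2| ^ β) ^ 2 * ‖spectralDensity f p‖ₑ ^ 2 := by
    intro p
    rw [enorm_mul, mul_pow, ← ofReal_norm, Complex.norm_real,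
      Real.norm_of_nonneg (by positivity)]
  simp only [h1]
  rw [lintegral_spectral (w := fun p => ENNReal.ofReal (|p.1 + ‖p.2‖ ^ 2 / 2| ^ β) ^ 2) hf
    (by fun_prop) 2 two_ne_zero, polarMeasure, prod_withDensity_right (by fun_prop),
    lintegral_withDensity_eq_lintegral_mul _ (by fun_prop) hm,
    ← lintegral_const_mul' _ _ ENNReal.ofReal_ne_top]
  refine lintegral_congr_ae ?_
  filter_upwards [ae_pos_snd] with q hq
  have hr2 : 0 < 2 * q.2 ^ 2 := by positivity
  have e : (freqMap q).1 + ‖(freqMap q).2‖ ^ 2 / 2 = -(2 * q.2 ^ 2) := by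
    simp only [freqMap]; ring
  rw [e, abs_neg, abs_of_pos hr2, spectralDensity_freqMap f hq, enorm_mul, mul_pow,
    ← ofReal_norm, Complex.norm_real, Real.norm_of_nonneg (by positivity)]
  simp only [Pi.mul_apply]
  rw [← ENNReal.ofReal_pow (by positivity), ← ENNReal.ofReal_pow (by positivity),
    ← mul_assoc (ENNReal.ofReal _), ← ENNReal.ofReal_mul (by positivity),
    ← mul_assoc (ENNReal.ofReal _), ← mul_assoc (ENNReal.ofReal _ * ENNReal.ofReal _),
    ← ENNReal.ofReal_mul (by positivity), ← ENNReal.ofReal_mul (by positivity)]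
  congr 2
  obtain ⟨k, rfl⟩ := Nat.exists_eq_add_of_le hd
  -- With `d = 2 + k`, this splits off the power of `2r²` that cancels one factor `r^k` of the
  -- squared density.
  have e3 : ((2 * q.2 ^ 2) ^ β) ^ 2 =
      (2 * q.2 ^ 2) ^ (2 * (β - (2 - ((2 + k : ℕ) : ℝ)) / 4)) *
        (2 ^ ((2 - ((2 + k : ℕ) : ℝ)) / 2) * (q.2 ^ k)⁻¹) := by
    have : (2 : ℝ) ^ ((2 - ((2 + k : ℕ) : ℝ)) / 2) * (q.2 ^ k)⁻¹ =
        (2 * q.2 ^ 2) ^ ((2 - ((2 + k : ℕ) : ℝ)) / 2) := by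
      rw [Real.mul_rpow (by norm_num) (by positivity)]
      congr 1
      rw [← Real.rpow_natCast q.2 2, ← Real.rpow_mul hq.le, ← Real.rpow_natCast q.2 k,
        ← Real.rpow_neg hq.le]
      congr 1
      push_cast; ring
    rw [this, ← Real.rpow_add hr2, ← Real.rpow_natCast, ← Real.rpow_mul hr2.le]
    congr 1
    push_cast; ring
  rw [e3, show 2 + k - 2 = k by omega]
  have hk : q.2 ^ k ≠ 0 := by positivity
  field_simp

end Multiplier

/-! ### Cauchy–Schwarz on spheres and its equality case -/

section CauchySchwarz

/-- The average is the orthogonal projection onto constants, so this is Pythagoras. The deficit in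
Cauchy–Schwarz becomes an explicit square, giving the inequality and its equality case together. -/
theorem integral_norm_sub_average_sq {α : Type*} [MeasurableSpace α] {σ : Measure α}
    [IsFiniteMeasure σ] (h0 : σ ≠ 0) {g : α → ℂ} (hg : MemLp g 2 σ) :
    ∫ x, ‖g x - (σ.real Set.univ)⁻¹ • ∫ y, g y ∂σ‖ ^ 2 ∂σ =
      ∫ x, ‖g x‖ ^ 2 ∂σ - (σ.real Set.univ)⁻¹ * ‖∫ y, g y ∂σ‖ ^ 2 := by
  have hS : σ.real Set.univ ≠ 0 := by
    rw [measureReal_def, ENNReal.toReal_ne_zero]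
    exact ⟨by simpa using h0, measure_ne_top _ _⟩
  have hi : Integrable g σ := hg.integrable (by norm_num)
  have hsq : Integrable (fun x => ‖g x‖ ^ 2) σ := hg.integrable_norm_pow (by norm_num)
  set c : ℂ := (σ.real Set.univ)⁻¹ • ∫ y, g y ∂σ with hc
  have e : ∀ x, ‖g x - c‖ ^ 2 = ‖g x‖ ^ 2 - 2 * inner ℝ c (g x) + ‖c‖ ^ 2 := by
    intro x
    rw [norm_sub_sq_real, real_inner_comm]
  have hin : Integrable (fun x => 2 * inner ℝ c (g x)) σ := (hi.const_inner c).const_mul 2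
  simp only [e]
  have hadd := integral_add (hsq.sub hin) (integrable_const (‖c‖ ^ 2))
  simp only [Pi.sub_apply] at hadd
  rw [hadd, integral_sub hsq hin, integral_const_mul,
    integral_inner hi, integral_const, hc, inner_smul_left, real_inner_self_eq_norm_sq, norm_smul]
  simp only [conj_trivial, smul_eq_mul, norm_inv, Real.norm_eq_abs, mul_pow, inv_pow, sq_abs]
  field_simp
  ring

theorem lintegral_enorm_sq_eq {α : Type*} [MeasurableSpace α] {σ : Measure α} {g : α → ℂ}
    (hg : MemLp g 2 σ) : ∫⁻ x, ‖g x‖ₑ ^ 2 ∂σ = ENNReal.ofReal (∫ x, ‖g x‖ ^ 2 ∂σ) := by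
  rw [ofReal_integral_eq_lintegral_ofReal (hg.integrable_norm_pow (by norm_num))
    (Filter.Eventually.of_forall fun x => by positivity)]
  refine lintegral_congr fun x => ?_
  rw [ENNReal.ofReal_pow (norm_nonneg _), ofReal_norm]

theorem memLp_two_of_lintegral {α : Type*} [MeasurableSpace α] {σ : Measure α} {g : α → ℂ}
    (hm : AEStronglyMeasurable g σ) (hg : ∫⁻ x, ‖g x‖ₑ ^ 2 ∂σ ≠ ⊤) : MemLp g 2 σ := by
  refine ⟨hm, ?_⟩
  rw [eLpNorm_lt_top_iff_lintegral_rpow_enorm_lt_top (by norm_num) (by norm_num)]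
  simpa using lt_top_iff_ne_top.2 hg

/-- The Cauchy–Schwarz inequality against the constant function. -/
theorem enorm_integral_sq_le {α : Type*} [MeasurableSpace α] {σ : Measure α}
    [IsFiniteMeasure σ] (h0 : σ ≠ 0) {g : α → ℂ} (hm : AEStronglyMeasurable g σ) :
    ‖∫ x, g x ∂σ‖ₑ ^ 2 ≤ σ Set.univ * ∫⁻ x, ‖g x‖ₑ ^ 2 ∂σ := by
  by_cases hg : ∫⁻ x, ‖g x‖ₑ ^ 2 ∂σ = ⊤
  · rw [hg, ENNReal.mul_top (by simpa using h0)]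
    exact le_top
  have hL := memLp_two_of_lintegral hm hg
  have h := integral_norm_sub_average_sq h0 hL
  have hnn : 0 ≤ ∫ x, ‖g x - (σ.real Set.univ)⁻¹ • ∫ y, g y ∂σ‖ ^ 2 ∂σ :=
    integral_nonneg fun x => by positivity
  have hS : 0 < σ.real Set.univ := by
    rw [measureReal_def]
    exact ENNReal.toReal_pos (by simpa using h0) (measure_ne_top _ _)
  rw [lintegral_enorm_sq_eq hL, ← ENNReal.ofReal_toReal (measure_ne_top σ Set.univ),
    ← ENNReal.ofReal_mul (by positivity), ← ofReal_norm, ← ENNReal.ofReal_pow (norm_nonneg _)]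
  refine ENNReal.ofReal_le_ofReal ?_
  rw [← measureReal_def, ← inv_mul_le_iff₀ hS]
  linarith

/-- The case of equality in the Cauchy–Schwarz inequality against the constant function. -/
theorem enorm_integral_sq_eq_iff {α : Type*} [MeasurableSpace α] {σ : Measure α}
    [IsFiniteMeasure σ] (h0 : σ ≠ 0) {g : α → ℂ} (hm : AEStronglyMeasurable g σ)
    (hg : ∫⁻ x, ‖g x‖ₑ ^ 2 ∂σ ≠ ⊤) :
    ‖∫ x, g x ∂σ‖ₑ ^ 2 = σ Set.univ * ∫⁻ x, ‖g x‖ₑ ^ 2 ∂σ ↔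
      ∀ᵐ x ∂σ, g x = (σ.real Set.univ)⁻¹ • ∫ y, g y ∂σ := by
  have hL := memLp_two_of_lintegral hm hg
  have h := integral_norm_sub_average_sq h0 hL
  have hS : 0 < σ.real Set.univ := by
    rw [measureReal_def]
    exact ENNReal.toReal_pos (by simpa using h0) (measure_ne_top _ _)
  have hsub : Integrable (fun x => ‖g x - (σ.real Set.univ)⁻¹ • ∫ y, g y ∂σ‖ ^ 2) σ :=
    (hL.sub (memLp_const _)).integrable_norm_pow (by norm_num)
  rw [lintegral_enorm_sq_eq hL, ← ENNReal.ofReal_toReal (measure_ne_top σ Set.univ),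
    ← ENNReal.ofReal_mul (by positivity), ← ofReal_norm, ← ENNReal.ofReal_pow (norm_nonneg _),
    ENNReal.ofReal_eq_ofReal_iff (by positivity)
      (mul_nonneg (by positivity) (integral_nonneg fun x => by positivity)),
    ← measureReal_def, ← inv_mul_eq_iff_eq_mul₀ hS.ne']
  have hiff := integral_eq_zero_iff_of_nonneg (fun x => by positivity) hsub
  rw [h] at hiff
  constructor
  · intro he
    have := hiff.1 (by rw [he, sub_self])
    filter_upwards [this] with x hx
    simpa [sub_eq_zero] using hx
  · intro he
    have : ∫ x, ‖g x‖ ^ 2 ∂σ - (σ.real Set.univ)⁻¹ * ‖∫ y, g y ∂σ‖ ^ 2 = 0 := by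
      refine hiff.2 ?_
      filter_upwards [he] with x hx
      simp [hx]
    linarith

variable {d : ℕ}

theorem surf_ne_zero (hd : 2 ≤ d) : surf d ≠ 0 := by
  have := nontrivial_RSpace hd
  exact Measure.toSphere_ne_zero _

theorem ae_pos_snd_polar :
    ∀ᵐ q ∂((volume : Measure (RSpace d)).prod (polarMeasure d)), 0 < q.2 :=
  Measure.quasiMeasurePreserving_snd.ae (ae_polarMeasure_pos d)

theorem measurable_pairProd_polar {f : RSpace d → ℂ} (hf : Measurable f) :
    Measurable fun q : (RSpace d × ℝ) × USphere d => pairProd f (polarMap q) :=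
  (measurable_pairProd hf).comp measurable_polarMap

theorem measurable_sphere_sq {f : RSpace d → ℂ} (hf : Measurable f) :
    Measurable fun q : RSpace d × ℝ => ∫⁻ θ, ‖pairProd f (polarMap (q, θ))‖ₑ ^ 2 ∂surf d :=
  ((measurable_pairProd_polar hf).enorm.pow_const 2).lintegral_prod_right'

theorem lintegral_weight_pairProd (hd : 2 ≤ d) {f : RSpace d → ℂ} (hf : Measurable f)
    {w : ℝ → ℝ≥0∞} (hw : Measurable w) :
    ∫⁻ p : RSpace d × RSpace d, w ‖p.2‖ * ‖pairProd f p‖ₑ ^ 2 =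
      ∫⁻ q, w q.2 * ∫⁻ θ, ‖pairProd f (polarMap (q, θ))‖ₑ ^ 2 ∂surf d
        ∂((volume : Measure (RSpace d)).prod (polarMeasure d)) := by
  have hm : Measurable fun p : RSpace d × RSpace d => w ‖p.2‖ * ‖pairProd f p‖ₑ ^ 2 := by
    have := measurable_pairProd hf
    fun_prop
  rw [← (measurePreserving_polarMap hd).lintegral_comp hm,
    lintegral_prod _ (by exact (hm.comp measurable_polarMap).aemeasurable)]
  refine lintegral_congr_ae ?_
  filter_upwards [ae_pos_snd_polar] with q hq
  have hmq : Measurable fun θ : USphere d => ‖pairProd f (polarMap (q, θ))‖ₑ ^ 2 :=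
    (((measurable_pairProd_polar hf).comp measurable_prodMk_left).enorm.pow_const 2)
  simp only [norm_polarMap_snd hq]
  rw [lintegral_const_mul _ hmq]

theorem enorm_sphMean_sq_le (hd : 2 ≤ d) {f : RSpace d → ℂ} (hf : Measurable f)
    (q : RSpace d × ℝ) : ‖sphMean f q‖ₑ ^ 2 ≤
      surf d Set.univ * ∫⁻ θ, ‖pairProd f (polarMap (q, θ))‖ₑ ^ 2 ∂surf d :=
  enorm_integral_sq_le (surf_ne_zero hd)
    ((measurable_pairProd_polar hf).comp measurable_prodMk_left).aestronglyMeasurable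

theorem lintegral_sphMean_le (hd : 2 ≤ d) {f : RSpace d → ℂ} (hf : Measurable f)
    {w : ℝ → ℝ≥0∞} (hw : Measurable w) :
    ∫⁻ q, w q.2 * ‖sphMean f q‖ₑ ^ 2 ∂((volume : Measure (RSpace d)).prod (polarMeasure d)) ≤
      surf d Set.univ * ∫⁻ p : RSpace d × RSpace d, w ‖p.2‖ * ‖pairProd f p‖ₑ ^ 2 := by
  rw [lintegral_weight_pairProd hd hf hw, ← lintegral_const_mul' _ _ (measure_ne_top _ _)]
  refine lintegral_mono fun q => ?_
  rw [mul_left_comm]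
  exact mul_le_mul_right (enorm_sphMean_sq_le hd hf q) _

/-- Equality holds in the bilinear estimate iff `f(ξ/2 + ζ) f(ξ/2 - ζ)` only depends on `ξ` and
`|ζ|`. -/
theorem lintegral_sphMean_eq_iff (hd : 2 ≤ d) {f : RSpace d → ℂ} (hf : Measurable f)
    {w : ℝ → ℝ≥0∞} (hw : Measurable w) (hw0 : ∀ r, 0 < r → w r ≠ 0) (hwt : ∀ r, w r ≠ ⊤)
    (hfin : ∫⁻ p : RSpace d × RSpace d, w ‖p.2‖ * ‖pairProd f p‖ₑ ^ 2 ≠ ⊤) :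
    ∫⁻ q, w q.2 * ‖sphMean f q‖ₑ ^ 2 ∂((volume : Measure (RSpace d)).prod (polarMeasure d)) =
      surf d Set.univ * ∫⁻ p : RSpace d × RSpace d, w ‖p.2‖ * ‖pairProd f p‖ₑ ^ 2 ↔
    ∃ h : RSpace d × ℝ → ℂ, ∀ᵐ p : RSpace d × RSpace d, pairProd f p = h (p.1, ‖p.2‖) := by
  have hle : ∀ q : RSpace d × ℝ, w q.2 * ‖sphMean f q‖ₑ ^ 2 ≤ w q.2 * (surf d Set.univ *
      ∫⁻ θ, ‖pairProd f (polarMap (q, θ))‖ₑ ^ 2 ∂surf d) :=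
    fun q => mul_le_mul_right (enorm_sphMean_sq_le hd hf q) _
  have hmB := measurable_sphere_sq hf
  have hmA := (stronglyMeasurable_sphMean hf).measurable
  have hP := measurePreserving_polarMap hd
  have hslice : ∀ q : RSpace d × ℝ, AEStronglyMeasurable
      (fun θ : USphere d => pairProd f (polarMap (q, θ))) (surf d) := fun q =>
    ((measurable_pairProd_polar hf).comp measurable_prodMk_left).aestronglyMeasurable
  rw [lintegral_weight_pairProd hd hf hw] at hfin ⊢
  -- Since the weight is positive for `r > 0`, a finite total forces almost every sphere integral to
  -- be finite, as the equality case requires.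
  have hBfin : ∀ᵐ q ∂((volume : Measure (RSpace d)).prod (polarMeasure d)),
      ∫⁻ θ, ‖pairProd f (polarMap (q, θ))‖ₑ ^ 2 ∂surf d ≠ ⊤ := by
    filter_upwards [ae_lt_top (by fun_prop) hfin, ae_pos_snd_polar] with q h1 hq htop
    rw [htop, ENNReal.mul_top (hw0 _ hq)] at h1
    exact lt_irrefl _ h1
  have hfin' : surf d Set.univ * ∫⁻ q, w q.2 * ∫⁻ θ, ‖pairProd f (polarMap (q, θ))‖ₑ ^ 2 ∂surf d
      ∂((volume : Measure (RSpace d)).prod (polarMeasure d)) ≠ ⊤ :=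
    ENNReal.mul_ne_top (measure_ne_top _ _) hfin
  rw [← lintegral_const_mul' _ _ (measure_ne_top _ _)] at hfin' ⊢
  simp only [mul_left_comm (surf d Set.univ)] at hfin' ⊢
  constructor
  · intro heq
    refine ⟨fun q => ((surf d).real Set.univ)⁻¹ • sphMean f q, ?_⟩
    -- The sphere-by-sphere inequality has equal finite integrals on both sides, so it is an
    -- equality on almost every sphere.
    have hae := ae_eq_of_ae_le_of_lintegral_le (Filter.Eventually.of_forall hle)
      (by rw [heq]; exact hfin') (by fun_prop) heq.ge
    have hset : MeasurableSet {p : RSpace d × RSpace d | pairProd f p =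
        ((surf d).real Set.univ)⁻¹ • sphMean f (p.1, ‖p.2‖)} := by
      have := measurable_pairProd hf
      refine measurableSet_eq_fun this ?_
      fun_prop
    rw [← hP.map_eq, ae_map_iff measurable_polarMap.aemeasurable hset]
    refine (Measure.ae_prod_iff_ae_ae (measurable_polarMap hset)).2 ?_
    filter_upwards [hae, hBfin, ae_pos_snd_polar] with q h1 h2 hq
    rw [ENNReal.mul_right_inj (hw0 _ hq) (hwt _)] at h1
    have h3 := (enorm_integral_sq_eq_iff (surf_ne_zero hd) (hslice q) h2).1 h1
    filter_upwards [h3] with θ hθ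
    rw [norm_polarMap_snd hq]
    exact hθ
  · rintro ⟨h, hh⟩
    have h1 := Measure.ae_ae_of_ae_prod (hP.quasiMeasurePreserving.ae hh)
    refine lintegral_congr_ae ?_
    filter_upwards [h1, hBfin, ae_pos_snd_polar] with q h1 h2 hq
    congr 1
    have h3 : ∀ᵐ θ ∂surf d, pairProd f (polarMap (q, θ)) = h q := by
      filter_upwards [h1] with θ hθ
      rw [hθ, norm_polarMap_snd hq]
      rfl
    refine (enorm_integral_sq_eq_iff (surf_ne_zero hd) (hslice q) h2).2 ?_
    have hS : (surf d).real Set.univ ≠ 0 := by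
      rw [measureReal_def, ENNReal.toReal_ne_zero]
      exact ⟨by simpa using surf_ne_zero hd, measure_ne_top _ _⟩
    rw [integral_congr_ae h3, integral_const, inv_smul_smul₀ hS]
    exact h3

end CauchySchwarz

/-! ### The constant, and the integrals over pairs -/

section Values

variable {d : ℕ}

theorem lintegral_hatL2_sq (u : L2Space d) :
    ∫⁻ ξ, ‖hatL2 u ξ‖ₑ ^ 2 = ENNReal.ofReal ((2 * Real.pi) ^ d) * ‖u‖ₑ ^ 2 := by
  have h1 : ∫⁻ ξ, ‖(𝓕 u : L2Space d) ξ‖ₑ ^ 2 = ‖u‖ₑ ^ 2 := by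
    rw [← ofReal_norm u, ← Lp.norm_fourier_eq u, ofReal_norm, Lp.enorm_def,
      eLpNorm_eq_lintegral_rpow_enorm_toReal (by norm_num) (by norm_num)]
    rw [← ENNReal.rpow_natCast, ← ENNReal.rpow_mul]
    norm_num
  have h2 := Measure.integral_comp_smul volume (fun ξ : RSpace d => ‖(𝓕 u : L2Space d) ξ‖ ^ 2)
    (2 * Real.pi)⁻¹
  rw [finrank_euclideanSpace_fin, abs_of_pos (by positivity), smul_eq_mul, inv_pow, inv_inv] at h2
  rw [lintegral_enorm_sq_eq (Lp.memLp _)] at h1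
  rw [lintegral_enorm_sq_eq (memLp_hatL2 u), ← h1, ← ENNReal.ofReal_mul (by positivity), ← h2]
  rfl

theorem surf_univ (hd : 2 ≤ d) : surf d Set.univ =
    ENNReal.ofReal (2 * Real.pi ^ ((d : ℝ) / 2) / Real.Gamma ((d : ℝ) / 2)) := by
  have : Nonempty (Fin d) := ⟨⟨0, by omega⟩⟩
  have hd0 : (0 : ℝ) < d := by have : 0 < d := by omega
                               exact_mod_cast this
  rw [surf, Measure.toSphere_apply_univ, finrank_euclideanSpace_fin, EuclideanSpace.volume_ball,
    ENNReal.ofReal_one, one_pow, one_mul, Fintype.card_fin, ← ENNReal.ofReal_natCast,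
    ← ENNReal.ofReal_mul (by positivity)]
  congr 1
  rw [Real.Gamma_add_one (by positivity), Real.sqrt_eq_rpow, ← Real.rpow_natCast,
    ← Real.rpow_mul Real.pi_pos.le]
  have := Real.Gamma_pos_of_pos (half_pos hd0)
  rw [one_div_mul_eq_div]
  field_simp

/-- The constant in front of the spherical means in the norm of `|𝔇|^β (u²)`. -/
noncomputable def bilinConst (d : ℕ) : ℝ :=
  ((2 * Real.pi) ^ (d + 1))⁻¹ *
    (((((2 * Real.pi) ^ d)⁻¹ * (2 * Real.pi)) ^ 2) / 4 * 2 ^ ((2 - d : ℝ) / 2))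

theorem bilinConst_pos (d : ℕ) : 0 < bilinConst d := by unfold bilinConst; positivity

/-- The two factors `(2π)^d` are the Plancherel constants converting `‖f‖⁴` into `‖u₀‖⁴`; the
surface area supplies `Γ(d/2)`. -/
theorem sharpConst_eq (hd : 2 ≤ d) : ENNReal.ofReal (bilinConst d) * (surf d Set.univ *
    (ENNReal.ofReal ((2 * Real.pi) ^ d) * ENNReal.ofReal ((2 * Real.pi) ^ d))) = sharpConst d := by
  have hd0 : (0 : ℝ) < d := by have : 0 < d := by omega
                               exact_mod_cast this
  have hG := Real.Gamma_pos_of_pos (half_pos hd0)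
  rw [surf_univ hd, ← ENNReal.ofReal_mul (by positivity), ← ENNReal.ofReal_mul (by positivity),
    ← ENNReal.ofReal_mul (bilinConst_pos d).le, sharpConst]
  congr 1
  have e1 : (2 : ℝ) ^ ((2 - 3 * (d : ℝ)) / 2) = 2 ^ ((2 - d : ℝ) / 2) * ((2 : ℝ) ^ d)⁻¹ := by
    rw [← Real.rpow_natCast, ← Real.rpow_neg (by norm_num), ← Real.rpow_add (by norm_num)]
    congr 1; ring
  have e2 : Real.pi ^ ((2 - (d : ℝ)) / 2) = Real.pi * Real.pi ^ ((d : ℝ) / 2) * (Real.pi ^ d)⁻¹ := by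
    nth_rewrite 2 [← Real.rpow_one Real.pi]
    rw [← Real.rpow_natCast, ← Real.rpow_neg Real.pi_pos.le, ← Real.rpow_add Real.pi_pos,
      ← Real.rpow_add Real.pi_pos]
    congr 1; ring
  rw [e1, e2, bilinConst]
  simp only [mul_pow, pow_succ]
  field_simp
  norm_num

theorem IsSchrodingerSolution.dispersiveNormSq_eq (hd : 2 ≤ d) {u₀ : L2Space d}
    {u : ℝ → L2Space d} (hu : IsSchrodingerSolution u₀ u) (β : ℝ) :
    dispersiveNormSq β (fun t x => u t x ^ 2) = ENNReal.ofReal (bilinConst d) *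
      ∫⁻ q, ENNReal.ofReal ((2 * q.2 ^ 2) ^ (2 * (β - (2 - d : ℝ) / 4))) *
        ‖sphMean (hatL2 u₀) q‖ₑ ^ 2 ∂((volume : Measure (RSpace d)).prod (polarMeasure d)) := by
  rw [(hu.isSpaceTimeFourier hd).dispersiveNormSq_eq,
    lintegral_weight_spectralDensity hd (measurable_hatL2 u₀), ← mul_assoc,
    ← ENNReal.ofReal_mul (by positivity), bilinConst]

theorem lintegral_comp_comMap {g : RSpace d × RSpace d → ℝ≥0∞} (hg : Measurable g) :
    ∫⁻ p, g (comMap p) = ∫⁻ x, ∫⁻ y, g (x, y) := by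
  rw [measurePreserving_comMap.lintegral_comp hg, Measure.volume_eq_prod,
    lintegral_prod _ hg.aemeasurable]

theorem enorm_pairProd (f : RSpace d → ℂ) (p : RSpace d × RSpace d) :
    ‖pairProd f p‖ₑ = ‖f (comMap p).1‖ₑ * ‖f (comMap p).2‖ₑ := enorm_mul _ _

theorem lintegral_pairProd_sq {f : RSpace d → ℂ} (hf : Measurable f) :
    ∫⁻ p, ‖pairProd f p‖ₑ ^ 2 = (∫⁻ x, ‖f x‖ₑ ^ 2) * ∫⁻ x, ‖f x‖ₑ ^ 2 := by
  simp only [enorm_pairProd]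
  rw [lintegral_comp_comMap (g := fun p => (‖f p.1‖ₑ * ‖f p.2‖ₑ) ^ 2) (by fun_prop)]
  simp only [mul_pow]
  rw [← lintegral_mul_const _ (by fun_prop)]
  exact lintegral_congr fun x => lintegral_const_mul _ (by fun_prop)

theorem lintegral_weight_pairProd_sq {f : RSpace d → ℂ} (hf : Measurable f) :
    ∫⁻ p : RSpace d × RSpace d, ENNReal.ofReal (2 * ‖p.2‖ ^ 2) * ‖pairProd f p‖ₑ ^ 2 =
      ∫⁻ x, ∫⁻ y, ENNReal.ofReal (‖x - y‖ ^ 2 / 2 * (‖f x‖ ^ 2 * ‖f y‖ ^ 2)) := by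
  rw [← lintegral_comp_comMap (g := fun p =>
    ENNReal.ofReal (‖p.1 - p.2‖ ^ 2 / 2 * (‖f p.1‖ ^ 2 * ‖f p.2‖ ^ 2))) (by fun_prop)]
  refine lintegral_congr fun p => ?_
  have e : ‖pairProd f p‖ₑ ^ 2 =
      ENNReal.ofReal (‖f (comMap p).1‖ ^ 2 * ‖f (comMap p).2‖ ^ 2) := by
    rw [ENNReal.ofReal_mul (by positivity), ENNReal.ofReal_pow (norm_nonneg _),
      ENNReal.ofReal_pow (norm_nonneg _), ofReal_norm, ofReal_norm, enorm_pairProd, mul_pow]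
  rw [e, ← ENNReal.ofReal_mul (by positivity)]
  congr 2
  have : (comMap p).1 - (comMap p).2 = (2 : ℝ) • p.2 := by simp only [comMap]; module
  rw [this, norm_smul]
  norm_num
  ring

theorem integrable_norm_sq_smul {f : RSpace d → ℂ} (hf : Measurable f) (h2 : MemLp f 2)
    (hX : Integrable fun x => ‖x‖ ^ 2 * ‖f x‖ ^ 2) : Integrable fun x => (‖f x‖ ^ 2) • x := by
  have hN : Integrable (fun x => ‖f x‖ ^ 2) := h2.integrable_norm_pow (by norm_num)
  refine (hX.add hN).mono' (by fun_prop) (Filter.Eventually.of_forall fun x => ?_)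
  rw [norm_smul, Real.norm_of_nonneg (by positivity), Pi.add_apply]
  nlinarith [sq_nonneg (‖x‖ - 1), sq_nonneg ‖f x‖, norm_nonneg x,
    mul_nonneg (sq_nonneg ‖f x‖) (sq_nonneg (‖x‖ - 1)), mul_nonneg (sq_nonneg ‖f x‖) (sq_nonneg ‖x‖)]

/-- The energy of a pair of particles in terms of the total energy and the momentum. -/
theorem lintegral_pair_energy {f : RSpace d → ℂ} (hf : Measurable f) (h2 : MemLp f 2)
    (hX : Integrable fun x => ‖x‖ ^ 2 * ‖f x‖ ^ 2) :
    (∫⁻ x, ∫⁻ y, ENNReal.ofReal (‖x - y‖ ^ 2 / 2 * (‖f x‖ ^ 2 * ‖f y‖ ^ 2))) +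
        ENNReal.ofReal (‖∫ x, (‖f x‖ ^ 2) • x‖ ^ 2) =
      ENNReal.ofReal ((∫ x, ‖x‖ ^ 2 * ‖f x‖ ^ 2) * ∫ x, ‖f x‖ ^ 2) := by
  have hN : Integrable (fun x => ‖f x‖ ^ 2) := h2.integrable_norm_pow (by norm_num)
  have hP := integrable_norm_sq_smul hf h2 hX
  set X := ∫ x, ‖x‖ ^ 2 * ‖f x‖ ^ 2
  set N := ∫ x, ‖f x‖ ^ 2
  set P := ∫ x, (‖f x‖ ^ 2) • x with hPdef
  -- The square is polarised: the diagonal terms each give half of energy times mass, and the cross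
  -- term integrates to the squared momentum.
  have hexp : ∀ x y : RSpace d, ‖x - y‖ ^ 2 / 2 * (‖f x‖ ^ 2 * ‖f y‖ ^ 2) =
      (‖x‖ ^ 2 * ‖f x‖ ^ 2 / 2) * ‖f y‖ ^ 2 + (‖f x‖ ^ 2 / 2) * (‖y‖ ^ 2 * ‖f y‖ ^ 2) -
        inner ℝ ((‖f x‖ ^ 2) • x) ((‖f y‖ ^ 2) • y) := by
    intro x y
    rw [norm_sub_sq_real, real_inner_smul_left, real_inner_smul_right]
    ring
  have hiy : ∀ x : RSpace d, Integrable fun y => ‖x - y‖ ^ 2 / 2 * (‖f x‖ ^ 2 * ‖f y‖ ^ 2) := by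
    intro x
    simp only [hexp]
    exact ((hN.const_mul _).add (hX.const_mul _)).sub (hP.const_inner _)
  have hinner : ∀ x : RSpace d, ∫ y, ‖x - y‖ ^ 2 / 2 * (‖f x‖ ^ 2 * ‖f y‖ ^ 2) =
      (‖x‖ ^ 2 * ‖f x‖ ^ 2 / 2) * N + (‖f x‖ ^ 2 / 2) * X - inner ℝ P ((‖f x‖ ^ 2) • x) := by
    intro x
    simp only [hexp]
    have h1 := integral_sub ((hN.const_mul (‖x‖ ^ 2 * ‖f x‖ ^ 2 / 2)).add
      (hX.const_mul (‖f x‖ ^ 2 / 2))) (hP.const_inner ((‖f x‖ ^ 2) • x))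
    have h2 := integral_add (hN.const_mul (‖x‖ ^ 2 * ‖f x‖ ^ 2 / 2))
      (hX.const_mul (‖f x‖ ^ 2 / 2))
    simp only [Pi.add_apply] at h1
    rw [h1, h2, integral_const_mul, integral_const_mul, integral_inner hP, real_inner_comm P]
  have hout : Integrable fun x => (‖x‖ ^ 2 * ‖f x‖ ^ 2 / 2) * N + (‖f x‖ ^ 2 / 2) * X -
      inner ℝ P ((‖f x‖ ^ 2) • x) :=
    (((hX.div_const 2).mul_const N).add ((hN.div_const 2).mul_const X)).sub (hP.const_inner P)
  have hval : ∫ x, ((‖x‖ ^ 2 * ‖f x‖ ^ 2 / 2) * N + (‖f x‖ ^ 2 / 2) * X -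
      inner ℝ P ((‖f x‖ ^ 2) • x)) = X * N - ‖P‖ ^ 2 := by
    have h1 := integral_sub (((hX.div_const 2).mul_const N).add ((hN.div_const 2).mul_const X))
      (hP.const_inner P)
    have h2 := integral_add ((hX.div_const 2).mul_const N) ((hN.div_const 2).mul_const X)
    simp only [Pi.add_apply] at h1
    rw [h1, h2, integral_mul_const, integral_mul_const, integral_div, integral_div,
      integral_inner hP, real_inner_self_eq_norm_sq]
    ring
  have hnn : ∀ x y : RSpace d, 0 ≤ ‖x - y‖ ^ 2 / 2 * (‖f x‖ ^ 2 * ‖f y‖ ^ 2) := by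
    intro x y; positivity
  have e1 : ∀ x : RSpace d, ∫⁻ y, ENNReal.ofReal (‖x - y‖ ^ 2 / 2 * (‖f x‖ ^ 2 * ‖f y‖ ^ 2)) =
      ENNReal.ofReal ((‖x‖ ^ 2 * ‖f x‖ ^ 2 / 2) * N + (‖f x‖ ^ 2 / 2) * X -
        inner ℝ P ((‖f x‖ ^ 2) • x)) := by
    intro x
    rw [← ofReal_integral_eq_lintegral_ofReal (hiy x) (Filter.Eventually.of_forall (hnn x)),
      hinner]
  have hnn2 : ∀ x : RSpace d, 0 ≤ (‖x‖ ^ 2 * ‖f x‖ ^ 2 / 2) * N + (‖f x‖ ^ 2 / 2) * X -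
        inner ℝ P ((‖f x‖ ^ 2) • x) := fun x => by
    rw [← hinner]; exact integral_nonneg (hnn x)
  simp only [e1]
  rw [← ofReal_integral_eq_lintegral_ofReal hout (Filter.Eventually.of_forall hnn2), hval,
    ← ENNReal.ofReal_add (by rw [← hval]; exact integral_nonneg hnn2) (by positivity),
    sub_add_cancel]

end Values

/-! ### Solutions of the rectangle identity -/

section Rectangle

variable {d : ℕ}

/-- The rectangle identity `G(p) G(p + a + b) = G(p + a) G(p + b)` for orthogonal `a, b`. -/
def RectangleIdentity (G : RSpace d → ℂ) : Prop :=
  ∀ p a b : RSpace d, inner ℝ a b = 0 → G p * G (p + a + b) = G (p + a) * G (p + b)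

theorem exists_orthogonal_norm_eq (hd : 2 ≤ d) (v : RSpace d) :
    ∃ w : RSpace d, inner ℝ v w = 0 ∧ ‖w‖ = ‖v‖ := by
  rcases eq_or_ne v 0 with rfl | hv
  · exact ⟨0, inner_zero_left 0, rfl⟩
  have h1 := Submodule.finrank_add_finrank_orthogonal (Submodule.span ℝ {v})
  rw [finrank_span_singleton hv, finrank_euclideanSpace_fin] at h1
  have : Nontrivial (Submodule.span ℝ {v})ᗮ :=
    Module.finrank_pos_iff (R := ℝ).1 (by omega)
  obtain ⟨⟨w, hw⟩, hw0⟩ := exists_ne (0 : (Submodule.span ℝ {v})ᗮ)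
  have hw0 : ‖w‖ ≠ 0 := norm_ne_zero_iff.2 fun h => hw0 (Subtype.ext h)
  refine ⟨(‖v‖ / ‖w‖) • w, ?_, ?_⟩
  · rw [inner_smul_right, Submodule.mem_orthogonal_singleton_iff_inner_right.1 hw, mul_zero]
  · rw [norm_smul, norm_div, norm_norm, norm_norm, div_mul_cancel₀ _ hw0]

/-- Take the zero `z` nearest to `x₀` and the square having `z` and `x₀` as opposite vertices. The
identity forces a zero at one of the other two vertices, yet both are nearer to `x₀`, at distance
`|x₀ - z|/√2`. An orthogonal direction is needed for the square, hence `2 ≤ d`. -/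
theorem RectangleIdentity.ne_zero (hd : 2 ≤ d) {G : RSpace d → ℂ} (hG : RectangleIdentity G)
    (hc : Continuous G) {x₀ : RSpace d} (h0 : G x₀ ≠ 0) (x : RSpace d) : G x ≠ 0 := by
  intro hx
  have hcl : IsClosed {y | G y = 0} := isClosed_eq hc continuous_const
  obtain ⟨z, hz, hdist⟩ := hcl.exists_infDist_eq_dist ⟨x, hx⟩ x₀
  have hnear : ∀ y, dist x₀ y < dist x₀ z → G y ≠ 0 := fun y hy h =>
    absurd (Metric.infDist_le_dist_of_mem (x := x₀) (s := {y | G y = 0}) h) (by rw [hdist]; linarith)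
  obtain ⟨w, hw, hwn⟩ := exists_orthogonal_norm_eq hd (x₀ - z)
  set v := x₀ - z with hv
  have hvpos : 0 < ‖v‖ := by
    rw [norm_pos_iff, hv, sub_ne_zero]
    rintro rfl
    exact h0 hz
  have hhalf : ∀ s : ℝ, s = 1 ∨ s = -1 → dist x₀ (z + (2⁻¹ : ℝ) • (v + s • w)) < dist x₀ z := by
    intro s hs
    have e : x₀ - (z + (2⁻¹ : ℝ) • (v + s • w)) = (2⁻¹ : ℝ) • (v - s • w) := by
      rw [hv]; module
    rw [dist_eq_norm, dist_eq_norm, e, ← hv]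
    refine lt_of_pow_lt_pow_left₀ 2 (norm_nonneg _) ?_
    have hs2 : s ^ 2 = 1 := by rcases hs with rfl | rfl <;> norm_num
    rw [norm_smul, mul_pow, norm_sub_sq_real, real_inner_smul_right, hw, norm_smul, mul_pow, hwn]
    simp only [Real.norm_eq_abs, sq_abs, hs2]
    nlinarith
  have h1 := hnear _ (hhalf 1 (Or.inl rfl))
  have h2 := hnear _ (hhalf (-1) (Or.inr rfl))
  have horth : inner ℝ ((2⁻¹ : ℝ) • (v + (1 : ℝ) • w)) ((2⁻¹ : ℝ) • (v + (-1 : ℝ) • w)) = 0 := by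
    simp only [inner_smul_left, inner_smul_right, inner_add_left, inner_add_right,
      real_inner_self_eq_norm_sq, hw, real_inner_comm v w, hwn]
    simp
  have := hG z _ _ horth
  rw [show G z = 0 from hz, zero_mul] at this
  exact mul_ne_zero h1 h2 this.symm

/-- The logarithmic derivative of `G` in a fixed direction. -/
noncomputable def dirLogDeriv (G : RSpace d → ℂ) (w x : RSpace d) : ℂ := fderiv ℝ G x w / G x

/-- Differentiating the identity along the side `t • w` of a rectangle with other side `b` compares
the derivatives at `q` and `q + b`. -/
theorem RectangleIdentity.logDeriv_add {G : RSpace d → ℂ} (hG : RectangleIdentity G)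
    (hdiff : Differentiable ℝ G) (hne : ∀ x, G x ≠ 0) {w b : RSpace d} (hwb : inner ℝ w b = 0)
    (q : RSpace d) : dirLogDeriv G w (q + b) = dirLogDeriv G w q := by
  have hline : ∀ x : RSpace d, HasDerivAt (fun t : ℝ => G (x + t • w)) (fderiv ℝ G x w) 0 := by
    intro x
    have h1 : HasDerivAt (fun t : ℝ => x + t • w) w 0 := by
      simpa using ((hasDerivAt_id (0 : ℝ)).smul_const w).const_add x
    have h2 : HasFDerivAt G (fderiv ℝ G x) (x + (0 : ℝ) • w) := by
      simpa using (hdiff x).hasFDerivAt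
    exact h2.comp_hasDerivAt 0 h1
  have h1 := (hline (q + b)).const_mul (G q)
  have h2 := (hline q).mul_const (G (q + b))
  have e : (fun t : ℝ => G q * G (q + b + t • w)) = fun t : ℝ => G (q + t • w) * G (q + b) := by
    funext t
    rw [← hG q (t • w) b (by rw [inner_smul_left, hwb, mul_zero])]
    congr 2
    abel
  rw [e] at h1
  have h3 := h1.unique h2
  rw [dirLogDeriv, dirLogDeriv, div_eq_div_iff (hne _) (hne _)]
  linear_combination h3

/-- The quadratic exponential `exp(a|x|² + b·x + c)`. -/
noncomputable def quadExp (a c : ℂ) (b : Fin d → ℂ) (x : RSpace d) : ℂ :=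
  Complex.exp (a * ((‖x‖ ^ 2 : ℝ) : ℂ) + ∑ j, b j * (x j : ℂ) + c)

theorem continuous_additive_eq {A : ℝ → ℂ} (hA : Continuous A)
    (hadd : ∀ s t, A (s + t) = A s + A t) (s : ℝ) : A s = s * A 1 := by
  let L : ℝ →+ ℂ := AddMonoidHom.mk' A hadd
  have := map_real_smul L hA s 1
  simpa [L] using this

/-- Invariance under orthogonal translations makes the logarithmic derivative along `e i` a function
`m i` of the coordinate `x i` alone. The diagonal directions `e i + e j` then couple these
functions, forcing each to be affine with a common slope. -/
theorem RectangleIdentity.exists_logDeriv (hd : 2 ≤ d) {G : RSpace d → ℂ}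
    (hG : RectangleIdentity G) (hdiff : ContDiff ℝ 1 G) (hne : ∀ x, G x ≠ 0) :
    ∃ (α : ℂ) (β : Fin d → ℂ), ∀ (x : RSpace d) (i : Fin d),
      fderiv ℝ G x (EuclideanSpace.single i 1) = G x * (β i + 2 * α * x i) := by
  let e : Fin d → RSpace d := fun i => EuclideanSpace.single i 1
  let m : Fin d → ℝ → ℂ := fun i s => dirLogDeriv G (e i) (s • e i)
  have hdf : Differentiable ℝ G := hdiff.differentiable one_ne_zero
  have hee : ∀ i j, inner ℝ (e i) (e j) = if i = j then (1 : ℝ) else 0 := by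
    intro i j
    have := orthonormal_iff_ite.1 (EuclideanSpace.basisFun (Fin d) ℝ).orthonormal i j
    simpa [e] using this
  have hex : ∀ (i : Fin d) (x : RSpace d), inner ℝ (e i) x = x i := by
    intro i x
    simp [e, EuclideanSpace.inner_single_left]
  have hm : ∀ (i : Fin d) (x : RSpace d), dirLogDeriv G (e i) x = m i (x i) := by
    intro i x
    have h : inner ℝ (e i) (x - x i • e i) = 0 := by
      rw [inner_sub_right, inner_smul_right, hee, hex]; simp
    have := hG.logDeriv_add hdf hne h (x i • e i)
    rwa [add_sub_cancel] at this
  have hmc : ∀ i, Continuous (m i) := by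
    intro i
    have h1 : Continuous fun x => dirLogDeriv G (e i) x :=
      ((hdiff.continuous_fderiv one_ne_zero).clm_apply continuous_const).div hdiff.continuous hne
    exact h1.comp (continuous_id.smul continuous_const)
  -- The logarithmic derivative along `e i + e j` is unchanged by translation along the orthogonal
  -- vector `e i - e j`.
  have hsum : ∀ i j, i ≠ j → ∀ s t u : ℝ, m i s + m j t = m i (s + u) + m j (t - u) := by
    intro i j hij s t u
    have hw : ∀ x, dirLogDeriv G (e i + e j) x = m i (x i) + m j (x j) := by
      intro x
      rw [← hm, ← hm, dirLogDeriv, dirLogDeriv, dirLogDeriv, map_add, add_div]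
    have horth : inner ℝ (e i + e j) (u • (e i - e j)) = 0 := by
      simp only [inner_add_left, inner_sub_right, inner_smul_right, hee, hij, hij.symm, if_true,
        if_false]
      ring
    have := hG.logDeriv_add hdf hne horth (s • e i + t • e j)
    rw [hw, hw] at this
    simp only [← hex, inner_add_right, inner_smul_right, inner_sub_right, hee, hij, hij.symm,
      if_true, if_false] at this
    simp only [mul_one, mul_zero, add_zero, zero_add, sub_zero, zero_sub, mul_neg,
      ← sub_eq_add_neg] at this
    exact this.symm
  -- Taking `t = u` and comparing with `s = 0` eliminates `m j`, leaving Cauchy's additive equation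
  -- for `m i - m i 0`.
  have hjoin : ∀ i j, i ≠ j → ∀ s u, m i (s + u) - m i 0 = (m i s - m i 0) + (m i u - m i 0) := by
    intro i j hij s u
    have h1 := hsum i j hij s u u
    have h2 := hsum i j hij 0 u u
    rw [sub_self] at h1 h2
    rw [zero_add] at h2
    linear_combination h2 - h1
  have hother : ∀ i : Fin d, ∃ j, i ≠ j := by
    intro i
    have : Nontrivial (Fin d) := Fin.nontrivial_iff_two_le.2 hd
    obtain ⟨j, hj⟩ := exists_ne i
    exact ⟨j, hj.symm⟩
  have hlin : ∀ i s, m i s - m i 0 = s * (m i 1 - m i 0) := by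
    intro i s
    obtain ⟨j, hij⟩ := hother i
    exact continuous_additive_eq (A := fun s => m i s - m i 0) ((hmc i).sub continuous_const)
      (hjoin i j hij) s
  have hslope : ∀ i j, m i 1 - m i 0 = m j 1 - m j 0 := by
    intro i j
    by_cases hij : i = j
    · rw [hij]
    · have h2 := hsum i j hij 0 1 1
      rw [sub_self, zero_add] at h2
      linear_combination -h2
  let i₀ : Fin d := ⟨0, by omega⟩
  refine ⟨(m i₀ 1 - m i₀ 0) / 2, fun i => m i 0, fun x i => ?_⟩
  have h1 := hm i x
  have h2 := hlin i (x i)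
  rw [hslope i i₀] at h2
  rw [dirLogDeriv, div_eq_iff (hne x)] at h1
  change fderiv ℝ G x (e i) = _
  rw [h1]
  linear_combination (G x) * h2

theorem hasFDerivAt_quadratic (α : ℂ) (β : Fin d → ℂ) (x : RSpace d) :
    ∃ L : RSpace d →L[ℝ] ℂ,
      HasFDerivAt (fun x : RSpace d => α * ((‖x‖ ^ 2 : ℝ) : ℂ) + ∑ j, β j * (x j : ℂ)) L x ∧
      ∀ i, L (EuclideanSpace.single i 1) = β i + 2 * α * x i := by
  have h1 : HasFDerivAt (fun x : RSpace d => ((‖x‖ ^ 2 : ℝ) : ℂ))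
      (Complex.ofRealCLM.comp (2 • (innerSL ℝ x))) x :=
    Complex.ofRealCLM.hasFDerivAt.comp x (HasStrictFDerivAt.hasFDerivAt (hasStrictFDerivAt_norm_sq x))
  have h2 : ∀ j, HasFDerivAt (fun x : RSpace d => (x j : ℂ))
      (Complex.ofRealCLM.comp (EuclideanSpace.proj j : RSpace d →L[ℝ] ℝ)) x := fun j =>
    (Complex.ofRealCLM.comp (EuclideanSpace.proj j : RSpace d →L[ℝ] ℝ)).hasFDerivAt
  have h3 := (h1.const_mul α).add (HasFDerivAt.fun_sum (u := Finset.univ)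
    fun j _ => (h2 j).const_mul (β j))
  refine ⟨_, h3, fun i => ?_⟩
  simp [EuclideanSpace.inner_single_right, apply_ite Complex.ofReal]
  ring

/-- A continuously differentiable solution of the rectangle identity is a quadratic exponential. -/
theorem RectangleIdentity.exists_eq_quadExp (hd : 2 ≤ d) {G : RSpace d → ℂ}
    (hG : RectangleIdentity G) (hdiff : ContDiff ℝ 1 G) {x₀ : RSpace d} (h0 : G x₀ ≠ 0) :
    ∃ (α γ : ℂ) (β : Fin d → ℂ), G = quadExp α γ β := by
  have hne := hG.ne_zero hd hdiff.continuous h0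
  obtain ⟨α, β, hαβ⟩ := hG.exists_logDeriv hd hdiff hne
  set Q : RSpace d → ℂ := fun x => α * ((‖x‖ ^ 2 : ℝ) : ℂ) + ∑ j, β j * (x j : ℂ) with hQ
  -- `G` and `exp Q` have the same logarithmic derivative, so their quotient is constant.
  have hder : ∀ x, HasFDerivAt (fun x => G x * Complex.exp (-Q x)) (0 : RSpace d →L[ℝ] ℂ) x := by
    intro x
    obtain ⟨L, hL, hLe⟩ := hasFDerivAt_quadratic α β x
    have hGx : HasFDerivAt G (G x • L) x := by
      have h := (hdiff.differentiable one_ne_zero x).hasFDerivAt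
      have hlin : ((G x • L : RSpace d →L[ℝ] ℂ) : RSpace d →ₗ[ℝ] ℂ) = (fderiv ℝ G x) :=
        (EuclideanSpace.basisFun (Fin d) ℝ).toBasis.ext fun i => by simp [hLe, hαβ]
      rwa [ContinuousLinearMap.coe_injective hlin]
    refine (hGx.mul hL.neg.cexp).congr_fderiv ?_
    ext w
    simp
    ring
  have hconst := is_const_of_fderiv_eq_zero (𝕜 := ℝ) (fun x => (hder x).differentiableAt)
    (fun x => (hder x).fderiv)
  have hC : G x₀ * Complex.exp (-Q x₀) ≠ 0 := mul_ne_zero h0 (Complex.exp_ne_zero _)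
  refine ⟨α, Complex.log (G x₀ * Complex.exp (-Q x₀)), β, funext fun x => ?_⟩
  have h := hconst x x₀
  rw [quadExp, Complex.exp_add, Complex.exp_log hC, ← h]
  change G x = Complex.exp (Q x) * _
  rw [mul_left_comm, ← Complex.exp_add, add_neg_cancel, Complex.exp_zero, mul_one]

end Rectangle

/-! ### Gaussian integrals and transforms -/

section QuadExp

variable {d : ℕ}

theorem continuous_quadExp (a c : ℂ) (b : Fin d → ℂ) : Continuous (quadExp a c b) := by
  unfold quadExp; fun_prop

theorem quadExp_ne_zero (a c : ℂ) (b : Fin d → ℂ) (x : RSpace d) : quadExp a c b x ≠ 0 :=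
  Complex.exp_ne_zero _

theorem quadExp_mul (a c a' c' : ℂ) (b b' : Fin d → ℂ) (x : RSpace d) :
    quadExp a c b x * quadExp a' c' b' x = quadExp (a + a') (c + c') (b + b') x := by
  simp only [quadExp, ← Complex.exp_add, Pi.add_apply, add_mul, Finset.sum_add_distrib]
  congr 1
  ring

theorem norm_quadExp (a c : ℂ) (b : Fin d → ℂ) (x : RSpace d) :
    ‖quadExp a c b x‖ = Real.exp (a.re * ‖x‖ ^ 2 + ∑ j, (b j).re * x j + c.re) := by
  simp only [quadExp, Complex.norm_exp, Complex.add_re, Complex.re_mul_ofReal, Complex.re_sum]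

theorem quadExp_eq_sum (a c : ℂ) (b : Fin d → ℂ) (v : Fin d → ℝ) :
    quadExp a c b (WithLp.toLp 2 v) =
      Complex.exp c * Complex.exp (-(-a) * ∑ j, (v j : ℂ) ^ 2 + ∑ j, b j * v j) := by
  rw [quadExp, ← Complex.exp_add, EuclideanSpace.real_norm_sq_eq]
  congr 1
  push_cast
  ring

theorem integrable_quadExp {a : ℂ} (ha : a.re < 0) (c : ℂ) (b : Fin d → ℂ) :
    Integrable (quadExp a c b) := by
  rw [← (PiLp.volume_preserving_toLp (Fin d)).integrable_comp_emb
    (MeasurableEquiv.toLp 2 _).measurableEmbedding]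
  refine ((GaussianFourier.integrable_cexp_neg_mul_sum_add (b := -a) (by simpa using ha) b).const_mul
    (Complex.exp c)).congr (Filter.Eventually.of_forall fun v => ?_)
  exact (quadExp_eq_sum a c b v).symm

theorem integral_quadExp {a : ℂ} (ha : a.re < 0) (c : ℂ) (b : Fin d → ℂ) :
    ∫ x, quadExp a c b x = Complex.exp c * ((Real.pi / -a) ^ ((d : ℂ) / 2) *
      Complex.exp ((∑ j, b j ^ 2) / (4 * -a))) := by
  rw [← (PiLp.volume_preserving_toLp (Fin d)).integral_comp
    (MeasurableEquiv.toLp 2 _).measurableEmbedding]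
  simp only [quadExp_eq_sum]
  rw [integral_const_mul, GaussianFourier.integral_cexp_neg_mul_sum_add (by simpa using ha),
    Fintype.card_fin]

theorem norm_quadExp_sq (a c : ℂ) (b : Fin d → ℂ) (x : RSpace d) :
    ‖quadExp a c b x‖ ^ 2 = ‖quadExp (a + a) (c + c) (b + b) x‖ := by
  rw [← quadExp_mul, norm_mul, sq]

theorem memLp_quadExp {a : ℂ} (ha : a.re < 0) (c : ℂ) (b : Fin d → ℂ) :
    MemLp (quadExp a c b) 2 := by
  rw [memLp_two_iff_integrable_sq_norm (continuous_quadExp a c b).aestronglyMeasurable]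
  simp only [norm_quadExp_sq]
  exact (integrable_quadExp (by simpa using ha) _ _).norm

theorem integrable_norm_sq_mul_quadExp {a : ℂ} (ha : a.re < 0) (c : ℂ) (b : Fin d → ℂ) :
    Integrable fun x => ‖x‖ ^ 2 * ‖quadExp a c b x‖ ^ 2 := by
  have hc := continuous_quadExp a c b
  -- With `s = -Re a · |x|²`, the bound `s ≤ exp s` trades the factor `|x|²` for half of the decay:
  -- the exponent `2a - Re a` still has real part `Re a < 0`.
  refine Integrable.mono' ((integrable_quadExp (a := a + (a - (a.re : ℂ))) (by simpa using ha)
    (c + c) (b + b)).norm.const_mul (-a.re)⁻¹) (by fun_prop) (Filter.Eventually.of_forall fun x => ?_)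
  rw [Real.norm_of_nonneg (by positivity), norm_quadExp_sq, norm_quadExp, norm_quadExp]
  have e : (a + (a - (a.re : ℂ))).re * ‖x‖ ^ 2 + ∑ j, ((b + b) j).re * x j + (c + c).re =
      -a.re * ‖x‖ ^ 2 + ((a + a).re * ‖x‖ ^ 2 + ∑ j, ((b + b) j).re * x j + (c + c).re) := by
    simp; ring
  rw [e, Real.exp_add (-a.re * ‖x‖ ^ 2), ← mul_assoc]
  have ha' : 0 < -a.re := by linarith
  refine mul_le_mul_of_nonneg_right ?_ (Real.exp_pos _).le
  rw [le_inv_mul_iff₀ ha']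
  have := Real.add_one_le_exp (-a.re * ‖x‖ ^ 2)
  linarith

/-- The product of the moduli at `x` and `-x` has no linear term, so if `Re a ≥ 0` it is bounded
below. By the arithmetic-geometric mean inequality a positive constant would then be integrable over
the whole space. -/
theorem re_neg_of_memLp_quadExp (hd : 2 ≤ d) {a c : ℂ} {b : Fin d → ℂ}
    (h : MemLp (quadExp a c b) 2) : a.re < 0 := by
  by_contra! ha
  have := nontrivial_RSpace hd
  have h1 : Integrable fun x => ‖quadExp a c b x‖ ^ 2 := h.integrable_norm_pow (by norm_num)
  have h2 : Integrable fun x => ‖quadExp a c b x‖ ^ 2 + ‖quadExp a c b (-x)‖ ^ 2 :=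
    h1.add h1.comp_neg
  have h3 : Integrable fun _ : RSpace d => 2 * Real.exp (c.re) ^ 2 := by
    refine h2.mono' (by fun_prop) (Filter.Eventually.of_forall fun x => ?_)
    rw [Real.norm_of_nonneg (by positivity)]
    have e : ‖quadExp a c b x‖ * ‖quadExp a c b (-x)‖ =
        Real.exp c.re ^ 2 * Real.exp (2 * (a.re * ‖x‖ ^ 2)) := by
      rw [norm_quadExp, norm_quadExp, ← Real.exp_add, ← Real.exp_nat_mul, ← Real.exp_add]
      congr 1
      simp [Finset.sum_neg_distrib]
      ring
    have h1 : 1 ≤ Real.exp (2 * (a.re * ‖x‖ ^ 2)) := Real.one_le_exp (by positivity)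
    nlinarith [sq_nonneg (‖quadExp a c b x‖ - ‖quadExp a c b (-x)‖),
      sq_nonneg (Real.exp c.re)]
  rw [integrable_const_iff] at h3
  rcases h3 with h3 | h3
  · exact absurd h3 (by positivity)
  · have := isFiniteMeasure_iff (volume : Measure (RSpace d)) |>.1 h3
    simp at this

theorem pairProd_quadExp (a c : ℂ) (b : Fin d → ℂ) (p : RSpace d × RSpace d) :
    pairProd (quadExp a c b) p =
      Complex.exp (a * ((‖p.1‖ ^ 2 / 2 + 2 * ‖p.2‖ ^ 2 : ℝ) : ℂ) + ∑ j, b j * (p.1 j : ℂ) + 2 * c) := by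
  have h := energy_eq p
  rw [energy] at h
  rw [pairProd, quadExp, quadExp, ← Complex.exp_add, h]
  congr 1
  have e : ∑ j, b j * (p.1 j : ℂ) = ∑ j, b j * ((((2⁻¹ : ℝ) • p.1 + p.2) j : ℝ) : ℂ) +
      ∑ j, b j * ((((2⁻¹ : ℝ) • p.1 - p.2) j : ℝ) : ℂ) := by
    rw [← Finset.sum_add_distrib]
    refine Finset.sum_congr rfl fun j _ => ?_
    simp
    ring
  rw [e]
  push_cast
  ring

/-- The inverse Fourier transform of a gaussian is a gaussian. -/
theorem exists_fourierInv_quadExp {α : ℂ} (hα : α.re < 0) (γ : ℂ) (β : Fin d → ℂ) :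
    ∃ (a c : ℂ) (b : Fin d → ℂ), 𝓕⁻ (quadExp α γ β) = quadExp a c b := by
  have hα0 : α ≠ 0 := by rintro rfl; simp at hα
  have hπ : (Real.pi : ℂ) ≠ 0 := by exact_mod_cast Real.pi_ne_zero
  set C : ℂ := (Real.pi / -α) ^ ((d : ℂ) / 2) with hC
  have hC0 : C ≠ 0 := by
    rw [hC, Ne, Complex.cpow_eq_zero_iff]
    exact fun h => div_ne_zero hπ (neg_ne_zero.2 hα0) h.1
  -- The character shifts `β j` to `β j + 2πi v j`; these coefficients come from expanding its
  -- square in the gaussian integral, whose nonzero prefactor `C` is absorbed as `log C`.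
  refine ⟨Real.pi ^ 2 / α, γ + Complex.log C - (∑ j, β j ^ 2) / (4 * α),
    fun j => -(Complex.I * Real.pi * β j / α), funext fun v => ?_⟩
  have e : ∀ w : RSpace d, Real.fourierChar (inner ℝ w v) • quadExp α γ β w =
      quadExp α γ (fun j => β j + 2 * Real.pi * Complex.I * (v j : ℂ)) w := by
    intro w
    rw [Circle.smul_def, Real.fourierChar_apply, smul_eq_mul, quadExp, quadExp, ← Complex.exp_add]
    congr 1
    have : inner ℝ w v = ∑ j, v j * w j := by simp [PiLp.inner_apply]
    simp only [add_mul, Finset.sum_add_distrib]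
    rw [this]
    push_cast
    rw [Finset.mul_sum, Finset.sum_mul]
    rw [add_comm, add_assoc, add_assoc, add_assoc, add_assoc]
    congr 2
    rw [add_comm]
    congr 1
    exact Finset.sum_congr rfl fun j _ => by ring
  rw [Real.fourierInv_eq]
  simp only [e]
  rw [integral_quadExp hα, ← hC, quadExp]
  have hlog := Complex.exp_log hC0
  have e2 : (Real.pi : ℂ) ^ 2 / α * ((‖v‖ ^ 2 : ℝ) : ℂ) +
      ∑ j, -(Complex.I * Real.pi * β j / α) * (v j : ℂ) +
      (γ + Complex.log C - (∑ j, β j ^ 2) / (4 * α)) =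
      γ + (Complex.log C + (∑ j, (β j + 2 * Real.pi * Complex.I * (v j : ℂ)) ^ 2) / (4 * -α)) := by
    rw [EuclideanSpace.real_norm_sq_eq]
    push_cast
    rw [Finset.mul_sum, Finset.sum_div, Finset.sum_div]
    have : ∀ S T U V : ℂ, S + T - U = V → S + T + (γ + Complex.log C - U) = γ + (Complex.log C + V) := by
      intro S T U V h; linear_combination h
    apply this
    rw [← Finset.sum_add_distrib, ← Finset.sum_sub_distrib]
    refine Finset.sum_congr rfl fun j _ => ?_
    field_simp
    ring_nf
    simp only [Complex.I_sq]
    ring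
  rw [e2, Complex.exp_add, Complex.exp_add, hlog]

end QuadExp

/-! ### The functional equation `f(x) f(y) = h(x + y, |x - y|)` -/

section FunctionalEquation

variable {d : ℕ}

/-- The product `f(x) f(y)` depends only on `x + y` and `|x - y|`. -/
def RadialPairProd (f : RSpace d → ℂ) : Prop :=
  ∃ h : RSpace d × ℝ → ℂ, ∀ᵐ p : RSpace d × RSpace d, pairProd f p = h (p.1, ‖p.2‖)

theorem fourier_mul_fourier {f : RSpace d → ℂ} (hf : Measurable f) (ξ η : RSpace d) :
    𝓕 f ξ * 𝓕 f η = ∫ p : RSpace d × RSpace d,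
      (Real.fourierChar (-(inner ℝ p.1 ((2⁻¹ : ℝ) • (ξ + η)) + inner ℝ p.2 (ξ - η))) : ℂ) *
        pairProd f p := by
  have h : ∀ ζ : RSpace d, Continuous fun x : RSpace d => (Real.fourierChar (-(inner ℝ x ζ)) : ℂ) :=
    fun ζ => by fun_prop
  have hm : Measurable fun z : RSpace d × RSpace d =>
      ((Real.fourierChar (-(inner ℝ z.1 ξ)) : ℂ) * f z.1) *
        ((Real.fourierChar (-(inner ℝ z.2 η)) : ℂ) * f z.2) :=
    (((h ξ).measurable.comp measurable_fst).mul (hf.comp measurable_fst)).mul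
      (((h η).measurable.comp measurable_snd).mul (hf.comp measurable_snd))
  have hcov := integral_map (μ := volume) (φ := comMap) measurable_comMap.aemeasurable
    hm.aestronglyMeasurable
  rw [measurePreserving_comMap.map_eq, Measure.volume_eq_prod] at hcov
  rw [Real.fourier_eq, Real.fourier_eq, ← integral_prod_mul]
  refine hcov.trans (integral_congr_ae (Filter.Eventually.of_forall fun p => ?_))
  simp only [comMap, pairProd]
  rw [mul_mul_mul_comm, ← Circle.coe_mul, ← AddChar.map_add_eq_mul]
  congr 3
  simp only [inner_add_left, inner_sub_left, inner_add_right, inner_sub_right, inner_smul_left,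
    inner_smul_right]
  simp
  ring

/-- The reflection exchanging `Q` and `Q'`, applied to `ζ`, preserves volume and `|ζ|`, hence the
pair product almost everywhere. -/
theorem RadialPairProd.integral_eq {f : RSpace d → ℂ} (hr : RadialPairProd f)
    (P : RSpace d) {Q Q' : RSpace d} (hQ : ‖Q‖ = ‖Q'‖) :
    ∫ p : RSpace d × RSpace d, (Real.fourierChar (-(inner ℝ p.1 P + inner ℝ p.2 Q)) : ℂ) *
        pairProd f p =
      ∫ p : RSpace d × RSpace d, (Real.fourierChar (-(inner ℝ p.1 P + inner ℝ p.2 Q')) : ℂ) *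
        pairProd f p := by
  obtain ⟨h, hh⟩ := hr
  set R := (Submodule.span ℝ {Q - Q'})ᗮ.reflection with hR
  have hRQ : R Q = Q' := Submodule.reflection_sub hQ
  have hpres : MeasurePreserving (Prod.map id R : RSpace d × RSpace d → _) :=
    (MeasurePreserving.id volume).prod R.measurePreserving
  have hemb : MeasurableEmbedding (Prod.map id R : RSpace d × RSpace d → _) :=
    ((Homeomorph.refl _).prodCongr R.toHomeomorph).measurableEmbedding
  rw [← hpres.integral_comp hemb (fun p : RSpace d × RSpace d =>
    (Real.fourierChar (-(inner ℝ p.1 P + inner ℝ p.2 Q')) : ℂ) * pairProd f p)]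
  refine integral_congr_ae ?_
  filter_upwards [hh, hpres.quasiMeasurePreserving.ae hh] with p h1 h2
  rw [h1, h2, ← hRQ]
  simp

/-- The product of transforms at two points depends only on their midpoint and their distance; the
diagonals of a rectangle share both. -/
theorem RadialPairProd.rectangleIdentity_fourier {f : RSpace d → ℂ} (hf : Measurable f)
    (hr : RadialPairProd f) : RectangleIdentity (𝓕 f) := by
  intro p a b hab
  rw [fourier_mul_fourier hf, fourier_mul_fourier hf]
  have e1 : p + (p + a + b) = p + a + (p + b) := by abel
  have e2 : p - (p + a + b) = -(a + b) := by abel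
  have e3 : p + a - (p + b) = a - b := by abel
  rw [e1, e2, e3]
  refine hr.integral_eq _ ?_
  rw [norm_neg]
  refine (sq_eq_sq₀ (norm_nonneg _) (norm_nonneg _)).1 ?_
  rw [norm_add_sq_real, norm_sub_sq_real, hab]
  ring

/-- The gaussian factors multiply to a function of the kinetic energy, which is radial in `ζ`. This
permits damping `f` without losing the equation. -/
theorem RadialPairProd.mul_quadExp {f : RSpace d → ℂ} (hr : RadialPairProd f) (a : ℂ) :
    RadialPairProd fun x => f x * quadExp a 0 0 x := by
  obtain ⟨h, hh⟩ := hr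
  refine ⟨fun q => h q * Complex.exp (a * ((‖q.1‖ ^ 2 / 2 + 2 * q.2 ^ 2 : ℝ) : ℂ)), ?_⟩
  filter_upwards [hh] with p hp
  have := pairProd_quadExp a 0 0 p
  simp only [Pi.zero_apply, zero_mul, Finset.sum_const_zero, add_zero, mul_zero] at this
  rw [← hp, ← this]
  simp only [pairProd]
  ring

theorem radialPairProd_quadExp (a c : ℂ) (b : Fin d → ℂ) : RadialPairProd (quadExp a c b) :=
  ⟨fun q => Complex.exp (a * ((‖q.1‖ ^ 2 / 2 + 2 * q.2 ^ 2 : ℝ) : ℂ) +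
    ∑ j, b j * (q.1 j : ℂ) + 2 * c), Filter.Eventually.of_forall fun p => pairProd_quadExp a c b p⟩

theorem RadialPairProd.congr_ae {f g : RSpace d → ℂ} (hr : RadialPairProd f) (h : f =ᵐ[volume] g) :
    RadialPairProd g := by
  obtain ⟨k, hk⟩ := hr
  exact ⟨k, by filter_upwards [hk, pairProd_congr_ae h] with p h1 h2; rw [← h2, h1]⟩

/-- A gaussian is an `L²` solution of the functional equation `f(x) f(y) = h(x + y, |x - y|)`, and
there are no others. -/
theorem RadialPairProd.exists_ae_eq_quadExp (hd : 2 ≤ d) {f : RSpace d → ℂ} (hf : Measurable f)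
    (h2 : MemLp f 2) (h0 : ¬ f =ᵐ[volume] 0) (hr : RadialPairProd f) :
    ∃ (a c : ℂ) (b : Fin d → ℂ), a.re < 0 ∧ f =ᵐ[volume] quadExp a c b := by
  have hneg : ((-1 : ℂ)).re < 0 := by simp
  have hEc : Continuous (quadExp (d := d) (-1) 0 0) := continuous_quadExp _ _ _
  set g : RSpace d → ℂ := fun x => f x * quadExp (-1) 0 0 x with hg
  have hgm : Measurable g := hf.mul hEc.measurable
  have hE2 : MemLp (quadExp (d := d) (-1) 0 0) 2 := memLp_quadExp hneg 0 0
  have hg1 : Integrable g := h2.integrable_mul hE2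
  have hE1 : ∀ x, ‖quadExp (d := d) (-1) 0 0 x‖ ≤ 1 := by
    intro x
    rw [norm_quadExp, Real.exp_le_one_iff]
    simp
  have hg2 : MemLp g 2 := h2.mono hgm.aestronglyMeasurable (Filter.Eventually.of_forall fun x => by
    rw [hg, norm_mul]
    exact mul_le_of_le_one_right (norm_nonneg _) (hE1 x))
  -- The first moment is the product of `f ∈ L²` with `|x| exp(-|x|²) ∈ L²`; it makes the transform
  -- of `g` continuously differentiable.
  have hgx : Integrable fun x => ‖x‖ * ‖g x‖ := by
    have hx2 : MemLp (fun x : RSpace d => ‖x‖ * ‖quadExp (d := d) (-1) 0 0 x‖) 2 := by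
      rw [memLp_two_iff_integrable_sq_norm (by fun_prop)]
      simpa [mul_pow] using integrable_norm_sq_mul_quadExp (d := d) hneg 0 0
    refine (h2.norm.integrable_mul hx2).congr (Filter.Eventually.of_forall fun x => ?_)
    simp only [hg, Pi.mul_apply, norm_mul]
    ring
  have hdiff : ContDiff ℝ 1 (𝓕 g) := by
    refine Real.contDiff_fourier (N := 1) fun n hn => ?_
    have : n ≤ 1 := by exact_mod_cast hn
    interval_cases n
    · simpa using hg1.norm
    · simpa using hgx
  have hinv : g =ᵐ[volume] (𝓕⁻ (𝓕 (hg2.toLp g) : L2Space d) : L2Space d) := by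
    rw [FourierTransform.fourierInv_fourier_eq]
    exact hg2.coeFn_toLp.symm
  have hGae := l2_fourier_ae_eq g hg1 hg2
  have hGne : ∃ ξ, 𝓕 g ξ ≠ 0 := by
    by_contra! hG
    apply h0
    have hz : (𝓕 (hg2.toLp g) : L2Space d) = 0 := by
      refine Lp.ext ?_
      filter_upwards [hGae, Lp.coeFn_zero ℂ 2 (volume : Measure (RSpace d))] with ξ h1 h3
      rw [h1, h3, hG ξ, Pi.zero_apply]
    have hz' : hg2.toLp g = 0 := by
      rw [← norm_eq_zero, ← Lp.norm_fourier_eq, hz, norm_zero]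
    filter_upwards [hg2.coeFn_toLp, Lp.coeFn_zero ℂ 2 (volume : Measure (RSpace d))] with x h1 h3
    rw [hz', h3] at h1
    exact (mul_eq_zero.1 h1.symm).resolve_right (quadExp_ne_zero _ _ _ _)
  obtain ⟨ξ₀, hξ₀⟩ := hGne
  obtain ⟨α, γ, β, hG⟩ :=
    ((hr.mul_quadExp (-1)).rectangleIdentity_fourier hgm).exists_eq_quadExp hd hdiff hξ₀
  rw [hG] at hGae
  have hQ2 : MemLp (quadExp α γ β) 2 := (memLp_congr_ae hGae).1 (Lp.memLp _)
  have hα := re_neg_of_memLp_quadExp hd hQ2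
  have hLp : (𝓕 (hg2.toLp g) : L2Space d) = hQ2.toLp _ :=
    Lp.ext (hGae.trans hQ2.coeFn_toLp.symm)
  rw [hLp] at hinv
  have hgae := hinv.trans (l2_fourierInv_ae_eq _ (integrable_quadExp hα γ β) hQ2)
  obtain ⟨a, c, b, habc⟩ := exists_fourierInv_quadExp hα γ β
  rw [habc] at hgae
  -- The damping is undone by multiplying with `exp(|x|²)`. Membership of `f` in `L²` then restores
  -- the sign of the real part of the leading coefficient.
  have hfae : f =ᵐ[volume] quadExp (a + 1) (c + 0) (b + 0) := by
    filter_upwards [hgae] with x hx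
    rw [← quadExp_mul, ← hx, hg]
    have := quadExp_mul (-1) 0 1 0 0 0 x
    rw [mul_assoc, this]
    simp [quadExp]
  exact ⟨_, _, _, re_neg_of_memLp_quadExp hd ((memLp_congr_ae hfae).1 h2), hfae⟩

end FunctionalEquation

/-! ### Gaussians with vanishing momentum -/

section Momentum

variable {d : ℕ}

theorem integral_norm_sq_smul_eq_zero {g : RSpace d → ℂ} (hg : ∀ x, ‖g (-x)‖ = ‖g x‖) :
    ∫ x, (‖g x‖ ^ 2) • x = 0 := by
  have h := integral_neg_eq_self (fun x : RSpace d => (‖g x‖ ^ 2) • x) volume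
  simp only [hg, smul_neg, integral_neg] at h
  have h2 : (2 : ℝ) • ∫ x, (‖g x‖ ^ 2) • x = 0 := by
    rw [two_smul]
    nth_rewrite 1 [← h]
    exact neg_add_cancel _
  exact (smul_eq_zero.1 h2).resolve_left two_ne_zero

/-- With `β = Re b`, the modulus of the gaussian is at least as large at `x` as at `-x` when `β·x ≥
0`. Symmetrising `β·x |g(x)|²` under `x ↦ -x` thus gives a nonnegative continuous function. Zero
momentum makes its integral vanish, so it is identically zero, and its value at `x = β` gives `β =
0`. -/
theorem re_eq_zero_of_integral_norm_sq_smul {a c : ℂ} {b : Fin d → ℂ} (ha : a.re < 0)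
    (h0 : ∫ x, (‖quadExp a c b x‖ ^ 2) • x = 0) (j : Fin d) : (b j).re = 0 := by
  set g := quadExp a c b with hg
  have hc : Continuous g := continuous_quadExp a c b
  set β : RSpace d := WithLp.toLp 2 fun j => (b j).re with hβ
  have hβx : ∀ x : RSpace d, ∑ j, (b j).re * x j = inner ℝ β x := by
    intro x
    simp [PiLp.inner_apply, hβ, mul_comm]
  have hi := integrable_norm_sq_smul hc.measurable (memLp_quadExp ha c b)
    (integrable_norm_sq_mul_quadExp ha c b)
  have h1 : ∫ x, inner ℝ β ((‖g x‖ ^ 2) • x) = 0 := by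
    rw [integral_inner hi, h0, inner_zero_right]
  have hi1 : Integrable fun x => inner ℝ β ((‖g x‖ ^ 2) • x) := hi.const_inner β
  have h2 : ∫ x, (inner ℝ β ((‖g x‖ ^ 2) • x) + inner ℝ β ((‖g (-x)‖ ^ 2) • (-x))) = 0 := by
    rw [integral_add hi1 hi1.comp_neg, h1,
      integral_neg_eq_self (fun x => inner ℝ β ((‖g x‖ ^ 2) • x)) volume, h1, add_zero]
  have hnorm : ∀ x : RSpace d, ‖g x‖ = Real.exp (a.re * ‖x‖ ^ 2 + inner ℝ β x + c.re) := by
    intro x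
    rw [hg, norm_quadExp, hβx]
  have h3 : ∀ x : RSpace d, 0 ≤ inner ℝ β ((‖g x‖ ^ 2) • x) + inner ℝ β ((‖g (-x)‖ ^ 2) • (-x)) := by
    intro x
    rw [inner_smul_right, inner_smul_right, inner_neg_right, mul_neg, ← sub_eq_add_neg, ← sub_mul]
    rcases le_total 0 (inner ℝ β x) with h | h
    · refine mul_nonneg (sub_nonneg.2 (pow_le_pow_left₀ (norm_nonneg _) ?_ 2)) h
      rw [hnorm, hnorm, Real.exp_le_exp, norm_neg, inner_neg_right]
      linarith
    · refine mul_nonneg_of_nonpos_of_nonpos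
        (sub_nonpos.2 (pow_le_pow_left₀ (norm_nonneg _) ?_ 2)) h
      rw [hnorm, hnorm, Real.exp_le_exp, norm_neg, inner_neg_right]
      linarith
  have h4 := (integral_eq_zero_iff_of_nonneg h3 (hi1.add hi1.comp_neg)).1 h2
  have h5 := (Continuous.ae_eq_iff_eq volume (by fun_prop) continuous_zero).1 h4
  have h6 := congrFun h5 β
  simp only [Pi.zero_apply] at h6
  rw [inner_smul_right, inner_smul_right, inner_neg_right, mul_neg, ← sub_eq_add_neg, ← sub_mul,
    real_inner_self_eq_norm_sq, mul_eq_zero] at h6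
  have h7 : ‖β‖ ^ 2 = 0 := by
    rcases h6 with h | h
    · rw [sub_eq_zero, sq_eq_sq₀ (norm_nonneg _) (norm_nonneg _), hnorm, hnorm,
        Real.exp_eq_exp, norm_neg, inner_neg_right, real_inner_self_eq_norm_sq] at h
      linarith
    · exact h
  have h8 : β = 0 := by simpa using h7
  have := congrArg (fun v : RSpace d => v j) h8
  simpa [hβ] using this

theorem quadExp_I_mul (a c : ℂ) (b : Fin d → ℝ) : quadExp a c (fun j => Complex.I * b j) =
    fun η : RSpace d => Complex.exp
      (a * ((‖η‖ ^ 2 : ℝ) : ℂ) + Complex.I * ((∑ j, b j * η j : ℝ) : ℂ) + c) := by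
  funext η
  rw [quadExp]
  push_cast
  rw [Finset.mul_sum]
  simp only [mul_assoc]

theorem mem_radialGaussians_iff {g : RSpace d → ℂ} : g ∈ radialGaussians d ↔
    ∃ (a c : ℂ) (b : Fin d → ℂ), a.re < 0 ∧ (∀ j, (b j).re = 0) ∧ g = quadExp a c b := by
  constructor
  · rintro ⟨a, c, b, ha, rfl⟩
    exact ⟨a, c, fun j => Complex.I * b j, ha, by simp, (quadExp_I_mul a c b).symm⟩
  · rintro ⟨a, c, b, ha, hb, rfl⟩
    refine ⟨a, c, fun j => (b j).im, ha, ?_⟩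
    rw [← quadExp_I_mul]
    congr 1
    funext j
    apply Complex.ext <;> simp [hb]

theorem integral_quadExp_smul_eq_zero_iff {a c : ℂ} {b : Fin d → ℂ} (ha : a.re < 0) :
    ∫ x, (‖quadExp a c b x‖ ^ 2) • x = 0 ↔ ∀ j, (b j).re = 0 := by
  refine ⟨re_eq_zero_of_integral_norm_sq_smul ha, fun hb => integral_norm_sq_smul_eq_zero fun x => ?_⟩
  simp [norm_quadExp, hb]

end Momentum

/-! ### Initial data with gaussian transform -/

section Data

variable {d : ℕ}

theorem hatL2_ae_eq_zero_iff (u : L2Space d) : hatL2 u =ᵐ[volume] 0 ↔ u = 0 := by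
  have h := lintegral_hatL2_sq u
  have hc : ENNReal.ofReal ((2 * Real.pi) ^ d) ≠ 0 := by
    rw [Ne, ENNReal.ofReal_eq_zero, not_le]; positivity
  have h1 : ∫⁻ ξ, ‖hatL2 u ξ‖ₑ ^ 2 = 0 ↔ hatL2 u =ᵐ[volume] 0 := by
    rw [lintegral_eq_zero_iff ((measurable_hatL2 u).enorm.pow_const 2)]
    simp only [Filter.EventuallyEq, Pi.zero_apply, pow_eq_zero_iff two_ne_zero, enorm_eq_zero]
  rw [← h1, h, mul_eq_zero, or_iff_right hc, pow_eq_zero_iff two_ne_zero, enorm_eq_zero]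

theorem exists_hatL2_ae_eq {g : RSpace d → ℂ} (hg : MemLp g 2) :
    ∃ u : L2Space d, hatL2 u =ᵐ[volume] g := by
  have hs := memLp_comp_smul hg two_pi_pos.ne'
  refine ⟨𝓕⁻ (hs.toLp _), ?_⟩
  have h := (Measure.quasiMeasurePreserving_smul volume
    (inv_ne_zero two_pi_pos.ne')).ae_eq_comp hs.coeFn_toLp
  refine Filter.EventuallyEq.trans (Filter.Eventually.of_forall fun ξ => ?_)
    (h.trans (Filter.Eventually.of_forall fun ξ => ?_))
  · rw [hatL2, FourierTransform.fourier_fourierInv_eq]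
    rfl
  · simp only [Function.comp_apply]
    rw [smul_inv_smul₀ two_pi_pos.ne']

theorem not_quadExp_ae_eq_zero (a c : ℂ) (b : Fin d → ℂ) : ¬ quadExp a c b =ᵐ[volume] 0 := by
  intro h
  obtain ⟨x, hx⟩ := h.exists
  exact quadExp_ne_zero a c b x hx

theorem radialPairProd_hatL2_iff (hd : 2 ≤ d) (u : L2Space d) :
    u ≠ 0 ∧ RadialPairProd (hatL2 u) ↔
      ∃ (a c : ℂ) (b : Fin d → ℂ), a.re < 0 ∧ hatL2 u =ᵐ[volume] quadExp a c b := by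
  constructor
  · rintro ⟨h0, hr⟩
    exact hr.exists_ae_eq_quadExp hd (measurable_hatL2 u) (memLp_hatL2 u)
      (mt (hatL2_ae_eq_zero_iff u).1 h0)
  · rintro ⟨a, c, b, -, h⟩
    refine ⟨fun h0 => not_quadExp_ae_eq_zero a c b ?_, (radialPairProd_quadExp a c b).congr_ae h.symm⟩
    exact h.symm.trans ((hatL2_ae_eq_zero_iff u).2 h0)

theorem hatMem_gaussians_iff (hd : 2 ≤ d) (u : L2Space d) :
    HatMem u (gaussians d) ↔ u ≠ 0 ∧ RadialPairProd (hatL2 u) := by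
  rw [radialPairProd_hatL2_iff hd]
  constructor
  · rintro ⟨g, ⟨a, c, b, ha, rfl⟩, h⟩
    exact ⟨a, c, b, ha, h⟩
  · rintro ⟨a, c, b, ha, h⟩
    exact ⟨_, ⟨a, c, b, ha, rfl⟩, h⟩

end Data

/-! ### The sharp estimate for `L²` data -/

section SharpL2

variable {d : ℕ} {u₀ : L2Space d} {u : ℝ → L2Space d}

theorem sharpConst_mul_pow_four (hd : 2 ≤ d) (u₀ : L2Space d) : sharpConst d * ‖u₀‖ₑ ^ 4 =
    ENNReal.ofReal (bilinConst d) * (surf d Set.univ * ∫⁻ p, 1 * ‖pairProd (hatL2 u₀) p‖ₑ ^ 2) := by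
  simp only [one_mul]
  rw [lintegral_pairProd_sq (measurable_hatL2 u₀), lintegral_hatL2_sq, ← sharpConst_eq hd]
  ring

theorem ofReal_bilinConst_ne_zero (d : ℕ) : ENNReal.ofReal (bilinConst d) ≠ 0 := by
  rw [Ne, ENNReal.ofReal_eq_zero, not_le]
  exact bilinConst_pos d

theorem lintegral_pairProd_hatL2_ne_top (u₀ : L2Space d) :
    ∫⁻ p, 1 * ‖pairProd (hatL2 u₀) p‖ₑ ^ 2 ≠ ⊤ := by
  simp only [one_mul]
  rw [lintegral_pairProd_sq (measurable_hatL2 u₀), lintegral_hatL2_sq]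
  finiteness

theorem IsSchrodingerSolution.dispersiveNormSq_l2_eq (hd : 2 ≤ d)
    (hu : IsSchrodingerSolution u₀ u) :
    dispersiveNormSq ((2 - (d : ℝ)) / 4) (fun t x => (u t x) ^ 2) = ENNReal.ofReal (bilinConst d) *
      ∫⁻ q, 1 * ‖sphMean (hatL2 u₀) q‖ₑ ^ 2
        ∂((volume : Measure (RSpace d)).prod (polarMeasure d)) := by
  rw [hu.dispersiveNormSq_eq hd]
  simp only [sub_self, mul_zero, Real.rpow_zero, ENNReal.ofReal_one]

theorem IsSchrodingerSolution.dispersiveNormSq_l2_le (hd : 2 ≤ d)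
    (hu : IsSchrodingerSolution u₀ u) :
    dispersiveNormSq ((2 - (d : ℝ)) / 4) (fun t x => (u t x) ^ 2) ≤ sharpConst d * ‖u₀‖ₑ ^ 4 := by
  rw [hu.dispersiveNormSq_l2_eq hd, sharpConst_mul_pow_four hd]
  exact mul_le_mul_right (lintegral_sphMean_le hd (measurable_hatL2 u₀) measurable_const) _

theorem IsSchrodingerSolution.dispersiveNormSq_l2_eq_iff (hd : 2 ≤ d)
    (hu : IsSchrodingerSolution u₀ u) :
    dispersiveNormSq ((2 - (d : ℝ)) / 4) (fun t x => (u t x) ^ 2) = sharpConst d * ‖u₀‖ₑ ^ 4 ↔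
      RadialPairProd (hatL2 u₀) := by
  rw [hu.dispersiveNormSq_l2_eq hd, sharpConst_mul_pow_four hd,
    ENNReal.mul_right_inj (ofReal_bilinConst_ne_zero d) ENNReal.ofReal_ne_top]
  exact lintegral_sphMean_eq_iff hd (measurable_hatL2 u₀) (w := fun _ => 1) measurable_const
    (fun _ _ => one_ne_zero) (fun _ => ENNReal.one_ne_top) (lintegral_pairProd_hatL2_ne_top u₀)

end SharpL2

/-! ### The sharp estimate for `H¹` data -/

section SharpH1

variable {d : ℕ} {u₀ : L2Space d} {u : ℝ → L2Space d}

theorem homSobolevNormSq_one (u₀ : L2Space d) : homSobolevNormSq 1 u₀ =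
    ENNReal.ofReal (((2 * Real.pi) ^ d)⁻¹) *
      ∫⁻ ξ, ENNReal.ofReal (‖ξ‖ ^ 2 * ‖hatL2 u₀ ξ‖ ^ 2) := by
  rw [homSobolevNormSq]
  congr 1
  refine lintegral_congr fun ξ => ?_
  rw [Real.rpow_one, ← ofReal_norm, ← ENNReal.ofReal_pow (norm_nonneg _), norm_mul,
    Complex.norm_real, norm_norm, mul_pow]

theorem inH1_iff (u₀ : L2Space d) :
    InH1 u₀ ↔ Integrable fun ξ => ‖ξ‖ ^ 2 * ‖hatL2 u₀ ξ‖ ^ 2 := by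
  have hm := measurable_hatL2 u₀
  have hc : ENNReal.ofReal (((2 * Real.pi) ^ d)⁻¹) ≠ 0 := by
    rw [Ne, ENNReal.ofReal_eq_zero, not_le]; positivity
  have hma : AEStronglyMeasurable (fun ξ => ‖ξ‖ ^ 2 * ‖hatL2 u₀ ξ‖ ^ 2)
    (volume : Measure (RSpace d)) := by fun_prop
  rw [InH1, homSobolevNormSq_one, Integrable, and_iff_right hma,
    hasFiniteIntegral_iff_ofReal (Filter.Eventually.of_forall fun ξ => by positivity)]
  constructor
  · exact fun h => ENNReal.lt_top_of_mul_ne_top_right h.ne hc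
  · exact fun h => ENNReal.mul_lt_top ENNReal.ofReal_lt_top h

theorem sharpConst_mul_homSobolevNormSq (hd : 2 ≤ d) (h1 : InH1 u₀) :
    sharpConst d * (homSobolevNormSq 1 u₀ * ‖u₀‖ₑ ^ 2) = ENNReal.ofReal (bilinConst d) *
      (surf d Set.univ * ((∫⁻ p, ENNReal.ofReal (2 * ‖p.2‖ ^ 2) * ‖pairProd (hatL2 u₀) p‖ₑ ^ 2) +
        ENNReal.ofReal (‖∫ ξ, (‖hatL2 u₀ ξ‖ ^ 2) • ξ‖ ^ 2))) := by
  have hm := measurable_hatL2 u₀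
  have hX := (inH1_iff u₀).1 h1
  have hpos : 0 < (2 * Real.pi) ^ d := by positivity
  rw [lintegral_weight_pairProd_sq hm, lintegral_pair_energy hm (memLp_hatL2 u₀) hX,
    ENNReal.ofReal_mul (integral_nonneg fun ξ => by positivity),
    ← lintegral_enorm_sq_eq (memLp_hatL2 u₀), lintegral_hatL2_sq,
    ofReal_integral_eq_lintegral_ofReal hX (Filter.Eventually.of_forall fun ξ => by positivity),
    homSobolevNormSq_one, ← sharpConst_eq hd, ENNReal.ofReal_inv_of_pos hpos]
  have hcc : ENNReal.ofReal ((2 * Real.pi) ^ d) * (ENNReal.ofReal ((2 * Real.pi) ^ d))⁻¹ = 1 :=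
    ENNReal.mul_inv_cancel (by rw [Ne, ENNReal.ofReal_eq_zero, not_le]; exact hpos)
      ENNReal.ofReal_ne_top
  set c := ENNReal.ofReal ((2 * Real.pi) ^ d)
  set X := ∫⁻ ξ, ENNReal.ofReal (‖ξ‖ ^ 2 * ‖hatL2 u₀ ξ‖ ^ 2)
  -- Energy and mass bring only one factor `c`; the other Plancherel factor is cancelled by the
  -- `c⁻¹` in the Sobolev norm.
  calc _ = (c * c⁻¹) * (ENNReal.ofReal (bilinConst d) * (surf d Set.univ *
        (X * (c * ‖u₀‖ₑ ^ 2)))) := by ring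
    _ = _ := by rw [hcc, one_mul]

theorem IsSchrodingerSolution.dispersiveNormSq_h1_eq (hd : 2 ≤ d)
    (hu : IsSchrodingerSolution u₀ u) :
    dispersiveNormSq ((4 - (d : ℝ)) / 4) (fun t x => (u t x) ^ 2) = ENNReal.ofReal (bilinConst d) *
      ∫⁻ q, ENNReal.ofReal (2 * q.2 ^ 2) * ‖sphMean (hatL2 u₀) q‖ₑ ^ 2
        ∂((volume : Measure (RSpace d)).prod (polarMeasure d)) := by
  have e : 2 * ((4 - (d : ℝ)) / 4 - (2 - d) / 4) = 1 := by ring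
  rw [hu.dispersiveNormSq_eq hd, e]
  simp only [Real.rpow_one]

theorem lintegral_energy_le (hd : 2 ≤ d) (u₀ : L2Space d) :
    ∫⁻ q, ENNReal.ofReal (2 * q.2 ^ 2) * ‖sphMean (hatL2 u₀) q‖ₑ ^ 2
        ∂((volume : Measure (RSpace d)).prod (polarMeasure d)) ≤ surf d Set.univ *
      ∫⁻ p : RSpace d × RSpace d,
        ENNReal.ofReal (2 * ‖p.2‖ ^ 2) * ‖pairProd (hatL2 u₀) p‖ₑ ^ 2 :=
  lintegral_sphMean_le hd (measurable_hatL2 u₀) (w := fun r => ENNReal.ofReal (2 * r ^ 2))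
    (by fun_prop)

theorem IsSchrodingerSolution.dispersiveNormSq_h1_le (hd : 2 ≤ d) (h1 : InH1 u₀)
    (hu : IsSchrodingerSolution u₀ u) :
    dispersiveNormSq ((4 - (d : ℝ)) / 4) (fun t x => (u t x) ^ 2) ≤
      sharpConst d * (homSobolevNormSq 1 u₀ * ‖u₀‖ₑ ^ 2) := by
  rw [hu.dispersiveNormSq_h1_eq hd, sharpConst_mul_homSobolevNormSq hd h1]
  exact mul_le_mul_right ((lintegral_energy_le hd u₀).trans (mul_le_mul_right le_self_add _)) _

theorem lintegral_energy_ne_top (h1 : InH1 u₀) : ∫⁻ p : RSpace d × RSpace d,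
    ENNReal.ofReal (2 * ‖p.2‖ ^ 2) * ‖pairProd (hatL2 u₀) p‖ₑ ^ 2 ≠ ⊤ := by
  have h := lintegral_pair_energy (measurable_hatL2 u₀) (memLp_hatL2 u₀) ((inH1_iff u₀).1 h1)
  rw [lintegral_weight_pairProd_sq (measurable_hatL2 u₀)]
  exact ne_top_of_le_ne_top ENNReal.ofReal_ne_top (h ▸ le_self_add)

/-- Two nonnegative deficits separate the sides: the one from Cauchy–Schwarz and the squared
momentum. As the main term is finite, equality forces both to vanish. -/
theorem IsSchrodingerSolution.dispersiveNormSq_h1_eq_iff (hd : 2 ≤ d) (h1 : InH1 u₀)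
    (hu : IsSchrodingerSolution u₀ u) :
    dispersiveNormSq ((4 - (d : ℝ)) / 4) (fun t x => (u t x) ^ 2) =
        sharpConst d * (homSobolevNormSq 1 u₀ * ‖u₀‖ₑ ^ 2) ↔
      RadialPairProd (hatL2 u₀) ∧ ∫ ξ, (‖hatL2 u₀ ξ‖ ^ 2) • ξ = 0 := by
  have hfin := lintegral_energy_ne_top h1
  have hiff := lintegral_sphMean_eq_iff hd (measurable_hatL2 u₀)
    (w := fun r => ENNReal.ofReal (2 * r ^ 2)) (by fun_prop)
    (fun r hr => by rw [Ne, ENNReal.ofReal_eq_zero, not_le]; positivity)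
    (fun _ => ENNReal.ofReal_ne_top) hfin
  rw [hu.dispersiveNormSq_h1_eq hd, sharpConst_mul_homSobolevNormSq hd h1,
    ENNReal.mul_right_inj (ofReal_bilinConst_ne_zero d) ENNReal.ofReal_ne_top, RadialPairProd,
    ← hiff]
  have hle := lintegral_energy_le hd u₀
  have hS : surf d Set.univ ≠ 0 := by simpa using surf_ne_zero hd
  constructor
  · intro h
    have h2 : surf d Set.univ * _ ≤ surf d Set.univ * _ := h ▸ hle
    have h3 : ENNReal.ofReal (‖∫ ξ, (‖hatL2 u₀ ξ‖ ^ 2) • ξ‖ ^ 2) = 0 := by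
      rw [ENNReal.mul_le_mul_iff_right hS (measure_ne_top _ _)] at h2
      by_contra hne
      exact absurd h2 (not_le.2 (ENNReal.lt_add_right hfin hne))
    have h5 : ∫ ξ, (‖hatL2 u₀ ξ‖ ^ 2) • ξ = 0 := by
      rw [ENNReal.ofReal_eq_zero] at h3
      have := le_antisymm h3 (by positivity)
      simpa using this
    refine ⟨?_, h5⟩
    rw [h, h3, add_zero]
  · rintro ⟨h, h0⟩
    rw [h, h0]
    simp

theorem hatMem_radialGaussians_iff (hd : 2 ≤ d) (u₀ : L2Space d) :
    HatMem u₀ (radialGaussians d) ↔ InH1 u₀ ∧ u₀ ≠ 0 ∧ RadialPairProd (hatL2 u₀) ∧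
      ∫ ξ, (‖hatL2 u₀ ξ‖ ^ 2) • ξ = 0 := by
  have hmom : ∀ {a c : ℂ} {b : Fin d → ℂ}, hatL2 u₀ =ᵐ[volume] quadExp a c b →
      ∫ ξ, (‖hatL2 u₀ ξ‖ ^ 2) • ξ = ∫ ξ, (‖quadExp a c b ξ‖ ^ 2) • ξ := fun h =>
    integral_congr_ae (by filter_upwards [h] with ξ hξ; rw [hξ])
  constructor
  · rintro ⟨g, hg, h⟩
    obtain ⟨a, c, b, ha, hb, rfl⟩ := mem_radialGaussians_iff.1 hg
    obtain ⟨h0, hr⟩ := (radialPairProd_hatL2_iff hd u₀).2 ⟨a, c, b, ha, h⟩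
    refine ⟨(inH1_iff u₀).2 ?_, h0, hr, ?_⟩
    · refine (integrable_norm_sq_mul_quadExp ha c b).congr ?_
      filter_upwards [h] with ξ hξ
      rw [hξ]
    · rw [hmom h]
      exact (integral_quadExp_smul_eq_zero_iff ha).2 hb
  · rintro ⟨-, h0, hr, hP⟩
    obtain ⟨a, c, b, ha, h⟩ := (radialPairProd_hatL2_iff hd u₀).1 ⟨h0, hr⟩
    rw [hmom h] at hP
    exact ⟨_, mem_radialGaussians_iff.2
      ⟨a, c, b, ha, (integral_quadExp_smul_eq_zero_iff ha).1 hP, rfl⟩, h⟩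

theorem homSobolevNormSq_one_ne_zero (hd : 2 ≤ d) (h0 : u₀ ≠ 0) : homSobolevNormSq 1 u₀ ≠ 0 := by
  have := nontrivial_RSpace hd
  have hm := measurable_hatL2 u₀
  intro h
  rw [homSobolevNormSq_one, mul_eq_zero, or_iff_right (by
    rw [ENNReal.ofReal_eq_zero, not_le]; positivity), lintegral_eq_zero_iff (by fun_prop)] at h
  refine h0 ((hatL2_ae_eq_zero_iff u₀).1 ?_)
  filter_upwards [h, Measure.ae_ne volume 0] with ξ hξ hξ0
  rw [Pi.zero_apply, ENNReal.ofReal_eq_zero] at hξ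
  have h2 : 0 < ‖ξ‖ ^ 2 := by positivity
  have h3 : ‖hatL2 u₀ ξ‖ ^ 2 ≤ 0 := by
    by_contra! h3
    exact absurd hξ (not_le.2 (mul_pos h2 h3))
  have h4 := le_antisymm h3 (by positivity)
  simpa using h4

theorem exists_hatMem_radialGaussians (d : ℕ) : ∃ u₀ : L2Space d, HatMem u₀ (radialGaussians d) := by
  have hneg : ((-1 : ℂ)).re < 0 := by simp
  obtain ⟨u₀, h⟩ := exists_hatL2_ae_eq (memLp_quadExp (d := d) hneg 0 0)
  exact ⟨u₀, _, mem_radialGaussians_iff.2 ⟨-1, 0, 0, hneg, by simp, rfl⟩, h⟩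

end SharpH1

/-! ### Assembly of the estimates, optimal constants and extremisers -/

theorem corollary1p5 (d : ℕ) (hd : 2 ≤ d) :
    -- the estimate for data in `L²`
    (∀ (u₀ : L2Space d) (u : ℝ → L2Space d), IsSchrodingerSolution u₀ u →
      dispersiveNormSq ((2 - (d : ℝ)) / 4) (fun t x => (u t x) ^ 2) ≤ sharpConst d * ‖u₀‖ₑ ^ 4) ∧
    -- its constant is optimal
    (∀ C : ℝ≥0∞, (∀ (u₀ : L2Space d) (u : ℝ → L2Space d), IsSchrodingerSolution u₀ u →
      dispersiveNormSq ((2 - (d : ℝ)) / 4) (fun t x => (u t x) ^ 2) ≤ C * ‖u₀‖ₑ ^ 4) →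
      sharpConst d ≤ C) ∧
    -- its extremisers
    (∀ (u₀ : L2Space d) (u : ℝ → L2Space d), IsSchrodingerSolution u₀ u →
      ((u₀ ≠ 0 ∧
        dispersiveNormSq ((2 - (d : ℝ)) / 4) (fun t x => (u t x) ^ 2) =
          sharpConst d * ‖u₀‖ₑ ^ 4) ↔
        HatMem u₀ (gaussians d))) ∧
    -- the estimate for data in `H¹`
    (∀ (u₀ : L2Space d) (u : ℝ → L2Space d), InH1 u₀ → IsSchrodingerSolution u₀ u →
      dispersiveNormSq ((4 - (d : ℝ)) / 4) (fun t x => (u t x) ^ 2) ≤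
        sharpConst d * (homSobolevNormSq 1 u₀ * ‖u₀‖ₑ ^ 2)) ∧
    -- its constant is optimal
    (∀ C : ℝ≥0∞, (∀ (u₀ : L2Space d) (u : ℝ → L2Space d), InH1 u₀ → IsSchrodingerSolution u₀ u →
      dispersiveNormSq ((4 - (d : ℝ)) / 4) (fun t x => (u t x) ^ 2) ≤
        C * (homSobolevNormSq 1 u₀ * ‖u₀‖ₑ ^ 2)) →
      sharpConst d ≤ C) ∧
    -- its extremisers
    (∀ (u₀ : L2Space d) (u : ℝ → L2Space d), IsSchrodingerSolution u₀ u →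
      ((InH1 u₀ ∧ u₀ ≠ 0 ∧
        dispersiveNormSq ((4 - (d : ℝ)) / 4) (fun t x => (u t x) ^ 2) =
          sharpConst d * (homSobolevNormSq 1 u₀ * ‖u₀‖ₑ ^ 2)) ↔
        HatMem u₀ (radialGaussians d))) := by
  -- A gaussian with zero momentum attains equality in both estimates, so this single datum tests
  -- the optimality of both constants.
  obtain ⟨v₀, hv₀⟩ := exists_hatMem_radialGaussians d
  obtain ⟨v, hv⟩ := exists_isSchrodingerSolution v₀
  obtain ⟨hv1, hv0, hvr, hvP⟩ := (hatMem_radialGaussians_iff hd v₀).1 hv₀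
  have hvn : ‖v₀‖ₑ ≠ 0 := enorm_ne_zero.2 hv0
  refine ⟨fun u₀ u hu => hu.dispersiveNormSq_l2_le hd, fun C hC => ?_, fun u₀ u hu => ?_,
    fun u₀ u h1 hu => hu.dispersiveNormSq_h1_le hd h1, fun C hC => ?_, fun u₀ u hu => ?_⟩
  · have h := hC v₀ v hv
    rw [(hv.dispersiveNormSq_l2_eq_iff hd).2 hvr] at h
    exact (ENNReal.mul_le_mul_iff_left (pow_ne_zero 4 hvn) (by finiteness)).1 h
  · rw [hu.dispersiveNormSq_l2_eq_iff hd, hatMem_gaussians_iff hd]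
  · have h := hC v₀ v hv1 hv
    rw [(hv.dispersiveNormSq_h1_eq_iff hd hv1).2 ⟨hvr, hvP⟩] at h
    exact (ENNReal.mul_le_mul_iff_left
      (mul_ne_zero (homSobolevNormSq_one_ne_zero hd hv0) (pow_ne_zero 2 hvn))
      (ENNReal.mul_ne_top hv1.ne (by finiteness))).1 h
  · rw [hatMem_radialGaussians_iff hd]
    exact and_congr_right fun h1 => and_congr_right fun _ => hu.dispersiveNormSq_h1_eq_iff hd h1
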